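/- **Setting.** Let $S_{n+1}$ act on $\mathbb{R}^{n+1}$ by $\sigma e_i=e_{\sigma(i)}$, with simple transpositions $s_p=(p,p+1)$, simple roots $\alpha_p=e_p-e_{p+1}$, positive roots $e_i-e_j$ ($i<j$), fundamental weights $\omega_p=e_1+\dots+e_p$, and let $s_\beta=(i\,j)$ for $\beta=e_i-e_j$. For a word $Q=(q_1,\dots,q_m)$ in the simple transpositions and $w\in S_{n+1}$, the facets of the subword complex $\mathcal{SC}(Q,w)$ are the sets $J\subseteq[m]$ such that the subword of $Q$ at the positions $[m]\setminus J$ is a reduced expression for $w$. For $J\subseteq[m]$ and $k\in[m]$ let $\pi_{J,k}$ be the product, in order, of the letters $q_j$ with $j<k$, $j\notin J$. Writing $q_k=s_{p}$, put $r(J,k)=\pi_{J,k}(\alpha_{p})$ and $\omega(J,k)=\pi_{J,k}(\omega_{p})$, and define the brick vector $b(J)=-\sum_{k=1}^m\omega(J,k)$. Let $\operatorname{Dem}(Q)$ be the maximum in Bruhat order $\le_B$ (with cover relation $\prec_B$) of the products of subwords of $Q$. The brick polyhedron is $$\mathcal{B}(Q,w)=\operatorname{conv}\{b(J)\mid J\text{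 a facet of }\mathcal{SC}(Q,w)\}+\operatorname{cone}\{\beta\text{ a positive root}\mid w\prec_B s_\beta w\le_B\operatorname{Dem}(Q)\},$$ and for a face $I$ of $\mathcal{SC}(Q,w)$ (a subset of a facet) the modified brick polyhedron is $$\mathcal{B}^I(Q,w)=\operatorname{conv}\{b(J)\mid J\text{ a facet},\ I\subseteq J\}+\bigcap_{J\text{ a facet},\ I\subseteq J}\operatorname{cone}\{r(J,j)\mid j\in J\setminus I\}.$$ Let $\nu$ be a finite lattice path of east and north unit steps, and let $A_\nu$ be the set of lattice points weakly above $\nu$ in the smallest rectangle containing $\nu$. Two points of $A_\nu$ are $\nu$-incompatible if one is strictly southwest of the other and all lattice points of the rectangle they span lie in $A_\nu$; a $\nu$-tree is a maximal set of pairwise $\nu$-compatible (that is, not $\nu$-incompatible) points of $A_\nu$. An ascent of a $\nu$-tree $T$ is a node $q\in T$ such that $T$ contains a node north of $q$ in the same column and a node east of $q$ in the same row. For $p\in A_\nu$ let $d(p)$ be the lattice distance from $p$ to the top-left corner of the rectangle. Let $Q_\nu$ be the word with one letter $s_{d(p)+1}$ for each $p\in A_\nu$, read by columns from left to right and each column from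 bottom to top, in the group $S_{n+1}$ with $n=\max_{p\in A_\nu}d(p)+1$. Positions of $Q_\nu$ are identified with points of $A_\nu$. Let $w_\nu$ be the product of the letters of $Q_\nu$ in the complement of any $\nu$-tree (it does not depend on the $\nu$-tree). The $\nu$-brick polyhedron is $\mathcal{B}(Q_\nu,w_\nu)$. A face of a polyhedron is a nonempty set of all its points that minimize some linear functional on it. **Proposition.** Let $T$ be a $\nu$-tree, $A\subseteq T$ a set of ascents of $T$, and $I=T\setminus A$. Then the modified brick polyhedron $\mathcal{B}^I(Q_\nu,w_\nu)$ is a face of the $\nu$-brick polyhedron $\mathcal{B}(Q_\nu,w_\nu)$. Moreover, there is a linear functional $f$ with $$f(r(T,a))=0\ \text{ for all }a\in A,\qquad f(r(T,t))>0\ \text{ for all }t\in T\setminus A,$$ and for every such $f$ the set of points of $\mathcal{B}(Q_\nu,w_\nu)$ at which $f$ is minimal is exactly $\mathcal{B}^I(Q_\nu,w_\nu)$. -/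

import Mathlib

open scoped Pointwise

noncomputable section

namespace Brick

/-! ## Type `A`: the group `S_{n+1}` acting on `ℝ^{n+1}` (indices `0, …, n`) -/

/-- The simple transposition exchanging `p` and `p + 1`. -/
def simpleRefl {n : ℕ} (p : Fin n) : Equiv.Perm (Fin (n + 1)) :=
  Equiv.swap p.castSucc p.succ

/-- Permutations act on `ℝ^{n+1}` by permuting coordinates: `σ e_i = e_{σ i}`. -/
def permAct {n : ℕ} (σ : Equiv.Perm (Fin (n + 1))) (x : Fin (n + 1) → ℝ) : Fin (n + 1) → ℝ :=
  fun i => x (σ⁻¹ i)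

/-- The root `e_i - e_j`. -/
def root {n : ℕ} (i j : Fin (n + 1)) : Fin (n + 1) → ℝ :=
  Pi.single i 1 - Pi.single j 1

/-- The simple root `α_p = e_p - e_{p+1}`. -/
def simpleRoot {n : ℕ} (p : Fin n) : Fin (n + 1) → ℝ :=
  root p.castSucc p.succ

/-- The fundamental weight `ω_p = ∑_{q ≤ p} e_q`. -/
def fundWeight {n : ℕ} (p : Fin n) : Fin (n + 1) → ℝ :=
  ∑ q ∈ Finset.univ.filter (fun q => q ≤ p.castSucc), Pi.single q 1

/-- The simple transpositions generate the symmetric group. -/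
theorem exists_expression {n : ℕ} (w : Equiv.Perm (Fin (n + 1))) :
    ∃ l : List (Fin n), (l.map simpleRefl).prod = w := by
  have h : w ∈ Submonoid.closure
      (Set.range fun i : Fin n => Equiv.swap i.castSucc i.succ) := by
    rw [Equiv.Perm.mclosure_swap_castSucc_succ]
    trivial
  induction h using Submonoid.closure_induction with
  | mem x hx =>
    obtain ⟨i, rfl⟩ := hx
    exact ⟨[i], by simp [simpleRefl]⟩
  | one => exact ⟨[], rfl⟩
  | mul x y _ _ hx hy =>
    obtain ⟨a, rfl⟩ := hx
    obtain ⟨b, rfl⟩ := hy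
    exact ⟨a ++ b, by simp⟩

/-- The Coxeter length: the least length of an expression in simple transpositions. The set is
nonempty by `exists_expression`. -/
def len {n : ℕ} (w : Equiv.Perm (Fin (n + 1))) : ℕ :=
  sInf {k | ∃ l : List (Fin n), l.length = k ∧ (l.map simpleRefl).prod = w}

/-- The Bruhat order: `u ≤ v` if `v` is reached from `u` by multiplying successively by
reflections, each of which increases the length. -/
def bruhatLE {n : ℕ} (u v : Equiv.Perm (Fin (n + 1))) : Prop :=
  Relation.ReflTransGen
    (fun x y => (∃ i j, i ≠ j ∧ y = Equiv.swap i j * x) ∧ len x < len y) u v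

/-- The cover relation of the Bruhat order. -/
def bruhatCovers {n : ℕ} (u v : Equiv.Perm (Fin (n + 1))) : Prop :=
  bruhatLE u v ∧ u ≠ v ∧ ∀ x, bruhatLE u x → bruhatLE x v → x = u ∨ x = v

/-! ## Subword complexes and brick polyhedra

A word in the simple transpositions is a family `Q : ι → Fin n`, where the finite linear order
`ι` is the set of positions, read in increasing order (a word of length `m` is the case
`ι = Fin m`). -/

/-- The product of the subword of `Q` with positions in `X`. -/
def subProd {n : ℕ} {ι : Type} [LinearOrder ι] (Q : ι → Fin n) (X : Finset ι) :
    Equiv.Perm (Fin (n + 1)) :=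
  ((X.sort (· ≤ ·)).map (fun k => simpleRefl (Q k))).prod

/-- `I` is a facet of the subword complex `SC(Q, w)`: the subword on the complement of `I` is a
reduced expression for `w`. -/
def IsFacet {n : ℕ} {ι : Type} [LinearOrder ι] [Fintype ι] (Q : ι → Fin n)
    (w : Equiv.Perm (Fin (n + 1))) (I : Finset ι) : Prop :=
  subProd Q Iᶜ = w ∧ (Iᶜ).card = len w

/-- The product of the letters of `Q` at the positions before `k` that are not in `I`. -/
def prefixProd {n : ℕ} {ι : Type} [LinearOrder ι] [Fintype ι] (Q : ι → Fin n)
    (I : Finset ι) (k : ι) : Equiv.Perm (Fin (n + 1)) :=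
  subProd Q (Finset.univ.filter (fun j => j < k ∧ j ∉ I))

/-- The root function `r(I, k)`. -/
def rootFun {n : ℕ} {ι : Type} [LinearOrder ι] [Fintype ι] (Q : ι → Fin n)
    (I : Finset ι) (k : ι) : Fin (n + 1) → ℝ :=
  permAct (prefixProd Q I k) (simpleRoot (Q k))

/-- The weight function `ω(I, k)`. -/
def weightFun {n : ℕ} {ι : Type} [LinearOrder ι] [Fintype ι] (Q : ι → Fin n)
    (I : Finset ι) (k : ι) : Fin (n + 1) → ℝ :=
  permAct (prefixProd Q I k) (fundWeight (Q k))

/-- The brick vector `b(I) = -∑_k ω(I, k)`. -/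
def brickVector {n : ℕ} {ι : Type} [LinearOrder ι] [Fintype ι] (Q : ι → Fin n)
    (I : Finset ι) : Fin (n + 1) → ℝ :=
  -∑ k, weightFun Q I k

/-- `δ` is the Demazure product of `Q`: the Bruhat-maximum of the products of subwords. -/
def IsDemazure {n : ℕ} {ι : Type} [LinearOrder ι] (Q : ι → Fin n)
    (δ : Equiv.Perm (Fin (n + 1))) : Prop :=
  (∃ X : Finset ι, subProd Q X = δ) ∧ ∀ X : Finset ι, bruhatLE (subProd Q X) δ

/-- The Bruhat cone `cone {β ∈ Φ⁺ | w ≺ s_β w ≤ Dem(Q)}`. -/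
def bruhatCone {n : ℕ} {ι : Type} [LinearOrder ι] (Q : ι → Fin n)
    (w : Equiv.Perm (Fin (n + 1))) : PointedCone ℝ (Fin (n + 1) → ℝ) :=
  PointedCone.hull ℝ {β | ∃ i j, i < j ∧ β = root i j ∧ bruhatCovers w (Equiv.swap i j * w) ∧
    ∃ δ, IsDemazure Q δ ∧ bruhatLE (Equiv.swap i j * w) δ}

/-- The brick polyhedron `B(Q, w)`. -/
def brickPolyhedron {n : ℕ} {ι : Type} [LinearOrder ι] [Fintype ι] (Q : ι → Fin n)
    (w : Equiv.Perm (Fin (n + 1))) : Set (Fin (n + 1) → ℝ) :=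
  convexHull ℝ {b | ∃ J, IsFacet Q w J ∧ b = brickVector Q J} +
    (bruhatCone Q w : Set (Fin (n + 1) → ℝ))

/-- The modified Bruhat cone `C^{I,+}`: the intersection, over the facets `J ⊇ I`, of the cones
spanned by the roots `r(J, j)`, `j ∈ J \ I`. -/
def modifiedCone {n : ℕ} {ι : Type} [LinearOrder ι] [Fintype ι] (Q : ι → Fin n)
    (w : Equiv.Perm (Fin (n + 1))) (I : Finset ι) : Set (Fin (n + 1) → ℝ) :=
  {x | ∀ J, IsFacet Q w J → I ⊆ J →
    x ∈ PointedCone.hull ℝ {β | ∃ j ∈ J, j ∉ I ∧ β = rootFun Q J j}}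

/-- The modified brick polyhedron `B^I(Q, w)`. -/
def modifiedBrickPolyhedron {n : ℕ} {ι : Type} [LinearOrder ι] [Fintype ι] (Q : ι → Fin n)
    (w : Equiv.Perm (Fin (n + 1))) (I : Finset ι) : Set (Fin (n + 1) → ℝ) :=
  convexHull ℝ {b | ∃ J, IsFacet Q w J ∧ I ⊆ J ∧ b = brickVector Q J} + modifiedCone Q w I

/-- The set of points of `P` at which `f` is minimal on `P`. -/
def minFace {n : ℕ} (P : Set (Fin (n + 1) → ℝ)) (f : (Fin (n + 1) → ℝ) →ₗ[ℝ] ℝ) :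
    Set (Fin (n + 1) → ℝ) :=
  {x | x ∈ P ∧ ∀ y ∈ P, f x ≤ f y}

/-- `F` is a (nonempty) face of the polyhedron `P`: the set of minimizers of a linear
functional. -/
def IsFace {n : ℕ} (P F : Set (Fin (n + 1) → ℝ)) : Prop :=
  F.Nonempty ∧ ∃ f : (Fin (n + 1) → ℝ) →ₗ[ℝ] ℝ, F = minFace P f

/-! ## `ν`-trees and the `ν`-brick polyhedron -/

/-- A step of a lattice path: east or north. -/
inductive Step where
  | E
  | N

def Step.vec : Step → ℕ × ℕ
  | .E => (1, 0)
  | .N => (0, 1)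

/-- The endpoint of a lattice path that starts at the origin. -/
def endpoint (ν : List Step) : ℕ × ℕ := (ν.map Step.vec).sum

/-- Lattice points, ordered lexicographically: by columns from left to right, and each column
from bottom to top. -/
abbrev Pt : Type := ℕ ×ₗ ℕ

def Pt.x (p : Pt) : ℕ := (ofLex p).1

def Pt.y (p : Pt) : ℕ := (ofLex p).2

open scoped Classical in
/-- The set `A_ν` of the lattice points weakly above `ν` in the smallest rectangle containing
`ν`: those lying weakly above a lattice point of `ν` in the same column. -/
def pts (ν : List Step) : Finset Pt :=
  ((Finset.range ((endpoint ν).1 + 1) ×ˢ Finset.range ((endpoint ν).2 + 1)).map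
      toLex.toEmbedding).filter
    (fun p => ∃ k ≤ ν.length, (endpoint (ν.take k)).1 = p.x ∧ (endpoint (ν.take k)).2 ≤ p.y)

/-- The lattice distance from a point of the rectangle to its top-left corner. -/
def dist (ν : List Step) (p : Pt) : ℕ := p.x + ((endpoint ν).2 - p.y)

/-- `p` is strictly southwest of `q` and the rectangle spanned by them lies in the Ferrers
diagram. -/
def SWIncompatible (ν : List Step) (p q : Pt) : Prop :=
  p.x < q.x ∧ p.y < q.y ∧
    ∀ r : Pt, p.x ≤ r.x → r.x ≤ q.x → p.y ≤ r.y → r.y ≤ q.y → r ∈ pts ν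

/-- `ν`-compatibility of two lattice points. -/
def Compatible (ν : List Step) (p q : Pt) : Prop :=
  ¬ (SWIncompatible ν p q ∨ SWIncompatible ν q p)

/-- The points of `T` are pairwise `ν`-compatible. -/
def PairwiseCompatible (ν : List Step) (T : Finset (pts ν)) : Prop :=
  ∀ p ∈ T, ∀ q ∈ T, Compatible ν p q

/-- A `ν`-tree: a maximal set of pairwise `ν`-compatible points of `A_ν`. -/
def IsNuTree (ν : List Step) (T : Finset (pts ν)) : Prop :=
  Maximal (PairwiseCompatible ν) T

theorem exists_isNuTree (ν : List Step) : ∃ T, IsNuTree ν T := by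
  obtain ⟨T, -, hT⟩ := (Set.toFinite {T | PairwiseCompatible ν T}).exists_le_maximal
    (a := ∅) (by simp [PairwiseCompatible])
  exact ⟨T, hT⟩

/-- A node `q` of `T` is an ascent if `T` has a node to the north of `q` (in the same column) and
a node to the east of `q` (in the same row). -/
def IsAscent (ν : List Step) (T : Finset (pts ν)) (q : pts ν) : Prop :=
  q ∈ T ∧ (∃ p ∈ T, p.1.x = q.1.x ∧ q.1.y < p.1.y) ∧ (∃ r ∈ T, r.1.y = q.1.y ∧ q.1.x < r.1.x)

/-- The rank `n` of the type `A_n` in which `Q_ν` lives: the largest index of a letter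
`s_{d(p)+1}`, `p ∈ A_ν`. -/
def rank (ν : List Step) : ℕ := (pts ν).sup (dist ν) + 1

/-- The word `Q_ν`: its positions are the points of `A_ν`, read by columns from left to right,
each from bottom to top; the letter at `p` is `s_{d(p)+1}`, which is number `d(p)` when the
simple transpositions are numbered from `0`. -/
def wordNu (ν : List Step) : pts ν → Fin (rank ν) :=
  fun p => ⟨dist ν p.1, Nat.lt_succ_of_le (Finset.le_sup p.2)⟩

/-- The element `w_ν`: the product of the letters of `Q_ν` in the complement of a `ν`-tree. -/
def permNu (ν : List Step) : Equiv.Perm (Fin (rank ν + 1)) :=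
  subProd (wordNu ν) (Classical.choose (exists_isNuTree ν))ᶜ

/-- The `ν`-brick polyhedron `B(Q_ν, w_ν)`. -/
def nuBrickPolyhedron (ν : List Step) : Set (Fin (rank ν + 1) → ℝ) :=
  brickPolyhedron (wordNu ν) (permNu ν)

/-- A linear functional that vanishes on the roots `r(T, a)`, `a ∈ A`, and is positive on the
roots `r(T, t)`, `t ∈ T \ A`. -/
def Separates (ν : List Step) (T A : Finset (pts ν))
    (f : (Fin (rank ν + 1) → ℝ) →ₗ[ℝ] ℝ) : Prop :=
  (∀ a ∈ A, f (rootFun (wordNu ν) T a) = 0) ∧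
    ∀ t ∈ T \ A, 0 < f (rootFun (wordNu ν) T t)

end Brick

end

/-! A word is read as a strand diagram. The state before a position assigns a label to each level; a
letter outside `J` makes two labels cross, a letter in `J` is a contact of two labels, and its root
is `e_u - e_v` for the upper label `u` and the lower label `v`. The value of `f` on a brick vector
is minus a sum of values on weights, and each of these weights is the set of labels at the first
levels of a state.

Extremal facets. If `f` is nonnegative on all roots of a facet `T`, then `T` maximizes `f` on every
weight separately (`FacetOn.ps_le`). When `w` is the longest element, every contact can be flipped,
and flipping contacts of the wrong sign improves each facet to one whose contacts follow a linear
order that refines `f`; such a facet is unique (`FacetOn.unique`). The general case follows by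
appending letters until the longest element is reached. Equality holds exactly for the facets that
contain every `t` with `f (r(T,t)) > 0`.

The cones. A generator of the Bruhat cone is the root of a contact, in some facet, of two labels
that are not inverted in `w`; hence `f` is nonnegative on it. Let `g` be the functional with values
`-w⁻¹(i)`, which is positive on these generators. The two labels at an ascent of a tree cross at
another point, so `g` is negative on the roots in `A`. Then `f - ε g` is still nonnegative on the
roots of `T`, which makes `f` strictly positive on the Bruhat cone away from `0`. Comparing signs of
`g` in `T` and in another facet shows that the modified cone is zero. Both facts together identify
the minimal face (`minFace_brickPolyhedron`).

The trees. On the grid, labels run straight through crossings and turn at nodes. Tracing them shows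
that the final permutation is the same for all trees. Nodes can be counted by rows and columns, so
all complements have the same size, and the complement of one explicit tree is visibly reduced;
hence all trees are facets. The functional `f` is built column by column, by interpolating along the
nodes of a column between the value at its entry and the larger value at its top node
(`exists_posBefore_succ`). -/

noncomputable section
namespace Brick

/-! ## Prefix products of subwords -/

/-- The product of the letters `Q i`, `i < k`, at positions `i ∈ X`. -/
def wstate {n : ℕ} (Q : ℕ → Fin n) (X : Finset ℕ) : ℕ → Equiv.Perm (Fin (n + 1))
  | 0 => 1
  | k + 1 => if k ∈ X then wstate Q X k * simpleRefl (Q k) else wstate Q X k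

/-- The upper of the two labels that meet at position `k`. -/
def upLabel {n : ℕ} (Q : ℕ → Fin n) (X : Finset ℕ) (k : ℕ) : Fin (n + 1) :=
  wstate Q X k (Q k).castSucc

/-- The lower of the two labels that meet at position `k`. -/
def loLabel {n : ℕ} (Q : ℕ → Fin n) (X : Finset ℕ) (k : ℕ) : Fin (n + 1) :=
  wstate Q X k (Q k).succ

/-- All crossings before `M` go from the natural order to the reversed one. -/
def Red {n : ℕ} (Q : ℕ → Fin n) (X : Finset ℕ) (M : ℕ) : Prop :=
  ∀ k ∈ X, k < M → upLabel Q X k < loLabel Q X k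

/-- All pairs are inverted. -/
def AllInv {n : ℕ} (w : Equiv.Perm (Fin (n + 1))) : Prop :=
  ∀ u v, u < v → w⁻¹ v < w⁻¹ u

section
variable {n : ℕ} {Q Q' : ℕ → Fin n} {X X' : Finset ℕ} {M : ℕ}

/-- Only one pair can change its order under an adjacent transposition. Both the detection of
crossings and the count of inversions rest on this. -/
theorem simpleRefl_order (p : Fin n) {a b : Fin (n + 1)} (hab : a < b)
    (h : simpleRefl p b < simpleRefl p a) : a = p.castSucc ∧ b = p.succ := by
  unfold simpleRefl at h
  simp only [Equiv.swap_apply_def] at h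
  split_ifs at h <;>
    simp only [Fin.ext_iff, Fin.lt_def, Fin.val_castSucc, Fin.val_succ] at * <;> omega

theorem upLabel_ne_loLabel (k : ℕ) : upLabel Q X k ≠ loLabel Q X k := by
  intro h
  have := (wstate Q X k).injective h
  exact absurd this (Fin.castSucc_lt_succ).ne

theorem wstate_succ_mem {k : ℕ} (h : k ∈ X) :
    wstate Q X (k + 1) = Equiv.swap (upLabel Q X k) (loLabel Q X k) * wstate Q X k := by
  rw [wstate, if_pos h, simpleRefl, Equiv.mul_swap_eq_swap_mul]; rfl

theorem wstate_succ_notMem {k : ℕ} (h : k ∉ X) : wstate Q X (k + 1) = wstate Q X k := by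
  rw [wstate, if_neg h]

/-- Letters are appended on the right, so a left factor relating two states at time `s` survives
while both words read the same letters. The toggling and extension lemmas apply this. -/
theorem wstate_congr_from {g : Equiv.Perm (Fin (n + 1))} {s i : ℕ} (hsi : s ≤ i)
    (hQ : ∀ l, s ≤ l → l < i → Q' l = Q l) (hX : ∀ l, s ≤ l → l < i → (l ∈ X' ↔ l ∈ X))
    (h0 : wstate Q' X' s = g * wstate Q X s) : wstate Q' X' i = g * wstate Q X i := by
  induction i, hsi using Nat.le_induction with
  | base => exact h0
  | succ i hi ih =>
    have := ih (fun l h1 h2 => hQ l h1 (by omega)) (fun l h1 h2 => hX l h1 (by omega))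
    simp only [wstate, hX i hi (by omega), hQ i hi (by omega), this]
    split_ifs <;> simp [mul_assoc]

theorem wstate_congr {i : ℕ}
    (hQ : ∀ l, l < i → Q' l = Q l) (hX : ∀ l, l < i → (l ∈ X' ↔ l ∈ X)) :
    wstate Q' X' i = wstate Q X i := by
  have := wstate_congr_from (g := 1) (Nat.zero_le i) (fun l _ h => hQ l h) (fun l _ h => hX l h)
    (by simp [wstate])
  simpa using this

/-- Toggling the membership of one position. -/
theorem wstate_toggle {j k : ℕ} (hX : ∀ i, i ≠ j → (i ∈ X' ↔ i ∈ X)) (hj : j ∈ X' ↔ j ∉ X)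
    (hjk : j < k) :
    wstate Q X' k = Equiv.swap (upLabel Q X j) (loLabel Q X j) * wstate Q X k := by
  have h0 : wstate Q X' j = wstate Q X j :=
    wstate_congr (fun _ _ => rfl) (fun l hl => hX l (by omega))
  refine wstate_congr_from (s := j + 1) hjk (fun _ _ _ => rfl) (fun l h1 _ => hX l (by omega)) ?_
  by_cases h : j ∈ X
  · rw [wstate_succ_notMem (by simpa [hj] using h), wstate_succ_mem h, h0,
      Equiv.swap_mul_self_mul]
  · rw [wstate_succ_mem (hj.2 h), wstate_succ_notMem h]
    simp only [upLabel, loLabel, h0]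

/-- Toggling the membership of two positions at which the same labels meet. -/
theorem wstate_toggle_two {j k : ℕ} (hX : ∀ i, i ≠ j → i ≠ k → (i ∈ X' ↔ i ∈ X))
    (hj : j ∈ X' ↔ j ∉ X) (hk : k ∈ X' ↔ k ∉ X) (hjk : j < k)
    (hs : Equiv.swap (upLabel Q X k) (loLabel Q X k)
      = Equiv.swap (upLabel Q X j) (loLabel Q X j)) (i : ℕ) :
    wstate Q X' i = if j < i ∧ i ≤ k then
      Equiv.swap (upLabel Q X j) (loLabel Q X j) * wstate Q X i else wstate Q X i := by
  classical
  have h1 : ∀ i, j < i → i ≤ k → wstate Q X' i =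
      Equiv.swap (upLabel Q X j) (loLabel Q X j) * wstate Q X i := by
    intro i hi hik
    have h0 : wstate Q X' j = wstate Q X j :=
      wstate_congr (fun _ _ => rfl) (fun l hl => hX l (by omega) (by omega))
    refine wstate_congr_from (s := j + 1) hi (fun _ _ _ => rfl)
      (fun l h1 _ => hX l (by omega) (by omega)) ?_
    by_cases h : j ∈ X
    · rw [wstate_succ_notMem (by simpa [hj] using h), wstate_succ_mem h, h0,
        Equiv.swap_mul_self_mul]
    · rw [wstate_succ_mem (hj.2 h), wstate_succ_notMem h]
      simp only [upLabel, loLabel, h0]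
  split_ifs with hi
  · exact h1 i hi.1 hi.2
  · rcases Nat.lt_or_ge j i with hji | hji
    · have hki : k + 1 ≤ i := by omega
      have := wstate_congr_from (Q := Q) (Q' := Q) (X := X) (X' := X') (g := 1) hki
        (fun _ _ _ => rfl) (fun l h1 _ => hX l (by omega) (by omega)) ?_
      · simpa using this
      have hkk := h1 k hjk le_rfl
      rw [one_mul]
      by_cases h : k ∈ X
      · rw [wstate_succ_notMem (by simpa [hk] using h), wstate_succ_mem h, hkk, hs]
      · have hu : upLabel Q X' k = Equiv.swap (upLabel Q X k) (loLabel Q X k) (upLabel Q X k) := by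
          rw [hs, upLabel, hkk]; rfl
        have hv : loLabel Q X' k = Equiv.swap (upLabel Q X k) (loLabel Q X k) (loLabel Q X k) := by
          rw [hs, loLabel, hkk]; rfl
        rw [wstate_succ_mem (hk.2 h), wstate_succ_notMem h, hu, hv, Equiv.swap_apply_left,
          Equiv.swap_apply_right, Equiv.swap_comm, hs, hkk, Equiv.swap_mul_self_mul]
    · exact wstate_congr (fun _ _ => rfl) (fun l hl => hX l (by omega) (by omega))

/-- If the order of two labels changes between two times, they cross in between. -/
theorem exists_crossing {j k : ℕ} {u v : Fin (n + 1)} (hjk : j ≤ k)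
    (h1 : (wstate Q X j)⁻¹ u < (wstate Q X j)⁻¹ v)
    (h2 : (wstate Q X k)⁻¹ v < (wstate Q X k)⁻¹ u) :
    ∃ i ∈ X, j ≤ i ∧ i < k ∧ upLabel Q X i = u ∧ loLabel Q X i = v := by
  induction k, hjk using Nat.le_induction with
  | base => exact absurd h1 h2.not_gt
  | succ k hk ih =>
    by_cases h : (wstate Q X k)⁻¹ v < (wstate Q X k)⁻¹ u
    · obtain ⟨i, hi, h3, h4, h5⟩ := ih h
      exact ⟨i, hi, h3, by omega, h5⟩
    · have hne : (wstate Q X k)⁻¹ v ≠ (wstate Q X k)⁻¹ u := by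
        intro e
        rw [(wstate Q X k)⁻¹.injective e] at h2
        exact lt_irrefl _ h2
      have hlt := lt_of_le_of_ne (not_lt.1 h) hne.symm
      by_cases hkX : k ∈ X
      · rw [wstate, if_pos hkX] at h2
        simp only [mul_inv_rev, Equiv.Perm.mul_apply] at h2
        have e : (simpleRefl (Q k))⁻¹ = simpleRefl (Q k) := by simp [simpleRefl]
        rw [e] at h2
        obtain ⟨ha, hb⟩ := simpleRefl_order _ hlt h2
        refine ⟨k, hkX, hk, by omega, ?_, ?_⟩
        · rw [upLabel, ← ha]; simp
        · rw [loLabel, ← hb]; simp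
      · rw [wstate_succ_notMem hkX] at h2
        exact absurd h2 h

theorem inv_upLabel_lt (k : ℕ) :
    (wstate Q X k)⁻¹ (upLabel Q X k) < (wstate Q X k)⁻¹ (loLabel Q X k) := by
  simp [upLabel, loLabel]

theorem inv_succ_of_mem {k : ℕ} (h : k ∈ X) :
    (wstate Q X (k + 1))⁻¹ (loLabel Q X k) < (wstate Q X (k + 1))⁻¹ (upLabel Q X k) := by
  rw [wstate_succ_mem h]
  simp [mul_inv_rev, Equiv.Perm.mul_apply, upLabel, loLabel]

theorem Red.mono {M' : ℕ} (h : Red Q X M) (hM : M' ≤ M) : Red Q X M' :=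
  fun k hk hkM => h k hk (by omega)

/-- In a reduced word, inverted pairs stay inverted. -/
theorem Red.stays (h : Red Q X M) {j k : ℕ} (hjk : j ≤ k) (hk : k ≤ M) {u v : Fin (n + 1)}
    (huv : u < v) (h1 : (wstate Q X j)⁻¹ v < (wstate Q X j)⁻¹ u) :
    (wstate Q X k)⁻¹ v < (wstate Q X k)⁻¹ u := by
  by_contra h2
  have hne : (wstate Q X k)⁻¹ v ≠ (wstate Q X k)⁻¹ u := fun e =>
    huv.ne' ((wstate Q X k)⁻¹.injective e)
  obtain ⟨i, hi, _, hik, h4, h5⟩ := exists_crossing hjk h1 (lt_of_le_of_ne (not_lt.1 h2) hne.symm)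
  have := h i hi (by omega)
  rw [h4, h5] at this
  exact absurd this huv.not_gt

/-- Two labels cross at most once in a reduced word. -/
theorem Red.unique (h : Red Q X M) {i j : ℕ} (hi : i ∈ X) (hj : j ∈ X) (hiM : i < M) (hjM : j < M)
    (hu : upLabel Q X i = upLabel Q X j) (hv : loLabel Q X i = loLabel Q X j) : i = j := by
  wlog hij : i < j generalizing i j
  · rcases Nat.lt_or_ge j i with h1 | h1
    · exact (this hj hi hjM hiM hu.symm hv.symm h1).symm
    · omega
  have h1 := h.stays (show i + 1 ≤ j by omega) (by omega) (h i hi hiM) (inv_succ_of_mem hi)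
  rw [hu, hv] at h1
  exact absurd h1 (inv_upLabel_lt j).not_gt

/-! ### Length and inversions -/

/-- The set of inversions. -/
def invPairs (w : Equiv.Perm (Fin (n + 1))) : Finset (Fin (n + 1) × Fin (n + 1)) :=
  Finset.univ.filter fun p => p.1 < p.2 ∧ w⁻¹ p.2 < w⁻¹ p.1

theorem simpleRefl_inv (p : Fin n) : (simpleRefl p)⁻¹ = simpleRefl p := by simp [simpleRefl]

theorem invPairs_mul_subset (w : Equiv.Perm (Fin (n + 1))) (p : Fin n) :
    invPairs (w * simpleRefl p) ⊆ insert (w p.castSucc, w p.succ) (invPairs w) := by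
  intro q hq
  simp only [invPairs, Finset.mem_filter, Finset.mem_univ, true_and, Finset.mem_insert,
    mul_inv_rev, Equiv.Perm.mul_apply, simpleRefl_inv] at hq ⊢
  by_cases h : w⁻¹ q.2 < w⁻¹ q.1
  · exact Or.inr ⟨hq.1, h⟩
  · left
    have hne : w⁻¹ q.2 ≠ w⁻¹ q.1 := fun e => hq.1.ne' (w⁻¹.injective e)
    obtain ⟨ha, hb⟩ := simpleRefl_order p (lt_of_le_of_ne (not_lt.1 h) hne.symm) hq.2
    rw [← ha, ← hb]; simp

theorem card_invPairs_mul_le (w : Equiv.Perm (Fin (n + 1))) (p : Fin n) :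
    (invPairs (w * simpleRefl p)).card ≤ (invPairs w).card + 1 :=
  (Finset.card_le_card (invPairs_mul_subset w p)).trans (Finset.card_insert_le _ _)

/-- The pair that meets becomes inverted, and by `simpleRefl_order` no other inversion is lost. -/
theorem card_invPairs_mul_of_lt (w : Equiv.Perm (Fin (n + 1))) (p : Fin n)
    (h : w p.castSucc < w p.succ) :
    (invPairs (w * simpleRefl p)).card = (invPairs w).card + 1 := by
  refine le_antisymm (card_invPairs_mul_le w p) ?_
  rw [← Finset.card_insert_of_notMem (s := invPairs w) (a := (w p.castSucc, w p.succ))]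
  · refine Finset.card_le_card (Finset.insert_subset ?_ ?_)
    · simp only [invPairs, Finset.mem_filter, Finset.mem_univ, true_and, mul_inv_rev,
        Equiv.Perm.mul_apply, simpleRefl_inv]
      exact ⟨h, by simp [simpleRefl]⟩
    · intro q hq
      simp only [invPairs, Finset.mem_filter, Finset.mem_univ, true_and, mul_inv_rev,
        Equiv.Perm.mul_apply, simpleRefl_inv] at hq ⊢
      refine ⟨hq.1, ?_⟩
      by_contra h2
      have hne : simpleRefl p (w⁻¹ q.2) ≠ simpleRefl p (w⁻¹ q.1) := fun e =>
        hq.1.ne' (w⁻¹.injective ((simpleRefl p).injective e))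
      obtain ⟨ha, hb⟩ := simpleRefl_order p hq.2 (lt_of_le_of_ne (not_lt.1 h2) hne.symm)
      rw [← ha, ← hb] at h
      simp at h
      exact absurd h hq.1.not_gt
  · simp only [invPairs, Finset.mem_filter, not_and, not_lt]
    intro _ _
    rw [Equiv.Perm.inv_def, Equiv.symm_apply_apply, Equiv.symm_apply_apply]
    exact Fin.castSucc_lt_succ.le

theorem card_invPairs_prod_le (l : List (Fin n)) :
    (invPairs (l.map simpleRefl).prod).card ≤ l.length := by
  induction l using List.reverseRecOn with
  | nil => simp [invPairs]; intro a b h; exact h.le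
  | append_singleton l p ih =>
    simp only [List.map_append, List.prod_append, List.map_cons, List.map_nil, List.prod_singleton,
      List.length_append, List.length_singleton]
    exact (card_invPairs_mul_le _ _).trans (by omega)

theorem card_invPairs_le_len (w : Equiv.Perm (Fin (n + 1))) : (invPairs w).card ≤ len w := by
  unfold len
  refine le_csInf ?_ ?_
  · obtain ⟨l, hl⟩ := exists_expression w
    exact ⟨l.length, l, rfl, hl⟩
  · rintro k ⟨l, rfl, rfl⟩
    exact card_invPairs_prod_le l

theorem len_prod_le (l : List (Fin n)) : len (l.map simpleRefl).prod ≤ l.length :=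
  Nat.sInf_le ⟨l, rfl, rfl⟩

theorem exists_list_wstate (Q : ℕ → Fin n) (X : Finset ℕ) (k : ℕ) :
    ∃ l : List (Fin n), l.length = (X.filter (· < k)).card ∧
      (l.map simpleRefl).prod = wstate Q X k := by
  induction k with
  | zero => exact ⟨[], by simp, rfl⟩
  | succ k ih =>
    obtain ⟨l, h1, h2⟩ := ih
    by_cases h : k ∈ X
    · refine ⟨l ++ [Q k], ?_, ?_⟩
      · have : X.filter (· < k + 1) = insert k (X.filter (· < k)) := by
          ext i; simp only [Finset.mem_filter, Finset.mem_insert]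
          constructor
          · rintro ⟨a, b⟩; by_cases hik : i = k
            · exact Or.inl hik
            · exact Or.inr ⟨a, by omega⟩
          · rintro (rfl | ⟨a, b⟩)
            · exact ⟨h, by omega⟩
            · exact ⟨a, by omega⟩
        rw [this, Finset.card_insert_of_notMem (by simp)]
        simp [h1]
      · rw [wstate, if_pos h]; simp [h2]
    · refine ⟨l, ?_, by rw [wstate, if_neg h, h2]⟩
      rw [h1]; congr 1
      ext i; simp only [Finset.mem_filter]
      constructor
      · rintro ⟨a, b⟩; exact ⟨a, by omega⟩
      · rintro ⟨a, b⟩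
        refine ⟨a, ?_⟩
        rcases eq_or_ne i k with rfl | hik
        · exact absurd a h
        · omega

theorem len_wstate_le : len (wstate Q X M) ≤ X.card := by
  obtain ⟨l, h1, h2⟩ := exists_list_wstate Q X M
  rw [← h2]
  refine (len_prod_le l).trans (h1.le.trans ?_)
  exact Finset.card_le_card (Finset.filter_subset _ _)

/-- Every crossing creates one inversion. Since inversions bound the length from below, this makes
`Red` words as short as possible (`Red.card_eq_len`). -/
theorem Red.card_invPairs (h : Red Q X M) :
    (invPairs (wstate Q X M)).card = (X.filter (· < M)).card := by
  induction M with
  | zero => simp [wstate, invPairs]; intro a b h; exact h.le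
  | succ k ih =>
    have ih := ih (h.mono (by omega))
    by_cases hk : k ∈ X
    · rw [wstate, if_pos hk, card_invPairs_mul_of_lt _ _ (h k hk (by omega)), ih]
      have : X.filter (· < k + 1) = insert k (X.filter (· < k)) := by
        ext i; simp only [Finset.mem_filter, Finset.mem_insert]
        constructor
        · rintro ⟨a, b⟩; by_cases hik : i = k
          · exact Or.inl hik
          · exact Or.inr ⟨a, by omega⟩
        · rintro (rfl | ⟨a, b⟩)
          · exact ⟨hk, by omega⟩
          · exact ⟨a, by omega⟩
      rw [this, Finset.card_insert_of_notMem (by simp)]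
    · rw [wstate_succ_notMem hk, ih]
      congr 1
      ext i; simp only [Finset.mem_filter]
      constructor
      · rintro ⟨a, b⟩; exact ⟨a, by omega⟩
      · rintro ⟨a, b⟩
        refine ⟨a, ?_⟩
        rcases eq_or_ne i k with rfl | hik
        · exact absurd a hk
        · omega

/-- Two crossings can be deleted from a word that is not reduced. -/
theorem exists_ssubset_of_not_red (h : ¬ Red Q X M) :
    ∃ X' ⊂ X, wstate Q X' M = wstate Q X M := by
  classical
  unfold Red at h
  push Not at h
  obtain ⟨k, hk, hkM, hle⟩ := h
  have hlt := lt_of_le_of_ne hle (upLabel_ne_loLabel k).symm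
  -- The labels at `k` are already in reversed order, so they crossed before; deleting both
  -- crossings does not change the product.
  obtain ⟨i, hi, _, hik, hu, hv⟩ := exists_crossing (Q := Q) (X := X) (Nat.zero_le k)
    (by simpa [wstate] using hlt) (inv_upLabel_lt k)
  refine ⟨(X.erase i).erase k, ?_, ?_⟩
  · exact (Finset.erase_subset _ _).trans_ssubset (Finset.erase_ssubset hi)
  · rw [wstate_toggle_two (X := X) (j := i) (k := k) ?_ ?_ ?_ hik ?_ M, if_neg (by omega)]
    · intro a h1 h2; simp [h1, h2]
    · simp [hi]
    · simp [hk]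
    · rw [hu, hv, Equiv.swap_comm]

theorem exists_red_subset (Q : ℕ → Fin n) (X : Finset ℕ) (M : ℕ) :
    ∃ X' ⊆ X, Red Q X' M ∧ wstate Q X' M = wstate Q X M := by
  induction X using Finset.strongInduction with
  | H X ih =>
    by_cases h : Red Q X M
    · exact ⟨X, subset_rfl, h, rfl⟩
    · obtain ⟨X1, h1, h2⟩ := exists_ssubset_of_not_red h
      obtain ⟨X2, h3, h4, h5⟩ := ih X1 h1
      exact ⟨X2, h3.trans h1.subset, h4, h5.trans h2⟩

theorem Red.card_eq_len (h : Red Q X M) (hX : X ⊆ Finset.range M) :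
    X.card = len (wstate Q X M) := by
  refine le_antisymm ?_ len_wstate_le
  refine le_trans (le_of_eq ?_) (card_invPairs_le_len _)
  rw [h.card_invPairs, Finset.filter_true_of_mem]
  intro i hi; simpa using hX hi

theorem red_of_card_eq_len (h : X.card = len (wstate Q X M)) :
    Red Q X M := by
  by_contra hr
  obtain ⟨X', h1, h2⟩ := exists_ssubset_of_not_red hr
  have := len_wstate_le (Q := Q) (X := X') (M := M)
  rw [h2, ← h] at this
  exact absurd (Finset.card_lt_card h1) this.not_gt

end

/-! ## Flips and extremal facets -/

/-- The subword of `Q` at the positions `X ⊆ Y` is a reduced expression of `w`. -/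
structure FacetOn {n : ℕ} (Q : ℕ → Fin n) (Y : Finset ℕ) (M : ℕ)
    (w : Equiv.Perm (Fin (n + 1))) (X : Finset ℕ) : Prop where
  sub : X ⊆ Y
  bound : Y ⊆ Finset.range M
  red : Red Q X M
  prod : wstate Q X M = w

/-- The value on the weight `σ(ω_d)` of the functional with values `φ` on the basis vectors. -/
def ps {n : ℕ} (φ : Fin (n + 1) → ℝ) (σ : Equiv.Perm (Fin (n + 1))) (d : Fin (n + 1)) : ℝ :=
  ∑ i, if σ⁻¹ i ≤ d then φ i else 0

/-- The functional `φ` is nonnegative on the roots at the positions in `Y \ X`. -/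
def ContactNonneg {n : ℕ} (φ : Fin (n + 1) → ℝ) (Q : ℕ → Fin n) (Y X : Finset ℕ) : Prop :=
  ∀ j ∈ Y, j ∉ X → φ (loLabel Q X j) ≤ φ (upLabel Q X j)

/-- The labels that meet at the positions in `Y \ X` are in the order given by `σ`. -/
def OrderPos {n : ℕ} (σ : Equiv.Perm (Fin (n + 1))) (Q : ℕ → Fin n) (Y X : Finset ℕ) : Prop :=
  ∀ j ∈ Y, j ∉ X → σ⁻¹ (upLabel Q X j) < σ⁻¹ (loLabel Q X j)

section
variable {n : ℕ} {Q Q' : ℕ → Fin n} {X X' Y : Finset ℕ} {M : ℕ} {w : Equiv.Perm (Fin (n + 1))}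
  {φ : Fin (n + 1) → ℝ}

/-! ### Values of a functional on weights under reflections -/

theorem ps_swap {u v : Fin (n + 1)} (huv : u ≠ v) (σ : Equiv.Perm (Fin (n + 1)))
    (d : Fin (n + 1)) :
    ps φ (Equiv.swap u v * σ) d = ps φ σ d +
      (φ v - φ u) * ((if σ⁻¹ u ≤ d then 1 else 0) - (if σ⁻¹ v ≤ d then 1 else 0)) := by
  have h1 : ps φ (Equiv.swap u v * σ) d
      = ∑ i, if σ⁻¹ i ≤ d then φ (Equiv.swap u v i) else 0 := by
    unfold ps
    rw [← Equiv.sum_comp (Equiv.swap u v)]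
    refine Finset.sum_congr rfl fun i _ => ?_
    simp [mul_inv_rev, Equiv.Perm.mul_apply]
  rw [h1, ← sub_eq_iff_eq_add', ps, ← Finset.sum_sub_distrib,
    Fintype.sum_eq_add u v huv]
  · simp only [Equiv.swap_apply_left, Equiv.swap_apply_right]
    split_ifs <;> ring
  · rintro x ⟨h1, h2⟩
    rw [Equiv.swap_apply_of_ne_of_ne h1 h2, sub_self]

theorem ps_swap_of_eq {u v : Fin (n + 1)} (h : φ u = φ v) (σ : Equiv.Perm (Fin (n + 1)))
    (d : Fin (n + 1)) : ps φ (Equiv.swap u v * σ) d = ps φ σ d := by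
  rcases eq_or_ne u v with rfl | huv
  · rw [Equiv.swap_self, ← Equiv.Perm.one_def, one_mul]
  · rw [ps_swap huv, h]; ring

theorem ps_neg (σ : Equiv.Perm (Fin (n + 1))) (d : Fin (n + 1)) :
    ps (fun i => - φ i) σ d = - ps φ σ d := by
  unfold ps
  rw [← Finset.sum_neg_distrib]
  refine Finset.sum_congr rfl fun i _ => ?_
  split_ifs <;> simp

theorem ps_mul_simpleRefl_of_ne (σ : Equiv.Perm (Fin (n + 1))) {p : Fin n} {d : Fin (n + 1)}
    (hd : d ≠ p.castSucc) : ps φ (σ * simpleRefl p) d = ps φ σ d := by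
  unfold ps
  refine Finset.sum_congr rfl fun i _ => ?_
  rw [mul_inv_rev, Equiv.Perm.mul_apply, simpleRefl_inv]
  congr 1
  generalize σ⁻¹ i = x
  unfold simpleRefl
  rw [Equiv.swap_apply_def]
  split_ifs <;>
    simp only [ne_eq, Fin.ext_iff, Fin.le_def, Fin.val_castSucc, Fin.val_succ, eq_iff_iff] at * <;> omega

theorem ps_eq_sum (σ : Equiv.Perm (Fin (n + 1))) (d : Fin (n + 1)) :
    ps φ σ d = ∑ l, if l ≤ d then φ (σ l) else 0 := by
  unfold ps
  rw [← Equiv.sum_comp σ]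
  simp

/-- Consecutive weights differ by one basis vector, so the values on all weights determine the
values on the single labels. -/
theorem apply_eq_of_ps_eq {σ τ : Equiv.Perm (Fin (n + 1))} (h : ∀ d, ps φ σ d = ps φ τ d)
    (l : Fin (n + 1)) : φ (σ l) = φ (τ l) := by
  have key : ∀ (σ : Equiv.Perm (Fin (n + 1))) (j : Fin n),
      ps φ σ j.succ = ps φ σ j.castSucc + φ (σ j.succ) := by
    intro σ j
    rw [ps_eq_sum, ps_eq_sum, ← sub_eq_iff_eq_add', ← Finset.sum_sub_distrib,
      Finset.sum_eq_single j.succ]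
    · simp [Fin.le_def]
    · intro b _ hb
      have : b ≤ j.succ ↔ b ≤ j.castSucc := by
        simp only [ne_eq, Fin.ext_iff, Fin.le_def, Fin.val_castSucc, Fin.val_succ] at *; omega
      simp [this]
    · simp
  refine Fin.cases ?_ (fun j => ?_) l
  · have := h 0
    rw [ps_eq_sum, ps_eq_sum, Finset.sum_eq_single 0, Finset.sum_eq_single 0] at this
    · simpa using this
    all_goals simp +contextual
  · have h1 := h j.succ
    rw [key, key, h j.castSucc] at h1
    linarith

/-- Exchanging a contact with the crossing of the same two labels. -/
theorem FacetOn.flip (h : FacetOn Q Y M w X) {j k : ℕ} (hj : j ∈ Y) (hjX : j ∉ X) (hk : k ∈ X)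
    (hs : Equiv.swap (upLabel Q X k) (loLabel Q X k)
      = Equiv.swap (upLabel Q X j) (loLabel Q X j)) :
    FacetOn Q Y M w (insert j (X.erase k)) ∧ ∀ i, wstate Q (insert j (X.erase k)) i =
      if (j < i ∧ i ≤ k) ∨ (k < i ∧ i ≤ j) then
        Equiv.swap (upLabel Q X j) (loLabel Q X j) * wstate Q X i else wstate Q X i := by
  have hjk : j ≠ k := fun e => hjX (e ▸ hk)
  have hst : ∀ i, wstate Q (insert j (X.erase k)) i =
      if (j < i ∧ i ≤ k) ∨ (k < i ∧ i ≤ j) then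
        Equiv.swap (upLabel Q X j) (loLabel Q X j) * wstate Q X i else wstate Q X i := by
    intro i
    rcases Nat.lt_or_ge j k with hlt | hge
    · rw [wstate_toggle_two (X := X) (j := j) (k := k) ?_ ?_ ?_ hlt hs i]
      · congr 1; simp only [eq_iff_iff]; omega
      · intro a h1 h2; simp [h1, h2]
      · simp [hjX]
      · simp [hk, hjk.symm]
    · rw [wstate_toggle_two (X := X) (j := k) (k := j) ?_ ?_ ?_ (by omega) hs.symm i, hs]
      · congr 1; simp only [eq_iff_iff]; omega
      · intro a h1 h2; simp [h1, h2]
      · simp [hk, hjk.symm]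
      · simp [hjX]
  have hjM := Finset.mem_range.1 (h.bound hj)
  have hkM := Finset.mem_range.1 (h.bound (h.sub hk))
  have hprod : wstate Q (insert j (X.erase k)) M = w := by
    rw [hst, if_neg (by omega), h.prod]
  refine ⟨⟨?_, h.bound, ?_, hprod⟩, hst⟩
  · exact Finset.insert_subset hj ((Finset.erase_subset _ _).trans h.sub)
  · apply red_of_card_eq_len
    rw [hprod, Finset.card_insert_of_notMem (by simp [hjX]), Finset.card_erase_add_one hk,
      ← h.prod]
    exact h.red.card_eq_len (h.sub.trans h.bound)

/-- The crossing of the two labels that meet at a contact. -/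
theorem FacetOn.exists_partner (h : FacetOn Q Y M w X) {j : ℕ} (hj : j ∈ Y) (hjX : j ∉ X)
    (hinv : upLabel Q X j < loLabel Q X j → w⁻¹ (loLabel Q X j) < w⁻¹ (upLabel Q X j)) :
    ∃ k ∈ X, (j < k ∧ upLabel Q X j < loLabel Q X j ∧
        upLabel Q X k = upLabel Q X j ∧ loLabel Q X k = loLabel Q X j) ∨
      (k < j ∧ loLabel Q X j < upLabel Q X j ∧
        upLabel Q X k = loLabel Q X j ∧ loLabel Q X k = upLabel Q X j) := by
  have hjM := Finset.mem_range.1 (h.bound hj)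
  -- Labels in natural order at `j` must still cross later, by `hinv`; labels in reversed order have
  -- crossed before.
  rcases lt_or_gt_of_ne (upLabel_ne_loLabel (Q := Q) (X := X) j) with hlt | hlt
  · have h2 := hinv hlt
    rw [← h.prod] at h2
    obtain ⟨k, hk, h3, h4, h5, h6⟩ := exists_crossing hjM.le (inv_upLabel_lt j) h2
    refine ⟨k, hk, Or.inl ⟨lt_of_le_of_ne h3 (fun e => hjX (e ▸ hk)), hlt, h5, h6⟩⟩
  · obtain ⟨k, hk, h3, h4, h5, h6⟩ := exists_crossing (Q := Q) (X := X) (Nat.zero_le j)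
      (by simpa [wstate] using hlt) (inv_upLabel_lt j)
    exact ⟨k, hk, Or.inr ⟨h4, hlt, h5, h6⟩⟩

/-- A flip at a contact on which `φ` is nonpositive increases the values on all weights. -/
theorem FacetOn.exists_flip_le (h : FacetOn Q Y M w X) (hw : AllInv w) {j : ℕ} (hj : j ∈ Y)
    (hjX : j ∉ X) : ∃ X', FacetOn Q Y M w X' ∧ ∀ φ : Fin (n + 1) → ℝ,
      φ (upLabel Q X j) ≤ φ (loLabel Q X j) →
      (∀ i d, ps φ (wstate Q X i) d ≤ ps φ (wstate Q X' i) d) ∧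
      (ContactNonneg φ Q Y X → ContactNonneg φ Q Y X' ∧
        ∀ i d, ps φ (wstate Q X i) d = ps φ (wstate Q X' i) d) ∧
      (φ (upLabel Q X j) < φ (loLabel Q X j) →
        ∃ i ≤ M, ∃ d, ps φ (wstate Q X i) d < ps φ (wstate Q X' i) d) := by
  have hjM := Finset.mem_range.1 (h.bound hj)
  obtain ⟨k, hk, hc⟩ := h.exists_partner hj hjX (fun hlt => hw _ _ hlt)
  have hkM := Finset.mem_range.1 (h.bound (h.sub hk))
  have hs : Equiv.swap (upLabel Q X k) (loLabel Q X k)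
      = Equiv.swap (upLabel Q X j) (loLabel Q X j) := by
    rcases hc with ⟨_, _, h1, h2⟩ | ⟨_, _, h1, h2⟩
    · rw [h1, h2]
    · rw [h1, h2, Equiv.swap_comm]
  obtain ⟨hF, hst⟩ := h.flip hj hjX hk hs
  have hne := upLabel_ne_loLabel (Q := Q) (X := X) j
  -- Between the contact and the crossing, the upper label at `j` stays above the other one. Hence
  -- exchanging them changes each weight value by a nonnegative multiple of the difference of the
  -- values of `φ`.
  have hpos : ∀ i, (j < i ∧ i ≤ k) ∨ (k < i ∧ i ≤ j) →
      (wstate Q X i)⁻¹ (upLabel Q X j) < (wstate Q X i)⁻¹ (loLabel Q X j) := by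
    intro i hi
    rcases hc with ⟨hjk, hlt, h1, h2⟩ | ⟨hjk, hlt, h1, h2⟩
    · by_contra hcon
      have hcon' := lt_of_le_of_ne (not_lt.1 hcon)
        (fun e => hne ((wstate Q X i)⁻¹.injective e).symm)
      have := h.red.stays (show i ≤ k by omega) hkM.le hlt hcon'
      rw [← h1, ← h2] at this
      exact absurd this (inv_upLabel_lt k).not_gt
    · refine h.red.stays (show k + 1 ≤ i by omega) (by omega) hlt ?_
      have := inv_succ_of_mem (Q := Q) hk
      rwa [h1, h2] at this
  refine ⟨_, hF, fun φ hφ => ⟨?_, ?_, ?_⟩⟩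
  · intro i d
    rw [hst]
    split_ifs with hi
    · rw [ps_swap hne]
      have h1 := hpos i hi
      have : (0 : ℝ) ≤ (if (wstate Q X i)⁻¹ (upLabel Q X j) ≤ d then 1 else 0) -
          (if (wstate Q X i)⁻¹ (loLabel Q X j) ≤ d then 1 else 0) := by
        split_ifs with h2 h3 h3
        · simp
        · simp
        · exact absurd (h1.le.trans h3) h2
        · simp
      nlinarith [mul_nonneg (sub_nonneg.2 hφ) this]
    · exact le_rfl
  · intro hnn
    have heq : φ (upLabel Q X j) = φ (loLabel Q X j) := le_antisymm hφ (hnn j hj hjX)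
    have hφs : ∀ x, φ (Equiv.swap (upLabel Q X j) (loLabel Q X j) x) = φ x := by
      intro x
      rw [Equiv.swap_apply_def]
      split_ifs with h1 h2
      · rw [h1, heq]
      · rw [h2, heq]
      · rfl
    have hlab : ∀ i l, φ (wstate Q (insert j (X.erase k)) i l) = φ (wstate Q X i l) := by
      intro i l
      rw [hst]
      split_ifs
      · rw [Equiv.Perm.mul_apply, hφs]
      · rfl
    refine ⟨?_, ?_⟩
    · intro i hi hiX
      simp only [upLabel, loLabel, hlab]
      by_cases hik : i = k
      · subst hik
        change φ (loLabel Q X i) ≤ φ (upLabel Q X i)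
        rcases hc with ⟨_, _, h1, h2⟩ | ⟨_, _, h1, h2⟩ <;> rw [h1, h2, heq]
      · refine hnn i hi fun hiX' => hiX ?_
        simp [hik, hiX']
    · intro i d
      rw [hst]
      split_ifs
      · rw [ps_swap_of_eq heq]
      · rfl
  · intro hlt
    -- The weight of the letter at `j` contains exactly one of the two labels and so detects the
    -- strict inequality. It is tested at time `j + 1` or `j`, according to the side of `j` on which
    -- the states change.
    have hlo : ¬ (wstate Q X j)⁻¹ (loLabel Q X j) ≤ (Q j).castSucc := by
      simp [loLabel]
    have hup : (wstate Q X j)⁻¹ (upLabel Q X j) ≤ (Q j).castSucc := by simp [upLabel]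
    rcases hc with ⟨hjk, _⟩ | ⟨hjk, _⟩
    · refine ⟨j + 1, hjM, (Q j).castSucc, ?_⟩
      rw [hst, if_pos (Or.inl ⟨by omega, by omega⟩), ps_swap hne, wstate_succ_notMem hjX,
        if_pos hup, if_neg hlo]
      linarith
    · refine ⟨j, hjM.le, (Q j).castSucc, ?_⟩
      rw [hst, if_pos (Or.inr ⟨by omega, le_rfl⟩), ps_swap hne, if_pos hup, if_neg hlo]
      linarith

/-- Every facet is dominated by a facet whose contacts are ordered by `σ`. -/
theorem FacetOn.exists_orderPos (h : FacetOn Q Y M w X) (hw : AllInv w)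
    (σ : Equiv.Perm (Fin (n + 1))) (φ : Fin (n + 1) → ℝ)
    (hφ : ∀ u v, σ⁻¹ u < σ⁻¹ v → φ v ≤ φ u) :
    ∃ X', FacetOn Q Y M w X' ∧ OrderPos σ Q Y X' ∧
      (∀ i d, ps φ (wstate Q X i) d ≤ ps φ (wstate Q X' i) d) ∧
      (ContactNonneg φ Q Y X → ∀ i d, ps φ (wstate Q X i) d = ps φ (wstate Q X' i) d) := by
  classical
  -- A functional that is strictly decreasing along `σ`. Maximizing its total value on all weights
  -- excludes contacts that are out of order.
  let g : Fin (n + 1) → ℝ := fun u => -((σ⁻¹ u : Fin (n + 1)) : ℝ)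
  let P : Finset ℕ → Prop := fun X' => FacetOn Q Y M w X' ∧
      (∀ i d, ps φ (wstate Q X i) d ≤ ps φ (wstate Q X' i) d) ∧
      (ContactNonneg φ Q Y X → ContactNonneg φ Q Y X' ∧
        ∀ i d, ps φ (wstate Q X i) d = ps φ (wstate Q X' i) d)
  let S := Y.powerset.filter P
  have hXS : X ∈ S := by
    simp only [S, Finset.mem_filter, Finset.mem_powerset]
    exact ⟨h.sub, h, fun _ _ => le_rfl, fun hn => ⟨hn, fun _ _ => rfl⟩⟩
  let Φ : Finset ℕ → ℝ := fun X' => ∑ i ∈ Finset.range (M + 1), ∑ d, ps g (wstate Q X' i) d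
  obtain ⟨Z, hZS, hmax⟩ := S.exists_max_image Φ ⟨X, hXS⟩
  simp only [S, Finset.mem_filter, Finset.mem_powerset] at hZS hmax
  obtain ⟨_, hZF, hZ1, hZ2⟩ := hZS
  refine ⟨Z, hZF, ?_, hZ1, fun hn => (hZ2 hn).2⟩
  intro j hj hjZ
  by_contra hcon
  have hlt := lt_of_le_of_ne (not_lt.1 hcon)
    (fun e => upLabel_ne_loLabel (Q := Q) (X := Z) j (σ⁻¹.injective e).symm)
  obtain ⟨Z', hF, hflip⟩ := hZF.exists_flip_le hw hj hjZ
  obtain ⟨a1, a2, -⟩ := hflip φ (hφ _ _ hlt)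
  have hg : g (upLabel Q Z j) < g (loLabel Q Z j) := by
    simp only [g]
    have : ((σ⁻¹ (loLabel Q Z j) : Fin (n + 1)) : ℝ) < ((σ⁻¹ (upLabel Q Z j) : Fin (n + 1)) : ℝ) :=
      by exact_mod_cast hlt
    linarith
  obtain ⟨b1, -, b3⟩ := hflip g hg.le
  obtain ⟨i, hi, d, hid⟩ := b3 hg
  have hlt' : Φ Z < Φ Z' := by
    refine Finset.sum_lt_sum (fun i _ => Finset.sum_le_sum fun d _ => b1 i d)
      ⟨i, by simpa using Nat.lt_succ_of_le hi, ?_⟩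
    exact Finset.sum_lt_sum (fun d _ => b1 i d) ⟨d, Finset.mem_univ _, hid⟩
  refine absurd (hmax Z' ⟨hF.sub, hF, fun i d => (hZ1 i d).trans (a1 i d), fun hn => ?_⟩) hlt'.not_ge
  obtain ⟨c1, c2⟩ := hZ2 hn
  obtain ⟨e1, e2⟩ := a2 c1
  exact ⟨e1, fun i d => (c2 i d).trans (e2 i d)⟩

/-! ### Uniqueness -/

/-- With all contacts in natural order, the last letter (if its position is in `Y`) is a crossing
exactly when the product has a descent there. Reading from the right, the product therefore
determines the set of crossings. -/
theorem unique_of_natural_order {X₁ X₂ : Finset ℕ} (h1 : Red Q X₁ M) (h2 : Red Q X₂ M)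
    (hY1 : X₁ ⊆ Y) (hY2 : X₂ ⊆ Y) (hst : wstate Q X₁ M = wstate Q X₂ M)
    (hp1 : ∀ j ∈ Y, j ∉ X₁ → upLabel Q X₁ j < loLabel Q X₁ j)
    (hp2 : ∀ j ∈ Y, j ∉ X₂ → upLabel Q X₂ j < loLabel Q X₂ j) :
    ∀ i < M, i ∈ X₁ ↔ i ∈ X₂ := by
  induction M with
  | zero => intro i hi; omega
  | succ k ih =>
    have key : ∀ {X : Finset ℕ}, Red Q X (k + 1) → X ⊆ Y →
        (∀ j ∈ Y, j ∉ X → upLabel Q X j < loLabel Q X j) → k ∈ Y →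
        (k ∈ X ↔ wstate Q X (k + 1) (Q k).succ < wstate Q X (k + 1) (Q k).castSucc) := by
      intro X hr _ hp hkY
      by_cases hk : k ∈ X
      · have := hr k hk (by omega)
        rw [wstate, if_pos hk]
        simpa [hk, simpleRefl, upLabel, loLabel] using this
      · have := hp k hkY hk
        rw [wstate, if_neg hk]
        simpa [hk, upLabel, loLabel] using this.le
    have hk : k ∈ X₁ ↔ k ∈ X₂ := by
      by_cases hkY : k ∈ Y
      · rw [key h1 hY1 hp1 hkY, key h2 hY2 hp2 hkY, hst]
      · exact ⟨fun h => absurd (hY1 h) hkY, fun h => absurd (hY2 h) hkY⟩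
    have hst' : wstate Q X₁ k = wstate Q X₂ k := by
      simp only [wstate, hk] at hst
      split_ifs at hst
      · exact mul_right_cancel hst
      · exact hst
    intro i hi
    rcases Nat.lt_succ_iff_lt_or_eq.1 hi with h | rfl
    · exact ih (h1.mono (by omega)) (h2.mono (by omega)) hst' i h
    · exact hk

/-- The labels `a` and `b` meet at position `l`. -/
def Meets (Q : ℕ → Fin n) (X : Finset ℕ) (a b : Fin (n + 1)) (l : ℕ) : Prop :=
  (upLabel Q X l = a ∧ loLabel Q X l = b) ∨ (upLabel Q X l = b ∧ loLabel Q X l = a)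

/-- This is the inductive step for uniqueness. The two labels at a descent of `σ` cross once, at
their first meeting `k`, because the order of the contacts forces their contacts to come later.
Moving the crossing to the last meeting `j` turns all earlier meetings into contacts in the opposite
order, as `σ s_p` demands. The set of meetings is unchanged, so the move can be undone. -/
theorem FacetOn.exists_star (h : FacetOn Q Y M w X) (hw : AllInv w)
    {σ : Equiv.Perm (Fin (n + 1))} {p : Fin n} (hp : σ p.succ < σ p.castSucc)
    (hpos : OrderPos σ Q Y X) :
    ∃ j k, k ∈ X ∧ (j = k ∨ j ∉ X) ∧ j ∈ Y ∧
      Meets Q X (σ p.castSucc) (σ p.succ) j ∧ Meets Q X (σ p.castSucc) (σ p.succ) k ∧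
      (∀ l ∈ Y, Meets Q X (σ p.castSucc) (σ p.succ) l → k ≤ l ∧ l ≤ j) ∧
      FacetOn Q Y M w (insert j (X.erase k)) ∧
      OrderPos (σ * simpleRefl p) Q Y (insert j (X.erase k)) ∧
      ∀ l, Meets Q (insert j (X.erase k)) (σ p.castSucc) (σ p.succ) l ↔
        Meets Q X (σ p.castSucc) (σ p.succ) l := by
  classical
  set a := σ p.castSucc with ha
  set b := σ p.succ with hb
  have hsa : σ⁻¹ a = p.castSucc := by simp [ha]
  have hsb : σ⁻¹ b = p.succ := by simp [hb]
  have hwba := hw b a hp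
  rw [← h.prod] at hwba
  obtain ⟨k, hk, -, hkM, hku, hkl⟩ := exists_crossing (Q := Q) (X := X) (Nat.zero_le M)
    (by simpa [wstate] using hp) hwba
  have hkm : Meets Q X a b k := Or.inr ⟨hku, hkl⟩
  have hmin : ∀ l ∈ Y, Meets Q X a b l → k ≤ l := by
    intro l hl hm
    have hlM := Finset.mem_range.1 (h.bound hl)
    by_cases hlX : l ∈ X
    · have hr := h.red l hlX hlM
      rcases hm with ⟨h1, h2⟩ | ⟨h1, h2⟩
      · rw [h1, h2] at hr; exact absurd hr hp.not_gt
      · exact (h.red.unique hlX hk hlM hkM (h1.trans hku.symm) (h2.trans hkl.symm)).ge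
    · have hr := hpos l hl hlX
      rcases hm with ⟨h1, h2⟩ | ⟨h1, h2⟩
      · by_contra hcon
        have h3 := inv_upLabel_lt (Q := Q) (X := X) l
        rw [h1, h2] at h3
        have h4 := h.red.stays (show l ≤ k by omega) hkM.le hp h3
        rw [← hku, ← hkl] at h4
        exact absurd h4 (inv_upLabel_lt k).not_gt
      · rw [h1, h2, hsa, hsb] at hr
        exact absurd hr Fin.castSucc_lt_succ.not_gt
  have hne : (Y.filter (Meets Q X a b)).Nonempty := ⟨k, by simp [h.sub hk, hkm]⟩
  obtain ⟨j, hj, hjmax⟩ := (Y.filter (Meets Q X a b)).exists_max_image id hne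
  simp only [Finset.mem_filter, id_eq, and_imp] at hj hjmax
  obtain ⟨hjY, hjm⟩ := hj
  have hkj := hmin j hjY hjm
  have hjk : j = k ∨ j ∉ X := by
    by_cases hjX : j ∈ X
    · left
      have hjM := Finset.mem_range.1 (h.bound hjY)
      have hr := h.red j hjX hjM
      rcases hjm with ⟨h1, h2⟩ | ⟨h1, h2⟩
      · rw [h1, h2] at hr; exact absurd hr hp.not_gt
      · exact h.red.unique hjX hk hjM hkM (h1.trans hku.symm) (h2.trans hkl.symm)
    · exact Or.inr hjX
  have hF : FacetOn Q Y M w (insert j (X.erase k)) ∧ ∀ i, wstate Q (insert j (X.erase k)) i =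
      if k < i ∧ i ≤ j then Equiv.swap a b * wstate Q X i else wstate Q X i := by
    rcases hjk with rfl | hjX
    · rw [Finset.insert_erase hk]
      exact ⟨h, fun i => by rw [if_neg (by omega)]⟩
    · have hsj : Equiv.swap (upLabel Q X j) (loLabel Q X j) = Equiv.swap a b := by
        rcases hjm with ⟨h1, h2⟩ | ⟨h1, h2⟩
        · rw [h1, h2]
        · rw [h1, h2, Equiv.swap_comm]
      obtain ⟨h1, h2⟩ := h.flip hjY hjX hk (by rw [hsj, hku, hkl, Equiv.swap_comm])
      refine ⟨h1, fun i => ?_⟩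
      rw [h2, hsj]
      congr 1; simp only [eq_iff_iff]; omega
  obtain ⟨hF, hst⟩ := hF
  refine ⟨j, k, hk, hjk, hjY, hjm, hkm, fun l hl hm => ⟨hmin l hl hm, hjmax l hl hm⟩, hF, ?_, ?_⟩
  · intro l hl hlZ
    have hlj : l ≠ j := by rintro rfl; simp at hlZ
    rw [mul_inv_rev, Equiv.Perm.mul_apply, Equiv.Perm.mul_apply, simpleRefl_inv]
    have hsw : ∀ x, simpleRefl p (σ⁻¹ (Equiv.swap a b x)) = σ⁻¹ x := by
      intro x
      have : simpleRefl p = σ⁻¹ * Equiv.swap a b * σ := by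
        rw [mul_assoc, Equiv.swap_mul_eq_mul_swap, hsa, hsb, simpleRefl]; simp
      rw [this]; simp
    by_cases hint : k < l ∧ l ≤ j
    · have hlX : l ∉ X := by
        intro hlX
        apply hlZ
        simp only [Finset.mem_insert, Finset.mem_erase]
        exact Or.inr ⟨by omega, hlX⟩
      have := hpos l hl hlX
      simp only [upLabel, loLabel] at this ⊢
      rw [hst, if_pos hint, Equiv.Perm.mul_apply, Equiv.Perm.mul_apply, hsw, hsw]
      exact this
    · simp only [upLabel, loLabel]
      rw [hst, if_neg hint]
      change simpleRefl p (σ⁻¹ (upLabel Q X l)) < simpleRefl p (σ⁻¹ (loLabel Q X l))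
      by_cases hlk : l = k
      · subst hlk
        rw [hku, hkl, hsa, hsb]
        simp [simpleRefl]
      · have hlX : l ∉ X := fun hlX => hlZ (by simp [hlk, hlX])
        by_contra hcon
        have hcon := lt_of_le_of_ne (not_lt.1 hcon) (fun e =>
          upLabel_ne_loLabel (Q := Q) (X := X) l (σ⁻¹.injective ((simpleRefl p).injective e)).symm)
        obtain ⟨h1, h2⟩ := simpleRefl_order p (hpos l hl hlX) hcon
        have hm : Meets Q X a b l := by
          left
          rw [ha, hb, ← h1, ← h2]; simp
        have := hmin l hl hm
        have := hjmax l hl hm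
        omega
  · intro l
    unfold Meets
    simp only [upLabel, loLabel]
    rw [hst]
    split_ifs
    · simp only [Equiv.Perm.mul_apply, Equiv.swap_apply_eq_iff, Equiv.swap_apply_left,
        Equiv.swap_apply_right]
      tauto
    · rfl

/-- Induction on the number of inversions of `σ`. If there are no descents, the contacts are in
natural order. At a descent, `exists_star` passes to `σ s_p`, where the two moved facets agree;
their common meetings give the same `j` and `k`, and so the original facets agree. -/
theorem FacetOn.unique (hw : AllInv w) (σ : Equiv.Perm (Fin (n + 1))) {X₁ X₂ : Finset ℕ}
    (h1 : FacetOn Q Y M w X₁) (h2 : FacetOn Q Y M w X₂) (hp1 : OrderPos σ Q Y X₁)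
    (hp2 : OrderPos σ Q Y X₂) : X₁ = X₂ := by
  induction hN : (invPairs σ).card using Nat.strong_induction_on generalizing σ X₁ X₂ with
  | _ N ih =>
    by_cases hmono : ∀ p : Fin n, σ p.castSucc < σ p.succ
    · have hsm := Fin.strictMono_iff_lt_succ.2 hmono
      have hnat : ∀ {X : Finset ℕ}, OrderPos σ Q Y X →
          ∀ j ∈ Y, j ∉ X → upLabel Q X j < loLabel Q X j := by
        intro X hp j hj hjX
        have := hsm (hp j hj hjX)
        simpa using this
      ext i
      by_cases hi : i < M
      · exact unique_of_natural_order h1.red h2.red h1.sub h2.sub (h1.prod.trans h2.prod.symm)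
          (hnat hp1) (hnat hp2) i hi
      · constructor <;> intro hx
        · exact absurd (Finset.mem_range.1 (h1.bound (h1.sub hx))) hi
        · exact absurd (Finset.mem_range.1 (h2.bound (h2.sub hx))) hi
    · push Not at hmono
      obtain ⟨p, hle⟩ := hmono
      have hp : σ p.succ < σ p.castSucc := lt_of_le_of_ne hle
        (fun e => (Fin.castSucc_lt_succ (i := p)).ne' (σ.injective e))
      obtain ⟨j1, k1, hk1, hjk1, hjY1, hjm1, hkm1, hb1, hF1, ho1, hm1⟩ := h1.exists_star hw hp hp1
      obtain ⟨j2, k2, hk2, hjk2, hjY2, hjm2, hkm2, hb2, hF2, ho2, hm2⟩ := h2.exists_star hw hp hp2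
      have hcard : (invPairs (σ * simpleRefl p)).card < N := by
        have h := card_invPairs_mul_of_lt (σ * simpleRefl p) p (by simpa [simpleRefl] using hp)
        rw [mul_assoc, show simpleRefl p * simpleRefl p = 1 by simp [simpleRefl], mul_one] at h
        omega
      have hZ := ih _ hcard _ hF1 hF2 ho1 ho2 rfl
      have hmm : ∀ l, Meets Q X₁ (σ p.castSucc) (σ p.succ) l ↔
          Meets Q X₂ (σ p.castSucc) (σ p.succ) l := fun l => by rw [← hm1, hZ, hm2]
      have e1 := hb1 j2 hjY2 ((hmm _).2 hjm2)
      have e2 := hb2 j1 hjY1 ((hmm _).1 hjm1)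
      have e3 := hb1 k2 (h2.sub hk2) ((hmm _).2 hkm2)
      have e4 := hb2 k1 (h1.sub hk1) ((hmm _).1 hkm1)
      have ej : j1 = j2 := by omega
      have ek : k1 = k2 := by omega
      subst ej ek
      have hrec : ∀ {X : Finset ℕ}, k1 ∈ X → (j1 = k1 ∨ j1 ∉ X) →
          insert k1 ((insert j1 (X.erase k1)).erase j1) = X := by
        intro X hkX hj
        rcases hj with rfl | hj
        · simp [Finset.insert_erase hkX]
        · rw [Finset.erase_insert (by simp [hj]), Finset.insert_erase hkX]
      rw [← hrec hk1 hjk1, hZ, hrec hk2 hjk2]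

/-! ### Extremality when the product is the longest element -/

theorem exists_sorting (φ : Fin (n + 1) → ℝ) :
    ∃ σ : Equiv.Perm (Fin (n + 1)), ∀ u v, σ⁻¹ u < σ⁻¹ v → φ v ≤ φ u := by
  refine ⟨Tuple.sort (fun i => - φ i), fun u v h => ?_⟩
  have := Tuple.monotone_sort (fun i => - φ i) h.le
  simpa using this

/-- Both facets are improved to facets whose contacts follow one linear order refining `φ`. These
coincide by uniqueness, and the improvement of `X` changes no value of `φ` on a weight. -/
theorem FacetOn.ps_le_of_allInv (h : FacetOn Q Y M w X) (hw : AllInv w) (hn : ContactNonneg φ Q Y X)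
    (h' : FacetOn Q Y M w X') (i : ℕ) (d : Fin (n + 1)) :
    ps φ (wstate Q X' i) d ≤ ps φ (wstate Q X i) d := by
  obtain ⟨σ, hσ⟩ := exists_sorting φ
  obtain ⟨Z, hZ, hZp, -, hZe⟩ := h.exists_orderPos hw σ φ hσ
  obtain ⟨Z', hZ', hZp', hle, -⟩ := h'.exists_orderPos hw σ φ hσ
  obtain rfl := FacetOn.unique hw σ hZ hZ' hZp hZp'
  rw [hZe hn i d]
  exact hle i d

end

section
variable {n : ℕ} {Q Q' : ℕ → Fin n} {X X' Y : Finset ℕ} {M : ℕ} {w : Equiv.Perm (Fin (n + 1))}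
  {φ : Fin (n + 1) → ℝ}

/-! ### Extension to a word whose product is the longest element -/

/-- Appending ascents one at a time ends at the longest element. In the extended word every two
labels cross, so every contact has a flip. -/
theorem exists_extension (h : Red Q X M) :
    ∃ N ≥ M, ∃ Q' : ℕ → Fin n, (∀ l < M, Q' l = Q l) ∧ Red Q' (X ∪ Finset.Ico M N) N ∧
      AllInv (wstate Q' (X ∪ Finset.Ico M N) N) := by
  induction hK : Fintype.card (Fin (n + 1) × Fin (n + 1)) - (invPairs (wstate Q X M)).card
    using Nat.strong_induction_on generalizing Q X M with
  | _ K ih =>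
    by_cases hanti : ∀ p : Fin n, wstate Q X M p.succ < wstate Q X M p.castSucc
    · refine ⟨M, le_rfl, Q, fun _ _ => rfl, by simpa using h, ?_⟩
      have hsa := Fin.strictAnti_iff_succ_lt.2 hanti
      intro u v huv
      rw [Finset.Ico_self, Finset.union_empty, ← hsa.lt_iff_gt]
      simpa using huv
    · push Not at hanti
      obtain ⟨p, hle⟩ := hanti
      have hp : wstate Q X M p.castSucc < wstate Q X M p.succ := lt_of_le_of_ne hle
        (fun e => (Fin.castSucc_lt_succ (i := p)).ne ((wstate Q X M).injective e))
      have hst : ∀ i ≤ M, wstate (Function.update Q M p) (insert M X) i = wstate Q X i := by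
        intro i hi
        exact wstate_congr (fun l hl => Function.update_of_ne (by omega) _ _)
          (fun l hl => by simp [show l ≠ M by omega])
      have hstM : wstate (Function.update Q M p) (insert M X) (M + 1)
          = wstate Q X M * simpleRefl p := by
        rw [wstate, if_pos (Finset.mem_insert_self _ _), hst M le_rfl, Function.update_self]
      have hred : Red (Function.update Q M p) (insert M X) (M + 1) := by
        intro k hk hkM
        rcases Nat.lt_succ_iff_lt_or_eq.1 hkM with hlt | rfl
        · simp only [upLabel, loLabel]
          rw [hst k hlt.le, Function.update_of_ne hlt.ne]
          exact h k (by simpa [hlt.ne] using hk) hlt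
        · simp only [upLabel, loLabel]
          rw [hst k le_rfl, Function.update_self]
          exact hp
      have hc := card_invPairs_mul_of_lt (wstate Q X M) p hp
      have hb := Finset.card_le_univ (invPairs (wstate Q X M * simpleRefl p))
      obtain ⟨N, hN, Q', hQ', hr, ha⟩ := ih _ (by rw [← hK, hstM, hc]; omega) hred rfl
      have hset : insert M X ∪ Finset.Ico (M + 1) N = X ∪ Finset.Ico M N := by
        ext a; simp only [Finset.mem_union, Finset.mem_insert, Finset.mem_Ico]
        constructor
        · rintro ((rfl | h) | h)
          · exact Or.inr ⟨le_rfl, hN⟩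
          · exact Or.inl h
          · exact Or.inr ⟨by omega, h.2⟩
        · rintro (h | h)
          · exact Or.inl (Or.inr h)
          · rcases eq_or_ne a M with rfl | hne
            · exact Or.inl (Or.inl rfl)
            · exact Or.inr ⟨by omega, h.2⟩
      rw [hset] at hr ha
      refine ⟨N, by omega, Q', fun l hl => ?_, hr, ha⟩
      rw [hQ' l (by omega), Function.update_of_ne hl.ne]

theorem wstate_extension_of_le {N : ℕ} (hQ : ∀ l < M, Q' l = Q l) {i : ℕ}
    (hi : i ≤ M) : wstate Q' (X ∪ Finset.Ico M N) i = wstate Q X i :=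
  wstate_congr (fun l hl => hQ l (by omega)) (fun l hl => by
    simp only [Finset.mem_union, Finset.mem_Ico]; constructor
    · rintro (h | h)
      · exact h
      · omega
    · exact Or.inl)

theorem wstate_extension_of_ge {N : ℕ} (hX : X ⊆ Finset.range M) (hX' : X' ⊆ Finset.range M)
    (hQ : ∀ l < M, Q' l = Q l) (he : wstate Q X' M = wstate Q X M) {i : ℕ} (hi : M ≤ i) :
    wstate Q' (X' ∪ Finset.Ico M N) i = wstate Q' (X ∪ Finset.Ico M N) i := by
  have := wstate_congr_from (Q := Q') (Q' := Q') (X := X ∪ Finset.Ico M N)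
    (X' := X' ∪ Finset.Ico M N) (g := 1) hi (fun _ _ _ => rfl) (fun l hl _ => ?_) ?_
  · simpa using this
  · have h1 : l ∉ X := fun h => by have := Finset.mem_range.1 (hX h); omega
    have h2 : l ∉ X' := fun h => by have := Finset.mem_range.1 (hX' h); omega
    simp [h1, h2]
  · rw [one_mul, wstate_extension_of_le hQ le_rfl, wstate_extension_of_le hQ le_rfl, he]

/-- The two words have the same product, so from time `M` on their states agree and the appended
letters are reduced for both. -/
theorem FacetOn.extend {N : ℕ} (h : FacetOn Q Y M w X) (h' : FacetOn Q Y M w X') (hN : M ≤ N)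
    (hQ : ∀ l < M, Q' l = Q l) (hr : Red Q' (X ∪ Finset.Ico M N) N) :
    FacetOn Q' (Y ∪ Finset.Ico M N) N (wstate Q' (X ∪ Finset.Ico M N) N)
      (X' ∪ Finset.Ico M N) where
  sub := Finset.union_subset_union_left h'.sub
  bound := Finset.union_subset (h.bound.trans (Finset.range_subset_range.2 hN)) (by
    intro i; simp only [Finset.mem_Ico, Finset.mem_range]; exact And.right)
  red := by
    have hX := h.sub.trans h.bound
    have hX' := h'.sub.trans h'.bound
    intro k hk hkN
    rcases Nat.lt_or_ge k M with hlt | hge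
    · have hk' : k ∈ X' := by
        rcases Finset.mem_union.1 hk with h1 | h1
        · exact h1
        · have := Finset.mem_Ico.1 h1; omega
      simp only [upLabel, loLabel]
      rw [wstate_extension_of_le hQ hlt.le, hQ k hlt]
      exact h'.red k hk' hlt
    · simp only [upLabel, loLabel]
      rw [wstate_extension_of_ge hX hX' hQ (h'.prod.trans h.prod.symm) hge]
      exact hr k (Finset.mem_union_right _ (Finset.mem_Ico.2 ⟨hge, hkN⟩)) hkN
  prod := wstate_extension_of_ge (h.sub.trans h.bound) (h'.sub.trans h'.bound) hQ
    (h'.prod.trans h.prod.symm) hN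

theorem FacetOn.extend_nonneg {N : ℕ} (h : FacetOn Q Y M w X) (hQ : ∀ l < M, Q' l = Q l)
    (hn : ContactNonneg φ Q Y X) :
    ContactNonneg φ Q' (Y ∪ Finset.Ico M N) (X ∪ Finset.Ico M N) := by
  intro j hj hjX
  simp only [Finset.mem_union, not_or] at hj hjX
  have hjY : j ∈ Y := by tauto
  have hjM := Finset.mem_range.1 (h.bound hjY)
  simp only [upLabel, loLabel]
  rw [wstate_extension_of_le hQ hjM.le, hQ j hjM]
  exact hn j hjY hjX.1

/-- A facet on whose roots `φ` is nonnegative maximizes `φ` on all weights. -/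
theorem FacetOn.ps_le (h : FacetOn Q Y M w X) (hn : ContactNonneg φ Q Y X)
    (h' : FacetOn Q Y M w X') {i : ℕ} (hi : i ≤ M) (d : Fin (n + 1)) :
    ps φ (wstate Q X' i) d ≤ ps φ (wstate Q X i) d := by
  obtain ⟨N, hN, Q', hQ, hr, ha⟩ := exists_extension h.red
  have := (h.extend h hN hQ hr).ps_le_of_allInv ha (h.extend_nonneg hQ hn) (h.extend h' hN hQ hr) i d
  rwa [wstate_extension_of_le hQ hi,
    wstate_extension_of_le hQ hi] at this

/-- `φ` is nonnegative on the root of a contact of two labels that never cross, in any facet, if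
it is nonnegative on the roots of one facet. -/
theorem FacetOn.contact_le (h : FacetOn Q Y M w X) (hn : ContactNonneg φ Q Y X)
    (h' : FacetOn Q Y M w X') {j : ℕ} (hj : j ∈ Y) (hjX : j ∉ X')
    (hlt : upLabel Q X' j < loLabel Q X' j)
    (hw : w⁻¹ (upLabel Q X' j) < w⁻¹ (loLabel Q X' j)) :
    φ (loLabel Q X' j) ≤ φ (upLabel Q X' j) := by
  obtain ⟨N, hN, Q', hQ, hr, ha⟩ := exists_extension h.red
  have hX := h.sub.trans h.bound
  have hX' := h'.sub.trans h'.bound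
  have hjM := Finset.mem_range.1 (h.bound hj)
  have hZ := h.extend h hN hQ hr
  have hZ' := h.extend h' hN hQ hr
  have hu : upLabel Q' (X' ∪ Finset.Ico M N) j = upLabel Q X' j := by
    rw [upLabel, wstate_extension_of_le hQ hjM.le, hQ j hjM, upLabel]
  have hl : loLabel Q' (X' ∪ Finset.Ico M N) j = loLabel Q X' j := by
    rw [loLabel, wstate_extension_of_le hQ hjM.le, hQ j hjM, loLabel]
  have hjZ : j ∉ X' ∪ Finset.Ico M N := by simp [hjX, hjM]
  have hjY : j ∈ Y ∪ Finset.Ico M N := Finset.mem_union_left _ hj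
  obtain ⟨k, hk, hc⟩ := hZ'.exists_partner hjY hjZ (fun hlt => ha _ _ hlt)
  rcases hc with ⟨hjk, -, h1, h2⟩ | ⟨-, hbad, -⟩
  swap
  · rw [hu, hl] at hbad; exact absurd hbad hlt.not_gt
  rw [hu] at h1
  rw [hl] at h2
  have hkN := Finset.mem_range.1 (hZ'.bound (hZ'.sub hk))
  -- The labels are not inverted in `w`, so they cross only among the appended letters.
  have hkM : M ≤ k := by
    by_contra hcon
    have h3 := inv_succ_of_mem (Q := Q') hk
    rw [h1, h2, wstate_extension_of_le hQ (by omega)] at h3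
    have h4 := h'.red.stays (by omega) le_rfl hlt h3
    rw [h'.prod] at h4
    exact absurd h4 hw.not_gt
  obtain ⟨hF, hst⟩ := hZ'.flip hjY hjZ hk (by rw [h1, h2, hu, hl])
  -- At time `k` the unflipped states of both facets agree, and the flipped state differs by
  -- exchanging the two labels. The weight of the letter at `k` contains exactly one of them, so
  -- optimality compares their values.
  have hle := hZ.ps_le_of_allInv ha (h.extend_nonneg hQ hn) hF k (Q' k).castSucc
  rw [hst, if_pos (Or.inl ⟨hjk, le_rfl⟩), hu, hl, ps_swap (upLabel_ne_loLabel j),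
    wstate_extension_of_ge hX hX' hQ (h'.prod.trans h.prod.symm) hkM] at hle
  have e := wstate_extension_of_ge (N := N) hX hX' hQ (h'.prod.trans h.prod.symm) hkM
  rw [upLabel, e] at h1
  rw [loLabel, e] at h2
  rw [← h1, ← h2] at hle ⊢
  simp at hle
  linarith

/-- A facet attaining the maximum avoids the contacts on whose roots `φ` is positive. -/
theorem FacetOn.notMem_of_sum_eq (h : FacetOn Q (Finset.range M) M w X)
    (hn : ContactNonneg φ Q (Finset.range M) X) (h' : FacetOn Q (Finset.range M) M w X')
    (hs : ∑ k ∈ Finset.range M, ps φ (wstate Q X' k) (Q k).castSucc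
      = ∑ k ∈ Finset.range M, ps φ (wstate Q X k) (Q k).castSucc)
    {t : ℕ} (htM : t < M) (htX : t ∉ X) (ht : φ (loLabel Q X t) < φ (upLabel Q X t)) :
    t ∉ X' := by
  have hterm : ∀ k < M, ps φ (wstate Q X' k) (Q k).castSucc
      = ps φ (wstate Q X k) (Q k).castSucc := by
    have := (Finset.sum_eq_sum_iff_of_le (fun k hk =>
      h.ps_le hn h' (Finset.mem_range.1 hk).le (Q k).castSucc)).1 hs
    exact fun k hk => this k (Finset.mem_range.2 hk)
  -- A letter changes only its own weight, whose value before the letter is controlled by `hterm`.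
  -- Equality therefore spreads backwards from the common product `w` to all weights.
  have hall : ∀ i ≤ M, ∀ d, ps φ (wstate Q X' i) d = ps φ (wstate Q X i) d := by
    intro i hi
    induction hi using Nat.decreasingInduction with
    | self => intro d; rw [h.prod, h'.prod]
    | of_succ k hk ih =>
      intro d
      rcases eq_or_ne d (Q k).castSucc with rfl | hd
      · exact hterm k hk
      · have key : ∀ Z, ps φ (wstate Q Z (k + 1)) d = ps φ (wstate Q Z k) d := by
          intro Z
          rw [wstate]
          split_ifs
          · exact ps_mul_simpleRefl_of_ne _ hd
          · rfl
        rw [← key, ← key, ih]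
  intro htX'
  have h1 := apply_eq_of_ps_eq (hall t htM.le)
  have h2 := apply_eq_of_ps_eq (hall (t + 1) htM) (Q t).castSucc
  rw [wstate, if_pos htX', wstate_succ_notMem htX, Equiv.Perm.mul_apply, simpleRefl,
    Equiv.swap_apply_left, h1] at h2
  exact ht.ne h2

/-- A facet that avoids the contacts on whose roots `φ` is positive attains the maximum. -/
theorem FacetOn.ps_eq_of_notMem (h : FacetOn Q Y M w X) (hn : ContactNonneg φ Q Y X)
    (h' : FacetOn Q Y M w X')
    (hX' : ∀ t ∈ Y, t ∉ X → φ (loLabel Q X t) < φ (upLabel Q X t) → t ∉ X') {i : ℕ} (hi : i ≤ M)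
    (d : Fin (n + 1)) : ps φ (wstate Q X' i) d = ps φ (wstate Q X i) d := by
  classical
  -- Positions of contacts with positive value are removed from the word. On the contacts of `X`
  -- that remain `φ` vanishes, so `φ` and `-φ` are both nonnegative there, and extremality gives
  -- both inequalities.
  let Y' := Y.filter fun t => t ∉ X → φ (upLabel Q X t) ≤ φ (loLabel Q X t)
  have hY' : Y' ⊆ Y := Finset.filter_subset _ _
  have f1 : FacetOn Q Y' M w X := ⟨fun t ht => by simp [Y', h.sub ht, ht], hY'.trans h.bound,
    h.red, h.prod⟩
  have f2 : FacetOn Q Y' M w X' := by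
    refine ⟨fun t ht => ?_, hY'.trans h.bound, h'.red, h'.prod⟩
    simp only [Y', Finset.mem_filter]
    refine ⟨h'.sub ht, fun htX => ?_⟩
    by_contra hcon
    exact hX' t (h'.sub ht) htX (not_le.1 hcon) ht
  have n1 : ContactNonneg φ Q Y' X := fun j hj hjX => hn j (hY' hj) hjX
  have n2 : ContactNonneg (fun i => - φ i) Q Y' X := by
    intro j hj hjX
    simp only [Y', Finset.mem_filter] at hj
    exact neg_le_neg (hj.2 hjX)
  refine le_antisymm (f1.ps_le n1 f2 hi d) ?_
  have := f1.ps_le n2 f2 hi d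
  rw [ps_neg, ps_neg] at this
  linarith

/-! ### The Bruhat order -/

theorem exists_wstate_of_list (p₀ : Fin n) (l : List (Fin n)) :
    ∃ (Q : ℕ → Fin n) (X : Finset ℕ) (M : ℕ), X ⊆ Finset.range M ∧
      wstate Q X M = (l.map simpleRefl).prod := by
  induction l using List.reverseRecOn with
  | nil => exact ⟨fun _ => p₀, ∅, 0, by simp, rfl⟩
  | append_singleton l p ih =>
    obtain ⟨Q, X, M, h1, h2⟩ := ih
    refine ⟨Function.update Q M p, insert M X, M + 1, ?_, ?_⟩
    · refine Finset.insert_subset (by simp) (h1.trans (Finset.range_subset_range.2 (by omega)))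
    · have hst : wstate (Function.update Q M p) (insert M X) M = wstate Q X M :=
        wstate_congr (fun l hl => Function.update_of_ne (by omega) _ _)
          (fun l hl => by simp [show l ≠ M by omega])
      rw [wstate, if_pos (Finset.mem_insert_self _ _), hst, Function.update_self, h2]
      simp

theorem exists_red_wstate (p₀ : Fin n) (w : Equiv.Perm (Fin (n + 1))) :
    ∃ (Q : ℕ → Fin n) (X : Finset ℕ) (M : ℕ), X ⊆ Finset.range M ∧ Red Q X M ∧
      wstate Q X M = w := by
  obtain ⟨l, hl⟩ := exists_expression w
  obtain ⟨Q, X, M, h1, h2⟩ := exists_wstate_of_list p₀ l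
  obtain ⟨X', h3, h4, h5⟩ := exists_red_subset Q X M
  exact ⟨Q, X', M, h3.trans h1, h4, h5.trans (h2.trans hl)⟩

theorem fin_nonempty_of_lt {i j : Fin (n + 1)} (h : i < j) : Nonempty (Fin n) :=
  ⟨⟨i, by have := j.2; have : (i : ℕ) < j := h; omega⟩⟩

/-- Deleting a crossing from a word. -/
theorem wstate_erase {k : ℕ} (hk : k ∈ X) (hkM : k < M) :
    wstate Q (X.erase k) M = Equiv.swap (upLabel Q X k) (loLabel Q X k) * wstate Q X M :=
  wstate_toggle (fun i hi => by simp [hi]) (by simp [hk]) hkM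

theorem exists_crossing_of_inv {i j : Fin (n + 1)} (hij : i < j)
    (h : (wstate Q X M)⁻¹ j < (wstate Q X M)⁻¹ i) :
    ∃ k ∈ X, k < M ∧ upLabel Q X k = i ∧ loLabel Q X k = j := by
  obtain ⟨k, h1, -, h2⟩ := exists_crossing (Q := Q) (X := X) (Nat.zero_le M)
    (by simpa [wstate] using hij) h
  exact ⟨k, h1, h2⟩

theorem len_eq_card_invPairs (p₀ : Fin n) (w : Equiv.Perm (Fin (n + 1))) :
    len w = (invPairs w).card := by
  obtain ⟨Q, X, M, h1, h2, rfl⟩ := exists_red_wstate p₀ w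
  rw [← h2.card_eq_len h1, h2.card_invPairs, Finset.filter_true_of_mem]
  intro i hi; simpa using h1 hi

/-- The letter at which `i` and `j` cross is deleted from a reduced word. -/
theorem len_swap_lt {i j : Fin (n + 1)} (hij : i < j) (h : w⁻¹ j < w⁻¹ i) :
    len (Equiv.swap i j * w) < len w := by
  obtain ⟨p₀⟩ := fin_nonempty_of_lt hij
  obtain ⟨Q, X, M, h1, h2, rfl⟩ := exists_red_wstate p₀ w
  obtain ⟨k, hk, hkM, hu, hl⟩ := exists_crossing_of_inv hij h
  have := len_wstate_le (Q := Q) (X := X.erase k) (M := M)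
  rw [wstate_erase hk hkM, hu, hl] at this
  rw [← h2.card_eq_len h1]
  exact this.trans_lt (Finset.card_erase_lt_of_mem hk)

theorem lt_len_swap {i j : Fin (n + 1)} (hij : i < j) (h : w⁻¹ i < w⁻¹ j) :
    len w < len (Equiv.swap i j * w) := by
  have := len_swap_lt (w := Equiv.swap i j * w) hij (by simpa [mul_inv_rev] using h)
  rwa [Equiv.swap_mul_self_mul] at this

theorem bruhatLE.len_le {u v : Equiv.Perm (Fin (n + 1))} (h : bruhatLE u v) :
    u = v ∨ len u < len v := by
  induction h with
  | refl => exact Or.inl rfl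
  | tail _ h ih =>
    rcases ih with rfl | h1
    · exact Or.inr h.2
    · exact Or.inr (h1.trans h.2)

/-- The subword property. -/
theorem exists_subset_of_bruhatLE {u v : Equiv.Perm (Fin (n + 1))} (h : bruhatLE u v)
    (hv : wstate Q X M = v) : ∃ X' ⊆ X, wstate Q X' M = u := by
  induction h using Relation.ReflTransGen.head_induction_on with
  | refl => exact ⟨X, subset_rfl, hv⟩
  | @head x y h _ ih =>
    obtain ⟨X₁, h1, h2⟩ := ih
    obtain ⟨⟨i, j, hij, rfl⟩, hlen⟩ := h
    wlog hlt : i < j generalizing i j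
    · exact this j i hij.symm (by rwa [Equiv.swap_comm]) (by rw [h2, Equiv.swap_comm])
        (by rwa [Equiv.swap_comm]) (lt_of_le_of_ne (not_lt.1 hlt) hij.symm)
    have hinv : (Equiv.swap i j * x)⁻¹ j < (Equiv.swap i j * x)⁻¹ i := by
      simp only [mul_inv_rev, Equiv.Perm.mul_apply, Equiv.swap_inv, Equiv.swap_apply_left,
        Equiv.swap_apply_right]
      by_contra hcon
      have hcon := lt_of_le_of_ne (not_lt.1 hcon) (fun e => hij.symm (x⁻¹.injective e))
      exact absurd (len_swap_lt hlt hcon) hlen.not_gt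
    rw [← h2] at hinv
    obtain ⟨k, hk, hkM, hu, hl⟩ := exists_crossing_of_inv hlt hinv
    refine ⟨X₁.erase k, (Finset.erase_subset _ _).trans h1, ?_⟩
    rw [wstate_erase hk hkM, hu, hl, h2, Equiv.swap_mul_self_mul]

theorem swap_order {i j a b : Fin (n + 1)} (hij : i < j) (hab : a < b)
    (h : Equiv.swap i j b < Equiv.swap i j a) :
    (a = i ∧ b ≤ j) ∨ (b = j ∧ i ≤ a) := by
  simp only [Equiv.swap_apply_def] at h
  split_ifs at h <;> simp only [Fin.ext_iff, Fin.lt_def, Fin.le_def] at * <;> omega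

/-- Inversions other than `(i, j)` inject into those of `w` by exchanging `i` and `j` in the pair. A
pair whose order the exchange would reverse is kept unchanged; it is an inversion of `w` because no
label lies between `i` and `j` in value and position. -/
theorem card_invPairs_swap_le {i j : Fin (n + 1)} (hij : i < j)
    (hno : ∀ k, i < k → k < j → w⁻¹ i < w⁻¹ k → ¬ w⁻¹ k < w⁻¹ j) :
    (invPairs (Equiv.swap i j * w)).card ≤ (invPairs w).card + 1 := by
  classical
  let τ := Equiv.swap i j
  suffices h : ((invPairs (τ * w)).erase (i, j)).card ≤ (invPairs w).card by
    have := Finset.pred_card_le_card_erase (s := invPairs (τ * w)) (a := (i, j))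
    change (invPairs (τ * w)).card ≤ _
    omega
  refine Finset.card_le_card_of_injOn
    (fun q => if τ q.1 < τ q.2 then (τ q.1, τ q.2) else q) ?_ ?_
  · rintro ⟨a, b⟩ hq
    simp only [invPairs, Finset.coe_erase, Set.mem_sdiff, Finset.mem_coe, Finset.mem_filter,
      Finset.mem_univ, true_and, Set.mem_singleton_iff, Prod.mk.injEq, mul_inv_rev,
      Equiv.Perm.mul_apply] at hq ⊢
    obtain ⟨⟨hab, hinv⟩, hne⟩ := hq
    have hτ : τ⁻¹ = τ := Equiv.swap_inv i j
    rw [hτ] at hinv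
    split_ifs with hlt
    · exact ⟨hlt, hinv⟩
    · refine ⟨hab, ?_⟩
      have hgt : τ b < τ a := lt_of_le_of_ne (not_lt.1 hlt) (fun e => hab.ne' (τ.injective e))
      rcases swap_order hij hab hgt with ⟨rfl, hb⟩ | ⟨rfl, ha⟩
      · have hbj : b < j := lt_of_le_of_ne hb (fun e => hne ⟨rfl, e⟩)
        have e1 : τ a = j := Equiv.swap_apply_left _ _
        have e2 : τ b = b := Equiv.swap_apply_of_ne_of_ne hab.ne' hbj.ne
        rw [e1, e2] at hinv
        by_contra hcon
        exact hno b hab hbj (lt_of_le_of_ne (not_lt.1 hcon)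
          (fun e => hab.ne (w⁻¹.injective e))) hinv
      · have hai : i < a := lt_of_le_of_ne ha (fun e => hne ⟨e.symm, rfl⟩)
        have e1 : τ b = i := Equiv.swap_apply_right _ _
        have e2 : τ a = a := Equiv.swap_apply_of_ne_of_ne hai.ne' hab.ne
        rw [e1, e2] at hinv
        by_contra hcon
        exact hno a hai hab hinv (lt_of_le_of_ne (not_lt.1 hcon)
          (fun e => hab.ne (w⁻¹.injective e)))
  · rintro ⟨a, b⟩ hq ⟨a', b'⟩ hq' heq
    simp only [invPairs, Finset.coe_erase, Set.mem_sdiff, Finset.mem_coe, Finset.mem_filter,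
      Finset.mem_univ, true_and] at hq hq'
    have hττ : ∀ x, τ (τ x) = x := fun x => Equiv.swap_apply_self i j x
    simp only at heq
    split_ifs at heq with h1 h2 h2
    · simpa using heq
    · simp only [Prod.mk.injEq] at heq
      rw [← heq.1, ← heq.2, hττ, hττ] at h2
      exact absurd hq.1.1 h2
    · simp only [Prod.mk.injEq] at heq
      rw [heq.1, heq.2, hττ, hττ] at h1
      exact absurd hq'.1.1 h1
    · exact heq

theorem bruhatLE_swap {i j : Fin (n + 1)} (hij : i < j) (h : w⁻¹ i < w⁻¹ j) :
    bruhatLE w (Equiv.swap i j * w) :=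
  Relation.ReflTransGen.single ⟨⟨i, j, hij.ne, rfl⟩, lt_len_swap hij h⟩

/-- A label `k` between `i` and `j` in value and position would give a chain `w < (i k)w < (i j)(i
k)w < (k j)(i j)(i k)w = (i j)w`, against the cover. Without such a label the exchange adds at most
one inversion. -/
theorem bruhatCovers.swap {i j : Fin (n + 1)} (hij : i < j)
    (h : bruhatCovers w (Equiv.swap i j * w)) :
    w⁻¹ i < w⁻¹ j ∧ len (Equiv.swap i j * w) = len w + 1 := by
  obtain ⟨hle, hne, hcov⟩ := h
  have hlen : len w < len (Equiv.swap i j * w) := hle.len_le.resolve_left hne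
  have hlt : w⁻¹ i < w⁻¹ j := by
    by_contra hcon
    exact absurd (len_swap_lt hij (lt_of_le_of_ne (not_lt.1 hcon)
      (fun e => hij.ne' (w⁻¹.injective e)))) hlen.not_gt
  refine ⟨hlt, le_antisymm ?_ hlen⟩
  obtain ⟨p₀⟩ := fin_nonempty_of_lt hij
  rw [len_eq_card_invPairs p₀, len_eq_card_invPairs p₀]
  refine card_invPairs_swap_le hij fun k hik hkj h1 h2 => ?_
  have s1 := bruhatLE_swap hik h1
  have s2 : bruhatLE (Equiv.swap i k * w) (Equiv.swap i j * (Equiv.swap i k * w)) :=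
    bruhatLE_swap hij (by
      simpa [mul_inv_rev, Equiv.swap_apply_of_ne_of_ne hij.ne' hkj.ne'] using h2)
  have s3 : bruhatLE (Equiv.swap i j * (Equiv.swap i k * w))
      (Equiv.swap k j * (Equiv.swap i j * (Equiv.swap i k * w))) :=
    bruhatLE_swap hkj (by
      simpa [mul_inv_rev, Equiv.swap_apply_of_ne_of_ne hik.ne' hkj.ne] using h1)
  have e : Equiv.swap k j * (Equiv.swap i j * (Equiv.swap i k * w)) = Equiv.swap i j * w := by
    rw [← mul_assoc, ← mul_assoc]
    congr 1
    ext x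
    simp only [Equiv.Perm.mul_apply, Equiv.swap_apply_def]
    have := hij.ne; have := hik.ne; have := hkj.ne
    split_ifs <;> simp_all
  rw [e] at s3
  have hx := hcov _ s1 (s2.trans s3)
  have l1 := lt_len_swap hik h1
  rcases hx with hx | hx
  · rw [hx] at l1; exact lt_irrefl _ l1
  · have l4 := bruhatLE.len_le s2
    have l5 := bruhatLE.len_le s3
    rw [hx] at l4
    rcases l4 with l4 | l4
    · have : Equiv.swap i j * (Equiv.swap i j * w) = Equiv.swap i j * w := l4.symm
      rw [Equiv.swap_mul_self_mul] at this
      exact hne this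
    · rcases l5 with l5 | l5
      · rw [hx] at l5
        rw [l5] at l4; exact lt_irrefl _ l4
      · rw [hx] at l5
        exact lt_irrefl _ (l4.trans l5)

/-- Every generator of the Bruhat cone is the root of a contact of a facet. -/
theorem exists_facet_of_covers {i j : Fin (n + 1)} (hij : i < j)
    (hcov : bruhatCovers w (Equiv.swap i j * w)) {D : Finset ℕ} (hD : D ⊆ Y)
    (hY : Y ⊆ Finset.range M) (hle : bruhatLE (Equiv.swap i j * w) (wstate Q D M)) :
    ∃ X', FacetOn Q Y M w X' ∧ ∃ k ∈ Y, k ∉ X' ∧ upLabel Q X' k = i ∧ loLabel Q X' k = j := by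
  obtain ⟨hlt, hlen⟩ := hcov.swap hij
  -- A reduced subword for `s_β w` has one letter more than a reduced word for `w`. Deleting the
  -- crossing of `i` and `j` leaves a reduced word for `w` and turns that position into the required
  -- contact.
  obtain ⟨U, hU, hUu⟩ := exists_subset_of_bruhatLE hle rfl
  obtain ⟨U', hU', hr, hU'u⟩ := exists_red_subset Q U M
  rw [hUu] at hU'u
  have hsub := hU'.trans (hU.trans hD)
  obtain ⟨k, hk, hkM, hu, hl⟩ := exists_crossing_of_inv (Q := Q) (X := U') (M := M) hij (by
    rw [hU'u]; simpa [mul_inv_rev] using hlt)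
  have hst : wstate Q (U'.erase k) k = wstate Q U' k :=
    wstate_congr (fun _ _ => rfl) (fun l hl => by simp [show l ≠ k by omega])
  have hprod : wstate Q (U'.erase k) M = w := by
    rw [wstate_erase hk hkM, hu, hl, hU'u, Equiv.swap_mul_self_mul]
  refine ⟨U'.erase k, ⟨(Finset.erase_subset _ _).trans hsub, hY, ?_, hprod⟩, k, hsub hk, by simp,
    ?_, ?_⟩
  · apply red_of_card_eq_len
    have := hr.card_eq_len (hsub.trans hY)
    rw [hU'u, hlen] at this
    rw [hprod, Finset.card_erase_of_mem hk, this]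
    simp
  · rw [upLabel, hst, ← hu, upLabel]
  · rw [loLabel, hst, ← hl, loLabel]

end

/-! ## Words indexed by a finite linear order -/

section
theorem subProd_insert {n : ℕ} {ι : Type} [LinearOrder ι] (Q : ι → Fin n) {S : Finset ι} {k : ι} (h : ∀ i ∈ S, i < k) :
    subProd Q (insert k S) = subProd Q S * simpleRefl (Q k) := by
  have hk : k ∉ S := fun hk => lt_irrefl _ (h k hk)
  have : (insert k S).sort (· ≤ ·) = S.sort (· ≤ ·) ++ [k] := by
    have hn : (S.sort (· ≤ ·) ++ [k]).Nodup := by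
      rw [List.nodup_append]
      refine ⟨Finset.sort_nodup _ _, by simp, ?_⟩
      intro a ha b hb
      simp only [Finset.mem_sort, List.mem_singleton] at ha hb
      rintro rfl
      exact hk (hb ▸ ha)
    have ht : (S.sort (· ≤ ·) ++ [k]).toFinset = insert k S := by
      ext a; simp
    rw [← ht]
    rw [List.toFinset_sort _ hn, List.pairwise_append]
    refine ⟨Finset.pairwise_sort _ _, by simp, ?_⟩
    intro a ha b hb
    simp only [Finset.mem_sort, List.mem_singleton] at ha hb
    exact hb ▸ (h a ha).le
  simp [subProd, this]

variable {n : ℕ} {ι : Type} [LinearOrder ι] [Fintype ι]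

/-- The number of a position. -/
def enc (k : ι) : ℕ := (Fintype.orderIsoFinOfCardEq ι rfl).symm k

theorem enc_lt (k : ι) : enc k < Fintype.card ι := Fin.is_lt _

theorem enc_lt_enc {j k : ι} : enc j < enc k ↔ j < k := by
  unfold enc
  rw [← Fin.lt_def, OrderIso.lt_iff_lt]

theorem enc_injective : Function.Injective (enc : ι → ℕ) := fun _ _ h =>
  (Fintype.orderIsoFinOfCardEq ι rfl).symm.injective (Fin.ext h)

theorem exists_enc {i : ℕ} (h : i < Fintype.card ι) : ∃ k : ι, enc k = i :=
  ⟨Fintype.orderIsoFinOfCardEq ι rfl ⟨i, h⟩, by simp [enc]⟩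

/-- The word with positions in `ℕ`. -/
def nword (p₀ : Fin n) (Q : ι → Fin n) (i : ℕ) : Fin n :=
  -- The letter beyond the end is arbitrary: facets involve only states up to the length of the
  -- word.
  if h : i < Fintype.card ι then Q (Fintype.orderIsoFinOfCardEq ι rfl ⟨i, h⟩) else p₀

theorem nword_enc (p₀ : Fin n) (Q : ι → Fin n) (k : ι) : nword p₀ Q (enc k) = Q k := by
  rw [nword, dif_pos (enc_lt k)]
  simp [enc]

theorem mem_image_enc {S : Finset ι} {k : ι} : enc k ∈ S.image enc ↔ k ∈ S := by
  rw [Finset.mem_image]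
  exact ⟨fun ⟨_, h, e⟩ => enc_injective e ▸ h, fun h => ⟨k, h, rfl⟩⟩

theorem image_enc_subset (S : Finset ι) : S.image enc ⊆ Finset.range (Fintype.card ι) := by
  intro i hi
  obtain ⟨k, -, rfl⟩ := Finset.mem_image.1 hi
  exact Finset.mem_range.2 (enc_lt k)

theorem subProd_filter (p₀ : Fin n) (Q : ι → Fin n) (S : Finset ι) (i : ℕ)
    (hi : i ≤ Fintype.card ι) :
    subProd Q (S.filter fun k => enc k < i) = wstate (nword p₀ Q) (S.image enc) i := by
  induction i with
  | zero => simp [subProd, wstate]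
  | succ i ih =>
    obtain ⟨k, rfl⟩ := exists_enc (ι := ι) hi
    have ih := ih (by omega)
    by_cases h : k ∈ S
    · rw [wstate, if_pos (mem_image_enc.2 h), ← ih, nword_enc, ← subProd_insert]
      · congr 1
        ext j
        simp only [Finset.mem_filter, Finset.mem_insert, Nat.lt_succ_iff, le_iff_lt_or_eq,
          enc_injective.eq_iff]
        constructor
        · rintro ⟨a, b | b⟩
          · exact Or.inr ⟨a, b⟩
          · exact Or.inl b
        · rintro (rfl | ⟨a, b⟩)
          · exact ⟨h, Or.inr rfl⟩
          · exact ⟨a, Or.inl b⟩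
      · intro j hj
        exact enc_lt_enc.1 (Finset.mem_filter.1 hj).2
    · rw [wstate_succ_notMem (fun h' => h (mem_image_enc.1 h')), ← ih]
      congr 1
      ext j
      simp only [Finset.mem_filter, Nat.lt_succ_iff, le_iff_lt_or_eq, enc_injective.eq_iff]
      constructor
      · rintro ⟨a, b | rfl⟩
        · exact ⟨a, b⟩
        · exact absurd a h
      · rintro ⟨a, b⟩
        exact ⟨a, Or.inl b⟩

theorem subProd_eq_wstate (p₀ : Fin n) (Q : ι → Fin n) (S : Finset ι) :
    subProd Q S = wstate (nword p₀ Q) (S.image enc) (Fintype.card ι) := by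
  rw [← subProd_filter p₀ Q S _ le_rfl, Finset.filter_true_of_mem]
  exact fun k _ => enc_lt k

theorem prefixProd_eq_wstate (p₀ : Fin n) (Q : ι → Fin n) (J : Finset ι) (k : ι) :
    prefixProd Q J k = wstate (nword p₀ Q) (Jᶜ.image enc) (enc k) := by
  rw [← subProd_filter p₀ Q Jᶜ _ (enc_lt k).le, prefixProd]
  congr 1
  ext j
  simp [enc_lt_enc, and_comm]

theorem isFacet_iff (p₀ : Fin n) (Q : ι → Fin n) (w : Equiv.Perm (Fin (n + 1))) (J : Finset ι) :
    IsFacet Q w J ↔ FacetOn (nword p₀ Q) (Finset.range (Fintype.card ι)) (Fintype.card ι) w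
      (Jᶜ.image enc) := by
  rw [IsFacet, subProd_eq_wstate p₀ Q, ← Finset.card_image_of_injective Jᶜ enc_injective]
  constructor
  · rintro ⟨h, hc⟩
    exact ⟨image_enc_subset _, subset_rfl, red_of_card_eq_len (hc.trans (by rw [h])), h⟩
  · intro h
    exact ⟨h.prod, by rw [h.red.card_eq_len h.sub, h.prod]⟩

/-- The labels exchanged at a position. -/
theorem rootFun_eq (p₀ : Fin n) (Q : ι → Fin n) (J : Finset ι) (k : ι) :
    rootFun Q J k = root (upLabel (nword p₀ Q) (Jᶜ.image enc) (enc k))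
      (loLabel (nword p₀ Q) (Jᶜ.image enc) (enc k)) := by
  rw [rootFun, prefixProd_eq_wstate p₀, upLabel, loLabel, nword_enc]
  ext i
  simp only [permAct, simpleRoot, root, Pi.sub_apply, Pi.single_apply, Equiv.Perm.inv_eq_iff_eq]

theorem map_eq_sum (f : (Fin (n + 1) → ℝ) →ₗ[ℝ] ℝ) (x : Fin (n + 1) → ℝ) :
    f x = ∑ i, x i * f (Pi.single i 1) := by
  rw [LinearMap.pi_apply_eq_sum_univ f x]
  refine Finset.sum_congr rfl fun i _ => ?_
  rw [smul_eq_mul]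
  congr 2
  ext j
  simp [Pi.single_apply, eq_comm]

theorem map_root (f : (Fin (n + 1) → ℝ) →ₗ[ℝ] ℝ) (i j : Fin (n + 1)) :
    f (root i j) = f (Pi.single i 1) - f (Pi.single j 1) := by
  rw [root, map_sub]

theorem map_weightFun (f : (Fin (n + 1) → ℝ) →ₗ[ℝ] ℝ) (Q : ι → Fin n) (J : Finset ι) (k : ι) :
    f (weightFun Q J k) =
      ps (fun i => f (Pi.single i 1)) (prefixProd Q J k) (Q k).castSucc := by
  rw [map_eq_sum, ps]
  refine Finset.sum_congr rfl fun i _ => ?_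
  simp only [weightFun, permAct, fundWeight, Finset.sum_apply, Pi.single_apply,
    Finset.sum_ite_eq, Finset.mem_filter, Finset.mem_univ, true_and]
  simp

theorem sum_enc {g : ℕ → ℝ} : ∑ k : ι, g (enc k) = ∑ i ∈ Finset.range (Fintype.card ι), g i := by
  have : Finset.range (Fintype.card ι) = Finset.univ.image (enc : ι → ℕ) := by
    refine subset_antisymm (fun i hi => ?_) (image_enc_subset _)
    obtain ⟨k, rfl⟩ := exists_enc (Finset.mem_range.1 hi)
    exact Finset.mem_image_of_mem _ (Finset.mem_univ k)
  rw [this, Finset.sum_image (fun _ _ _ _ h => enc_injective h)]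

theorem map_brickVector (p₀ : Fin n) (f : (Fin (n + 1) → ℝ) →ₗ[ℝ] ℝ) (Q : ι → Fin n)
    (J : Finset ι) :
    f (brickVector Q J) = -∑ i ∈ Finset.range (Fintype.card ι), ps (fun i => f (Pi.single i 1))
      (wstate (nword p₀ Q) (Jᶜ.image enc) i) (nword p₀ Q i).castSucc := by
  rw [brickVector, map_neg, map_sum, ← sum_enc]
  congr 1
  refine Finset.sum_congr rfl fun k _ => ?_
  rw [map_weightFun, nword_enc, prefixProd_eq_wstate p₀]

end

/-! ## Faces of brick polyhedra -/

section
variable {E : Type*} [AddCommGroup E] [Module ℝ E]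

theorem hull_nonneg {S : Set E} (f : E →ₗ[ℝ] ℝ) (h : ∀ s ∈ S, 0 ≤ f s) {x : E}
    (hx : x ∈ PointedCone.hull ℝ S) : 0 ≤ f x := by
  induction hx using Submodule.span_induction with
  | mem x hx => exact h x hx
  | zero => simp
  | add x y _ _ hx hy => rw [map_add]; exact add_nonneg hx hy
  | smul c x _ hx =>
    change 0 ≤ f ((c : ℝ) • x)
    rw [map_smul]
    exact mul_nonneg c.2 hx

theorem hull_eq_zero {S : Set E} (f : E →ₗ[ℝ] ℝ) (h : ∀ s ∈ S, 0 < f s) {x : E}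
    (hx : x ∈ PointedCone.hull ℝ S) (h0 : f x = 0) : x = 0 := by
  induction hx using Submodule.span_induction with
  | mem x hx => exact absurd h0 (h x hx).ne'
  | zero => rfl
  | add x y hx' hy' hx hy =>
    have h1 := hull_nonneg f (fun s hs => (h s hs).le) hx'
    have h2 := hull_nonneg f (fun s hs => (h s hs).le) hy'
    rw [map_add] at h0
    rw [hx (by linarith), hy (by linarith), add_zero]
  | smul c x _ hx =>
    change f ((c : ℝ) • x) = 0 at h0
    change (c : ℝ) • x = 0
    rw [map_smul, smul_eq_mul, mul_eq_zero] at h0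
    rcases h0 with h0 | h0
    · rw [h0, zero_smul]
    · rw [hx h0, smul_zero]

/-- A convex combination of two values that are at least `m` equals `m` only if each term with
nonzero weight does, so the set of points with the asserted property is convex. -/
theorem convexHull_min {S : Set E} (f : E →ₗ[ℝ] ℝ) {m : ℝ} (h : ∀ s ∈ S, m ≤ f s) {x : E}
    (hx : x ∈ convexHull ℝ S) :
    m ≤ f x ∧ (f x = m → x ∈ convexHull ℝ {s ∈ S | f s = m}) := by
  suffices convexHull ℝ S ⊆ {x | m ≤ f x ∧ (f x = m → x ∈ convexHull ℝ {s ∈ S | f s = m})} from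
    this hx
  refine _root_.convexHull_min (fun s hs => ⟨h s hs, fun e => subset_convexHull ℝ _ ⟨hs, e⟩⟩) ?_
  rintro x ⟨hx, hx'⟩ y ⟨hy, hy'⟩ a b ha hb hab
  have e : f (a • x + b • y) - m = a * (f x - m) + b * (f y - m) := by
    simp only [map_add, map_smul, smul_eq_mul]
    linear_combination m * hab
  have h1 : 0 ≤ a * (f x - m) := mul_nonneg ha (by linarith)
  have h2 : 0 ≤ b * (f y - m) := mul_nonneg hb (by linarith)
  refine ⟨by linarith, fun h0 => ?_⟩
  have h3 : a * (f x - m) = 0 := by linarith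
  have h4 : b * (f y - m) = 0 := by linarith
  rcases mul_eq_zero.1 h3 with rfl | h3
  · have hb1 : b = 1 := by linarith
    subst hb1
    rw [zero_smul, one_smul, zero_add]
    exact hy' (by linarith)
  rcases mul_eq_zero.1 h4 with rfl | h4
  · have ha1 : a = 1 := by linarith
    subst ha1
    rw [zero_smul, one_smul, add_zero]
    exact hx' (by linarith)
  exact convex_convexHull ℝ _ (hx' (by linarith)) (hy' (by linarith)) ha hb hab

end

section
variable {n : ℕ} {ι : Type} [LinearOrder ι] [Fintype ι] {Q : ι → Fin n}
  {w : Equiv.Perm (Fin (n + 1))} {T A J : Finset ι} {f : (Fin (n + 1) → ℝ) →ₗ[ℝ] ℝ}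

theorem map_rootFun (p₀ : Fin n) (f : (Fin (n + 1) → ℝ) →ₗ[ℝ] ℝ) (Q : ι → Fin n) (J : Finset ι)
    (k : ι) : f (rootFun Q J k)
      = f (Pi.single (upLabel (nword p₀ Q) (Jᶜ.image enc) (enc k)) 1)
        - f (Pi.single (loLabel (nword p₀ Q) (Jᶜ.image enc) (enc k)) 1) := by
  rw [rootFun_eq p₀, map_root]

theorem contactNonneg_image (p₀ : Fin n) (h : ∀ t ∈ T, 0 ≤ f (rootFun Q T t)) :
    ContactNonneg (fun i => f (Pi.single i 1)) (nword p₀ Q) (Finset.range (Fintype.card ι))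
      (Tᶜ.image enc) := by
  intro j hj hjX
  obtain ⟨t, rfl⟩ := exists_enc (ι := ι) (Finset.mem_range.1 hj)
  rw [mem_image_enc, Finset.mem_compl, not_not] at hjX
  have := h t hjX
  rw [map_rootFun p₀] at this
  exact sub_nonneg.1 this

theorem map_brickVector_le (p₀ : Fin n) (hT : IsFacet Q w T)
    (h : ∀ t ∈ T, 0 ≤ f (rootFun Q T t)) (hJ : IsFacet Q w J) :
    f (brickVector Q T) ≤ f (brickVector Q J) := by
  rw [map_brickVector p₀, map_brickVector p₀, neg_le_neg_iff]
  refine Finset.sum_le_sum fun i hi => ?_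
  exact ((isFacet_iff p₀ Q w T).1 hT).ps_le (contactNonneg_image p₀ h)
    ((isFacet_iff p₀ Q w J).1 hJ) (Finset.mem_range.1 hi).le _

/-- Contacts with positive value are forced by `notMem_of_sum_eq`, and by `ps_eq_of_notMem` nothing
else matters. -/
theorem map_brickVector_eq_iff (p₀ : Fin n) (hT : IsFacet Q w T)
    (h : ∀ t ∈ T, 0 ≤ f (rootFun Q T t)) (hJ : IsFacet Q w J) :
    f (brickVector Q J) = f (brickVector Q T) ↔ ∀ t ∈ T, 0 < f (rootFun Q T t) → t ∈ J := by
  have hT' := (isFacet_iff p₀ Q w T).1 hT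
  have hJ' := (isFacet_iff p₀ Q w J).1 hJ
  rw [map_brickVector p₀, map_brickVector p₀, neg_inj]
  constructor
  · intro hs t ht hpos
    have := hT'.notMem_of_sum_eq (contactNonneg_image p₀ h) hJ' hs (enc_lt t)
      (by rw [mem_image_enc]; simpa using ht)
      (by rw [map_rootFun p₀] at hpos; exact sub_pos.1 hpos)
    rw [mem_image_enc] at this
    simpa using this
  · intro hs
    refine Finset.sum_congr rfl fun i hi => ?_
    refine hT'.ps_eq_of_notMem (contactNonneg_image p₀ h) hJ' ?_ (Finset.mem_range.1 hi).le _
    intro j hj hjX hlt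
    obtain ⟨t, rfl⟩ := exists_enc (ι := ι) (Finset.mem_range.1 hj)
    rw [mem_image_enc, Finset.mem_compl, not_not] at hjX
    rw [mem_image_enc]
    simpa using hs t hjX (by rw [map_rootFun p₀]; exact sub_pos.2 hlt)

/-- By `exists_facet_of_covers` such a root belongs to a contact of a facet, and the cover relation
says that its labels are not inverted in `w`; this is the situation of `contact_le`. -/
theorem map_root_nonneg_of_covers (p₀ : Fin n) (hT : IsFacet Q w T)
    (h : ∀ t ∈ T, 0 ≤ f (rootFun Q T t)) {i j : Fin (n + 1)} (hij : i < j)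
    (hcov : bruhatCovers w (Equiv.swap i j * w)) {δ : Equiv.Perm (Fin (n + 1))}
    (hδ : IsDemazure Q δ) (hle : bruhatLE (Equiv.swap i j * w) δ) : 0 ≤ f (root i j) := by
  obtain ⟨⟨D, rfl⟩, -⟩ := hδ
  rw [subProd_eq_wstate p₀] at hle
  obtain ⟨X, hX, k, hk, hkX, rfl, rfl⟩ :=
    exists_facet_of_covers hij hcov (image_enc_subset D) subset_rfl hle
  rw [map_root, sub_nonneg]
  exact ((isFacet_iff p₀ Q w T).1 hT).contact_le (contactNonneg_image p₀ h) hX hk hkX hij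
    (hcov.swap hij).1

/-- The functional with the values `-w⁻¹(i)` on the basis vectors. -/
def invFunctional (w : Equiv.Perm (Fin (n + 1))) : (Fin (n + 1) → ℝ) →ₗ[ℝ] ℝ :=
  -∑ i, ((w⁻¹ i : Fin (n + 1)) : ℝ) • LinearMap.proj i

theorem invFunctional_root (w : Equiv.Perm (Fin (n + 1))) (i j : Fin (n + 1)) :
    invFunctional w (root i j) = ((w⁻¹ j : Fin (n + 1)) : ℝ) - ((w⁻¹ i : Fin (n + 1)) : ℝ) := by
  have h : ∀ k, invFunctional w (Pi.single k 1) = -((w⁻¹ k : Fin (n + 1)) : ℝ) := by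
    intro k
    simp only [invFunctional, LinearMap.neg_apply, LinearMap.sum_apply, LinearMap.smul_apply,
      LinearMap.proj_apply, smul_eq_mul, Pi.single_apply]
    simp
  rw [map_root, h, h]
  ring

theorem invFunctional_root_pos {i j : Fin (n + 1)} :
    0 < invFunctional w (root i j) ↔ w⁻¹ i < w⁻¹ j := by
  rw [invFunctional_root, sub_pos, Nat.cast_lt, Fin.lt_def]

/-- The roots of the elements of `A` are inversions of `w⁻¹`. -/
def InvRoots (Q : ι → Fin n) (w : Equiv.Perm (Fin (n + 1))) (T A : Finset ι) : Prop :=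
  ∀ a ∈ A, ∃ u v, rootFun Q T a = root u v ∧ w⁻¹ v < w⁻¹ u

theorem InvRoots.neg (h : InvRoots Q w T A) {a : ι} (ha : a ∈ A) :
    invFunctional w (rootFun Q T a) < 0 := by
  obtain ⟨u, v, e, hlt⟩ := h a ha
  rw [e, invFunctional_root, sub_neg, Nat.cast_lt]
  exact hlt

/-- For small `ε`, subtracting `ε` times `invFunctional w` keeps `f` nonnegative on the roots of
`T`, because that functional is negative where `f` vanishes. The difference is then nonnegative on
the Bruhat generators, where `invFunctional w` is positive. -/
theorem map_root_pos_of_covers (p₀ : Fin n) (hT : IsFacet Q w T)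
    (h0 : ∀ a ∈ A, f (rootFun Q T a) = 0) (h1 : ∀ t ∈ T \ A, 0 < f (rootFun Q T t))
    (hinv : InvRoots Q w T A) {i j : Fin (n + 1)} (hij : i < j)
    (hcov : bruhatCovers w (Equiv.swap i j * w)) {δ : Equiv.Perm (Fin (n + 1))}
    (hδ : IsDemazure Q δ) (hle : bruhatLE (Equiv.swap i j * w) δ) : 0 < f (root i j) := by
  obtain ⟨ε, hε, hb⟩ : ∃ ε : ℝ, 0 < ε ∧
      ∀ t ∈ T \ A, ε * |invFunctional w (rootFun Q T t)| ≤ f (rootFun Q T t) := by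
    have : ∀ S ⊆ T \ A, ∃ ε : ℝ, 0 < ε ∧
        ∀ t ∈ S, ε * |invFunctional w (rootFun Q T t)| ≤ f (rootFun Q T t) := by
      intro S
      induction S using Finset.induction_on with
      | empty => exact fun _ => ⟨1, one_pos, by simp⟩
      | insert t S _ ih =>
        intro hS
        obtain ⟨ε, hε, hb⟩ := ih ((Finset.subset_insert _ _).trans hS)
        have ht := h1 t (hS (Finset.mem_insert_self _ _))
        set g := |invFunctional w (rootFun Q T t)| with hg
        have hg0 : 0 ≤ g := abs_nonneg _
        -- The summand `1` keeps the denominator positive when the functional vanishes on the root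
        -- of `t`.
        refine ⟨min ε (f (rootFun Q T t) / (g + 1)), lt_min hε (by positivity), ?_⟩
        intro s hs
        rcases Finset.mem_insert.1 hs with rfl | hs
        · calc min ε (f (rootFun Q T s) / (g + 1)) * g
              ≤ f (rootFun Q T s) / (g + 1) * (g + 1) :=
                mul_le_mul (min_le_right _ _) (by linarith) hg0 (by positivity)
            _ = f (rootFun Q T s) := div_mul_cancel₀ _ (by positivity)
        · exact (mul_le_mul_of_nonneg_right (min_le_left _ _) (abs_nonneg _)).trans (hb s hs)
    exact this _ subset_rfl
  have key := map_root_nonneg_of_covers (f := f - ε • invFunctional w) p₀ hT (fun t ht => ?_)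
    hij hcov hδ hle
  · have hg := invFunctional_root_pos.2 (hcov.swap hij).1
    simp only [LinearMap.sub_apply, LinearMap.smul_apply, smul_eq_mul] at key
    have := mul_pos hε hg
    linarith
  · simp only [LinearMap.sub_apply, LinearMap.smul_apply, smul_eq_mul]
    by_cases ha : t ∈ A
    · have := mul_pos_of_neg_of_neg (neg_neg_of_pos hε) (hinv.neg ha)
      rw [h0 t ha]
      linarith
    · have := hb t (Finset.mem_sdiff.2 ⟨ht, ha⟩)
      have h2 := mul_le_mul_of_nonneg_left (le_abs_self (invFunctional w (rootFun Q T t))) hε.le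
      linarith

/-- Some facet that contains `I` has no root outside `I` that is an inversion of `w⁻¹`. -/
theorem exists_facet_invFunctional_pos (p₀ : Fin n) {I : Finset ι} (hT : IsFacet Q w T)
    (hI : I ⊆ T) : ∃ J, IsFacet Q w J ∧ I ⊆ J ∧
      ∀ j ∈ J, j ∉ I → 0 < invFunctional w (rootFun Q J j) := by
  classical
  -- In a facet with the largest sum of positions, a root inverted in `w` could be flipped to a
  -- later position.
  obtain ⟨J, hJ, hmax⟩ := (Finset.univ.filter fun J => IsFacet Q w J ∧ I ⊆ J).exists_max_image
    (fun J => ∑ j ∈ J, enc j) ⟨T, by simp [hT, hI]⟩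
  simp only [Finset.mem_filter, Finset.mem_univ, true_and] at hJ hmax
  refine ⟨J, hJ.1, hJ.2, fun j hj hjI => ?_⟩
  have hF := (isFacet_iff p₀ Q w J).1 hJ.1
  rw [rootFun_eq p₀, invFunctional_root_pos]
  by_contra hcon
  have hne := fun e => upLabel_ne_loLabel (Q := nword p₀ Q) (X := Jᶜ.image enc) (enc j)
    (w⁻¹.injective e)
  have hlt := lt_of_le_of_ne (not_lt.1 hcon) (Ne.symm hne)
  have hjX : enc j ∉ Jᶜ.image enc := by rw [mem_image_enc]; simpa using hj
  obtain ⟨k, hk, h | h⟩ := hF.exists_partner (Finset.mem_range.2 (enc_lt j)) hjX (fun _ => hlt)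
  · obtain ⟨hjk, -, hu, hl⟩ := h
    obtain ⟨k, rfl⟩ := exists_enc (ι := ι) (Finset.mem_range.1 (image_enc_subset _ hk))
    have hkJ : k ∉ J := Finset.mem_compl.1 (mem_image_enc.1 hk)
    have hF' := (hF.flip (Finset.mem_range.2 (enc_lt j)) hjX hk (by rw [hu, hl])).1
    have hjk' : k ≠ j := by rintro rfl; exact lt_irrefl _ hjk
    have himg : insert (enc j) ((Jᶜ.image enc).erase (enc k))
        = (insert k (J.erase j))ᶜ.image enc := by
      ext i
      constructor
      · intro hi
        obtain ⟨l, rfl⟩ := exists_enc (ι := ι) (Finset.mem_range.1 (hF'.sub hi))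
        rw [mem_image_enc]
        simp only [Finset.mem_insert, Finset.mem_erase, mem_image_enc, Finset.mem_compl,
          enc_injective.eq_iff, ne_eq] at hi ⊢
        rcases hi with rfl | hi
        · simp [hjk'.symm]
        · tauto
      · intro hi
        obtain ⟨l, hl, rfl⟩ := Finset.mem_image.1 hi
        simp only [Finset.mem_insert, Finset.mem_erase, mem_image_enc, Finset.mem_compl,
          enc_injective.eq_iff, ne_eq] at hl ⊢
        tauto
    rw [himg] at hF'
    have hle := hmax _ ⟨(isFacet_iff p₀ Q w _).2 hF', fun i hi => Finset.mem_insert_of_mem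
      (Finset.mem_erase.2 ⟨fun e => hjI (e ▸ hi), hJ.2 hi⟩)⟩
    rw [Finset.sum_insert (by simp [hkJ])] at hle
    have := Finset.add_sum_erase J (enc : ι → ℕ) hj
    omega
  · obtain ⟨hkj, hlo, hu, hl⟩ := h
    have hkM := Finset.mem_range.1 (hF.bound (hF.sub hk))
    have := hF.red.stays (show k + 1 ≤ Fintype.card ι from hkM) le_rfl (hF.red k hk hkM)
      (inv_succ_of_mem hk)
    rw [hF.prod, hu, hl] at this
    exact absurd this hlt.not_gt

/-- On the cone of `T` the functional `invFunctional w` is negative away from `0`, while on the cone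
of the facet from `exists_facet_invFunctional_pos` it is nonnegative. -/
theorem modifiedCone_eq_zero (p₀ : Fin n) (hT : IsFacet Q w T) (hinv : InvRoots Q w T A) :
    modifiedCone Q w (T \ A) = {0} := by
  refine Set.eq_singleton_iff_unique_mem.2 ⟨fun J _ _ => Submodule.zero_mem _, fun x hx => ?_⟩
  obtain ⟨J, hJ, hIJ, hpos⟩ := exists_facet_invFunctional_pos p₀ hT
    (Finset.sdiff_subset : T \ A ⊆ T)
  have h1 : 0 ≤ invFunctional w x := by
    refine hull_nonneg _ ?_ (hx J hJ hIJ)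
    rintro _ ⟨j, hj, hjI, rfl⟩
    exact (hpos j hj hjI).le
  have h2 : ∀ s ∈ {β | ∃ j ∈ T, j ∉ T \ A ∧ β = rootFun Q T j}, 0 < (-invFunctional w) s := by
    rintro _ ⟨j, hj, hjI, rfl⟩
    have : j ∈ A := by by_contra h; exact hjI (Finset.mem_sdiff.2 ⟨hj, h⟩)
    simpa using hinv.neg this
  have hx' := hx T hT Finset.sdiff_subset
  have h3 := hull_nonneg _ (fun s hs => (h2 s hs).le) hx'
  refine hull_eq_zero _ h2 hx' ?_
  simp only [LinearMap.neg_apply] at h3 ⊢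
  linarith

/-- Strict positivity on the Bruhat generators leaves minimizers without a cone part, so they are
convex combinations of minimal brick vectors. These belong to the facets containing `T \ A`, and the
modified cone contributes only `0`. -/
theorem minFace_brickPolyhedron (p₀ : Fin n) (hT : IsFacet Q w T)
    (h0 : ∀ a ∈ A, f (rootFun Q T a) = 0) (h1 : ∀ t ∈ T \ A, 0 < f (rootFun Q T t))
    (hinv : InvRoots Q w T A) :
    minFace (brickPolyhedron Q w) f = modifiedBrickPolyhedron Q w (T \ A) := by
  have hn : ∀ t ∈ T, 0 ≤ f (rootFun Q T t) := fun t ht => by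
    by_cases h : t ∈ A
    · exact (h0 t h).ge
    · exact (h1 t (Finset.mem_sdiff.2 ⟨ht, h⟩)).le
  have hS : ∀ s ∈ {b | ∃ J, IsFacet Q w J ∧ b = brickVector Q J}, f (brickVector Q T) ≤ f s := by
    rintro _ ⟨J, hJ, rfl⟩
    exact map_brickVector_le p₀ hT hn hJ
  have hset : {s ∈ {b | ∃ J, IsFacet Q w J ∧ b = brickVector Q J} | f s = f (brickVector Q T)}
      = {b | ∃ J, IsFacet Q w J ∧ T \ A ⊆ J ∧ b = brickVector Q J} := by
    ext b
    constructor
    · rintro ⟨⟨J, hJ, rfl⟩, hb⟩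
      have := (map_brickVector_eq_iff p₀ hT hn hJ).1 hb
      exact ⟨J, hJ, fun t ht => this t (Finset.mem_sdiff.1 ht).1 (h1 t ht), rfl⟩
    · rintro ⟨J, hJ, hIJ, rfl⟩
      refine ⟨⟨J, hJ, rfl⟩, (map_brickVector_eq_iff p₀ hT hn hJ).2 fun t ht hpos => ?_⟩
      refine hIJ (Finset.mem_sdiff.2 ⟨ht, fun h => ?_⟩)
      rw [h0 t h] at hpos
      exact lt_irrefl _ hpos
  have hcone : ∀ s ∈ {β | ∃ i j, i < j ∧ β = root i j ∧ bruhatCovers w (Equiv.swap i j * w) ∧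
      ∃ δ, IsDemazure Q δ ∧ bruhatLE (Equiv.swap i j * w) δ}, 0 < f s := by
    rintro _ ⟨i, j, hij, rfl, hcov, δ, hδ, hle⟩
    exact map_root_pos_of_covers p₀ hT h0 h1 hinv hij hcov hδ hle
  have hmem : brickVector Q T ∈ brickPolyhedron Q w :=
    ⟨_, subset_convexHull ℝ _ ⟨T, hT, rfl⟩, 0, Submodule.zero_mem _, add_zero _⟩
  rw [modifiedBrickPolyhedron, modifiedCone_eq_zero p₀ hT hinv, Set.add_singleton]
  simp only [add_zero, Set.image_id']
  rw [← hset]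
  ext x
  constructor
  · rintro ⟨⟨y, hy, z, hz, rfl⟩, hmin⟩
    have h2 := hmin _ hmem
    obtain ⟨h3, h4⟩ := convexHull_min f hS hy
    have h5 := hull_nonneg f (fun s hs => (hcone s hs).le) hz
    simp only [map_add] at h2
    have h6 : z = 0 := hull_eq_zero f hcone hz (by linarith)
    subst h6
    simp only [add_zero]
    exact h4 (by rw [map_zero] at h2; linarith)
  · intro hx
    have hfx : f x = f (brickVector Q T) := by
      have h2 := (convexHull_min f (m := f (brickVector Q T)) (fun s hs => hs.2.ge) hx).1
      have h3 := (convexHull_min (-f) (m := -f (brickVector Q T))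
        (fun s hs => by simp [hs.2]) hx).1
      simp only [LinearMap.neg_apply] at h3
      linarith
    refine ⟨⟨x, convexHull_mono (fun s hs => hs.1) hx, 0, Submodule.zero_mem _, add_zero _⟩, ?_⟩
    rintro _ ⟨y, hy, z, hz, rfl⟩
    have h3 := (convexHull_min f hS hy).1
    have h5 := hull_nonneg f (fun s hs => (hcone s hs).le) hz
    simp only [map_add]
    linarith

theorem modifiedBrickPolyhedron_nonempty (hT : IsFacet Q w T) {I : Finset ι} (hI : I ⊆ T) :
    (modifiedBrickPolyhedron Q w I).Nonempty :=
  ⟨_, Set.add_mem_add (subset_convexHull ℝ _ ⟨T, hT, hI, rfl⟩)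
    (fun _ _ _ => Submodule.zero_mem _)⟩

end

/-! ## Strands in a grid

The positions `(x, y)`, `y ≤ b`, are read column by column, each column from bottom to top, and
the labels at the levels `x + b - y` and `x + b - y + 1` are exchanged at `(x, y)` if `C x y`. -/

open scoped Classical in
/-- The labels (as a function of the level) before the position `(x, y)`. -/
def gs (b : ℕ) (C : ℕ → ℕ → Prop) : ℕ → ℕ → Equiv.Perm ℕ
  | 0, 0 => 1
  | x + 1, 0 => gs b C x (b + 1)
  | x, y + 1 =>
    if C x y then gs b C x y * Equiv.swap (x + b - y) (x + b - y + 1) else gs b C x y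
termination_by x y => (x, y)

/-- The label that enters `(x, y)` from the west. -/
def lW (b : ℕ) (C : ℕ → ℕ → Prop) (x y : ℕ) : ℕ := gs b C x 0 (x + b - y)

/-- The label that enters `(x, y)` from the south. -/
def lS (b : ℕ) (C : ℕ → ℕ → Prop) (x y : ℕ) : ℕ := gs b C x y (x + b - y + 1)

section
variable {b : ℕ} {C : ℕ → ℕ → Prop}

theorem gs_zero_zero : gs b C 0 0 = 1 := by rw [gs]

theorem gs_succ_zero (x : ℕ) : gs b C (x + 1) 0 = gs b C x (b + 1) := by rw [gs]

theorem gs_of_cross {x y : ℕ} (h : C x y) :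
    gs b C x (y + 1) = gs b C x y * Equiv.swap (x + b - y) (x + b - y + 1) := by
  rw [gs, if_pos h]

theorem gs_of_not_cross {x y : ℕ} (h : ¬ C x y) : gs b C x (y + 1) = gs b C x y := by
  rw [gs, if_neg h]

theorem gs_apply_of_ne {x y l : ℕ} (h1 : l ≠ x + b - y) (h2 : l ≠ x + b - y + 1) :
    gs b C x (y + 1) l = gs b C x y l := by
  by_cases h : C x y
  · rw [gs_of_cross h, Equiv.Perm.mul_apply, Equiv.swap_apply_of_ne_of_ne h1 h2]
  · rw [gs_of_not_cross h]

theorem gs_apply_of_forall_ne {x y y' l : ℕ} (hy : y' ≤ y)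
    (h : ∀ z, y' ≤ z → z < y → C x z → l ≠ x + b - z ∧ l ≠ x + b - z + 1) :
    gs b C x y l = gs b C x y' l := by
  induction y, hy using Nat.le_induction with
  | base => rfl
  | succ y hy ih =>
    rw [← ih fun z h1 h2 => h z h1 (by omega)]
    by_cases hc : C x y
    · obtain ⟨h1, h2⟩ := h y hy (by omega) hc
      exact gs_apply_of_ne h1 h2
    · rw [gs_of_not_cross hc]

/-- The earlier letters of the column act on larger levels. -/
theorem gs_apply_level {x y : ℕ} (hy : y ≤ b) : gs b C x y (x + b - y) = lW b C x y :=
  gs_apply_of_forall_ne (Nat.zero_le y) fun z _ hz _ => by omega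

theorem lW_zero (y : ℕ) : lW b C 0 y = b - y := by simp [lW, gs_zero_zero]

theorem lW_succ {x y : ℕ} (hy : y ≤ b) : lW b C (x + 1) y = gs b C x (y + 1) (x + b - y + 1) := by
  rw [lW, gs_succ_zero, show x + 1 + b - y = x + b - y + 1 by omega]
  exact gs_apply_of_forall_ne (by omega) fun z _ hz _ => by omega

theorem lW_succ_of_cross {x y : ℕ} (hy : y ≤ b) (h : C x y) : lW b C (x + 1) y = lW b C x y := by
  rw [lW_succ hy, gs_of_cross h, Equiv.Perm.mul_apply, Equiv.swap_apply_right, gs_apply_level hy]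

theorem lW_succ_of_not_cross {x y : ℕ} (hy : y ≤ b) (h : ¬ C x y) :
    lW b C (x + 1) y = lS b C x y := by
  rw [lW_succ hy, gs_of_not_cross h, lS]

theorem lS_succ_of_cross {x y : ℕ} (hy : y < b) (h : C x y) : lS b C x (y + 1) = lS b C x y := by
  rw [lS, gs_of_cross h, Equiv.Perm.mul_apply, show x + b - (y + 1) + 1 = x + b - y by omega,
    Equiv.swap_apply_left, lS]

theorem lS_succ_of_not_cross {x y : ℕ} (hy : y < b) (h : ¬ C x y) :
    lS b C x (y + 1) = lW b C x y := by
  rw [lS, gs_of_not_cross h, show x + b - (y + 1) + 1 = x + b - y by omega, gs_apply_level hy.le]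

theorem gs_succ_apply_of_cross {x : ℕ} (h : C x b) : gs b C (x + 1) 0 x = lS b C x b := by
  rw [gs_succ_zero, gs_of_cross h, Equiv.Perm.mul_apply, lS, Nat.add_sub_cancel,
    Equiv.swap_apply_left]

theorem gs_succ_apply_of_not_cross {x : ℕ} (h : ¬ C x b) : gs b C (x + 1) 0 x = lW b C x b := by
  rw [gs_succ_zero, gs_of_not_cross h, ← gs_apply_level le_rfl, Nat.add_sub_cancel]

theorem gs_succ_apply_of_lt {x l : ℕ} (h : l < x) : gs b C (x + 1) 0 l = gs b C x 0 l := by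
  rw [gs_succ_zero]
  exact gs_apply_of_forall_ne (by omega) fun z _ hz _ => by omega

/-- Column `x` and those after it act only on levels at least `x`, so the labels at smaller levels
are final. -/
theorem gs_apply_of_le {x x' l : ℕ} (h : l < x) (hx : x ≤ x') :
    gs b C x' 0 l = gs b C x 0 l := by
  induction x', hx using Nat.le_induction with
  | base => rfl
  | succ x' hx ih => rw [gs_succ_apply_of_lt (by omega), ih]

/-- Below the first crossing of a column nothing happens. -/
theorem lS_of_forall_not_cross {x y : ℕ} (h : ∀ z < y, ¬ C x z) :
    lS b C x y = gs b C x 0 (x + b - y + 1) :=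
  gs_apply_of_forall_ne (Nat.zero_le y) fun z _ hz hc => absurd hc (h z hz)

theorem gs_succ_apply_of_gt {x y l : ℕ} (h : ∀ z < y, ¬ C x z) (hl : x + b - y + 1 < l) :
    gs b C (x + 1) 0 l = gs b C x 0 l := by
  rw [gs_succ_zero]
  refine gs_apply_of_forall_ne (by omega) fun z _ _ hc => ?_
  have : y ≤ z := by by_contra hz; exact h z (by omega) hc
  omega

/-- A row of crossings. -/
theorem lW_eq_of_forall_cross {x x' y : ℕ} (hy : y ≤ b) (hx : x ≤ x')
    (h : ∀ z, x ≤ z → z < x' → C z y) : lW b C x' y = lW b C x y := by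
  induction x', hx using Nat.le_induction with
  | base => rfl
  | succ x' hx ih =>
    rw [lW_succ_of_cross hy (h x' hx (by omega)), ih fun z h1 h2 => h z h1 (by omega)]

/-- A column of crossings. -/
theorem lS_eq_of_forall_cross {x y y' : ℕ} (hy : y ≤ y') (hb : y' ≤ b)
    (h : ∀ z, y ≤ z → z < y' → C x z) : lS b C x y' = lS b C x y := by
  induction y', hy using Nat.le_induction with
  | base => rfl
  | succ y' hy ih =>
    rw [lS_succ_of_cross (by omega) (h y' hy (by omega)),
      ih (by omega) fun z h1 h2 => h z h1 (by omega)]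

/-- A label that turns east at `(x, y)` and runs through crossings. -/
theorem lW_eq_lS {x x' y : ℕ} (hy : y ≤ b) (h : ¬ C x y) (hx : x < x')
    (hc : ∀ z, x < z → z < x' → C z y) : lW b C x' y = lS b C x y := by
  rw [← lW_succ_of_not_cross hy h]
  exact lW_eq_of_forall_cross hy hx fun z h1 h2 => hc z h1 h2

/-- A label that turns north at `(x, y)` and runs through crossings. -/
theorem lS_eq_lW {x y y' : ℕ} (hb : y' ≤ b) (h : ¬ C x y) (hy : y < y')
    (hc : ∀ z, y < z → z < y' → C x z) : lS b C x y' = lW b C x y := by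
  rw [← lS_succ_of_not_cross (by omega) h]
  exact lS_eq_of_forall_cross hy hb fun z h1 h2 => hc z h1 h2

end

/-! ## Trees in a Ferrers diagram -/

/-- `T` is a maximal set of compatible points of the diagram `{(x, y) | h x ≤ y ≤ b}`, whose last
column is number `a`. -/
structure GridTree (a b : ℕ) (h : ℕ → ℕ) (T : ℕ → ℕ → Prop) : Prop where
  mono : Monotone h
  zero : h 0 = 0
  le_iff : ∀ x, h x ≤ b ↔ x ≤ a
  mem : ∀ {x y}, T x y → h x ≤ y ∧ y ≤ b
  compat : ∀ {x y x' y'}, T x y → T x' y' → x < x' → y < y' → y < h x'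
  maxl : ∀ {x y}, h x ≤ y → y ≤ b → ¬ T x y →
    (∃ x' y', T x' y' ∧ x' < x ∧ y' < y ∧ h x ≤ y') ∨
      (∃ x' y', T x' y' ∧ x < x' ∧ y < y' ∧ h x' ≤ y)

/-- The points of the diagram that are not in `T`. -/
def Cross (b : ℕ) (h : ℕ → ℕ) (T : ℕ → ℕ → Prop) (x y : ℕ) : Prop := h x ≤ y ∧ y ≤ b ∧ ¬ T x y

section
variable {a b : ℕ} {h : ℕ → ℕ} {T T' : ℕ → ℕ → Prop}

theorem not_cross_of_mem {x y : ℕ} (hT : T x y) : ¬ Cross b h T x y := fun hc => hc.2.2 hT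

theorem not_cross_of_lt {x : ℕ} : ∀ z < h x, ¬ Cross b h T x z := fun _ hz hc => hz.not_ge hc.1

namespace GridTree

theorem x_le (g : GridTree a b h T) {x y : ℕ} (hT : T x y) : x ≤ a :=
  (g.le_iff x).1 ((g.mem hT).1.trans (g.mem hT).2)

theorem root_mem (g : GridTree a b h T) : T 0 b := by
  by_contra hn
  rcases g.maxl (by rw [g.zero]; exact Nat.zero_le _) le_rfl hn with
    ⟨x', y', -, h1, -⟩ | ⟨x', y', h1, -, h2, -⟩
  · omega
  · have := (g.mem h1).2; omega

/-- Such a corner is compatible with every point of the diagram, so maximality puts it in the tree.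
-/
theorem corner_mem (g : GridTree a b h T) {x : ℕ} (hx : h x ≤ b) (hlt : h x < h (x + 1)) :
    T x (h x) := by
  by_contra hn
  rcases g.maxl le_rfl hx hn with ⟨x', y', -, -, h1, h2⟩ | ⟨x', y', -, h1, -, h2⟩
  · omega
  · have := g.mono (show x + 1 ≤ x' from h1)
    omega

/-- The nodes to the west and to the north span a rectangle whose lower right corner is the node
itself, so they would be incompatible. -/
theorem not_north_west (g : GridTree a b h T) {x y x' y' : ℕ} (hT : T x y) (h1 : T x y')
    (hy : y < y') (h2 : T x' y) (hx : x' < x) : False := by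
  have := g.compat h2 h1 hx hy
  have := (g.mem hT).1
  omega

/-- The lowest row above `h x` with a node to the west of column `x`, and the last such node. -/
theorem exists_top (g : GridTree a b h T) {x : ℕ} (hx0 : 0 < x) (hx : h x ≤ b) :
    ∃ y x₁, h x ≤ y ∧ x₁ < x ∧ T x₁ y ∧ T x y ∧ (∀ y', y < y' → ¬ T x y') ∧
      (∀ x' y', x' < x → h x ≤ y' → T x' y' → y ≤ y') ∧ ∀ x', x₁ < x' → x' < x → ¬ T x' y := by
  classical
  have hex : ∃ y, h x ≤ y ∧ ∃ x₁ < x, T x₁ y := ⟨b, hx, 0, hx0, g.root_mem⟩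
  obtain ⟨hy, hex1⟩ := Nat.find_spec hex
  have hmin : ∀ y' < Nat.find hex, ¬ (h x ≤ y' ∧ ∃ x₁ < x, T x₁ y') := fun y' => Nat.find_min hex
  generalize Nat.find hex = y at *
  have hmax : ∃ x₁ < x, T x₁ y ∧ ∀ x', x₁ < x' → x' < x → ¬ T x' y := by
    have hs : ((Finset.range x).filter fun z => T z y).Nonempty := by
      obtain ⟨z, h1, h2⟩ := hex1
      exact ⟨z, by simp [h1, h2]⟩
    have := Finset.max'_mem _ hs
    simp only [Finset.mem_filter, Finset.mem_range] at this
    refine ⟨_, this.1, this.2, fun x' h1 h2 h3 => ?_⟩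
    have := Finset.le_max' ((Finset.range x).filter fun z => T z y) x'
      (Finset.mem_filter.2 ⟨Finset.mem_range.2 h2, h3⟩)
    omega
  obtain ⟨x₁, hx₁, hT₁, hlast⟩ := hmax
  have hT : T x y := by
    by_contra hn
    rcases g.maxl hy (g.mem hT₁).2 hn with ⟨x', y', h1, h2, h3, h4⟩ | ⟨x', y', h1, h2, h3, h4⟩
    · exact hmin y' h3 ⟨h4, x', h2, h1⟩
    · have := g.compat hT₁ h1 (by omega) h3
      omega
  refine ⟨y, x₁, hy, hx₁, hT₁, hT, fun y' h1 h2 => ?_, fun x' y' h1 h2 h3 => ?_, hlast⟩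
  · have := g.compat hT₁ h2 hx₁ h1
    omega
  · by_contra hlt
    exact hmin y' (by omega) ⟨h2, x', h1, h3⟩

/-- The first node of a row. -/
theorem exists_first (g : GridTree a b h T) {y : ℕ} (hy : y < b) :
    ∃ x y₁, y < y₁ ∧ T x y₁ ∧ T x y ∧ (∀ x', x' < x → ¬ T x' y) ∧
      ∀ x' y', y < y' → h x' ≤ y → T x' y' → x' ≤ x := by
  classical
  have hs : ((Finset.range (a + 1)).filter fun z => h z ≤ y ∧ ∃ y₁, y < y₁ ∧ T z y₁).Nonempty :=
    ⟨0, by simp only [Finset.mem_filter, Finset.mem_range, g.zero]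
           exact ⟨by omega, by omega, b, hy, g.root_mem⟩⟩
  obtain ⟨x, hx⟩ : ∃ x, x = Finset.max' _ hs := ⟨_, rfl⟩
  have hxm := Finset.max'_mem _ hs
  rw [← hx] at hxm
  simp only [Finset.mem_filter, Finset.mem_range] at hxm
  obtain ⟨-, hhx, y₁, hy₁, hT₁⟩ := hxm
  have hmax : ∀ x' y', y < y' → h x' ≤ y → T x' y' → x' ≤ x := fun x' y' h1 h2 h3 => by
    rw [hx]
    refine Finset.le_max' _ x' (Finset.mem_filter.2 ⟨Finset.mem_range.2 ?_, h2, y', h1, h3⟩)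
    have := g.x_le h3
    omega
  refine ⟨x, y₁, hy₁, hT₁, ?_, fun x' h1 h2 => ?_, hmax⟩
  · by_contra hn
    rcases g.maxl hhx hy.le hn with ⟨x', y', h1, h2, h3, h4⟩ | ⟨x', y', h1, h2, h3, h4⟩
    · have := g.compat h1 hT₁ h2 (by omega)
      omega
    · have := hmax x' y' h3 h4 h1
      omega
  · have := g.compat h2 hT₁ h1 hy₁
    omega

/-- A row starts with the label of its height. -/
theorem lW_eq_of_forall_notMem (g : GridTree a b h T) {x y : ℕ} (hx : h x ≤ y) (hy : y ≤ b)
    (hn : ∀ x', x' < x → ¬ T x' y) : lW b (Cross b h T) x y = b - y := by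
  rw [lW_eq_of_forall_cross hy (Nat.zero_le x), lW_zero]
  exact fun z _ hz => ⟨(g.mono hz.le).trans hx, hy, hn z hz⟩

/-- The label at the top node of a column. -/
theorem lW_top (g : GridTree a b h T) {x y : ℕ} (hx : h (x + 1) ≤ b) (hT : T (x + 1) y)
    (htop : ∀ y', y < y' → ¬ T (x + 1) y') :
    lW b (Cross b h T) (x + 1) y = if h (x + 1) = h x then
      lS b (Cross b h T) x (h x) else b - (h (x + 1) - 1) := by
  obtain ⟨y₁, x₁, hy₁, hx₁, hT₁, hT₂, htop₂, hmin, hlast⟩ := g.exists_top (x := x + 1) (by omega) hx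
  obtain rfl : y = y₁ := by
    rcases lt_trichotomy y y₁ with hlt | hlt | hlt
    · exact absurd hT₂ (htop _ hlt)
    · exact hlt
    · exact absurd hT (htop₂ _ hlt)
  have hyb := (g.mem hT).2
  have hhx := g.mono (show x ≤ x + 1 by omega)
  -- Followed backwards, the label runs west to the node at `x₁`, turns there, and runs down column
  -- `x₁` through crossings to height `h (x + 1)`.
  have e1 : lW b (Cross b h T) (x + 1) y = lS b (Cross b h T) x₁ (h (x + 1)) := by
    rw [lW_eq_lS hyb (not_cross_of_mem hT₁) hx₁ fun z h1 h2 =>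
      ⟨(g.mono h2.le).trans hy₁, hyb, hlast z h1 h2⟩]
    refine lS_eq_of_forall_cross hy₁ hyb fun z h1 h2 =>
      ⟨(g.mono hx₁.le).trans h1, by omega, fun hz => ?_⟩
    have := hmin x₁ z hx₁ h1 hz
    omega
  rw [e1]
  split_ifs with he
  · suffices x₁ = x by rw [this, he]
    by_contra hne
    obtain ⟨y₂, x₂, hy₂, hx₂, hT₃, hT₄, -, hmin₂, -⟩ :=
      g.exists_top (x := x) (by omega) (hhx.trans hx)
    have h1 := hmin₂ x₁ y (by omega) (by omega) hT₁
    have h2 := hmin x₂ y₂ (by omega) (by omega) hT₃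
    obtain rfl : y = y₂ := le_antisymm h2 h1
    exact hlast x (by omega) (by omega) hT₄
  -- The row just below column `x + 1` of the diagram has its first node in the same column `x₁`.
  -- The starting label of that row turns north there.
  · obtain ⟨x₂, y₂, hy₂, hT₃, hT₄, hfirst, hmax⟩ := g.exists_first (y := h (x + 1) - 1) (by omega)
    have h1 : x₁ ≤ x₂ := hmax x₁ y (by omega) (by have := g.mono (show x₁ ≤ x by omega); omega) hT₁
    have h2 : x₂ ≤ x := by
      by_contra hlt
      have := g.mono (show x + 1 ≤ x₂ by omega)
      have := (g.mem hT₄).1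
      omega
    have h3 : x₁ = x₂ := by
      by_contra hne
      have h4 := hmin x₂ y₂ (by omega) (by omega) hT₃
      rcases eq_or_lt_of_le h4 with rfl | h5
      · exact hlast x₂ (by omega) (by omega) hT₃
      · have := g.compat hT₁ hT₃ (by omega) h5
        have := g.mono h2
        omega
    subst h3
    obtain ⟨r, hr⟩ : ∃ r, h (x + 1) = r + 1 := ⟨h (x + 1) - 1, by omega⟩
    simp only [hr, Nat.add_sub_cancel] at *
    rw [lS_succ_of_not_cross (by omega) (not_cross_of_mem hT₄),
      g.lW_eq_of_forall_notMem (g.mem hT₄).1 (by omega) hfirst]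

/-- The label that leaves a row at its end. -/
theorem lW_succ_end (g : GridTree a b h T) {x y : ℕ} (hx : h x ≤ y) (hy : y < b)
    (hlt : y + 1 < h (x + 1)) : lW b (Cross b h T) (x + 1) (y + 1) = b - y := by
  obtain ⟨x₁, y₁, hy₁, hT₁, hT₂, hfirst, hmax⟩ := g.exists_first hy
  have h1 : x₁ ≤ x := by
    by_contra hc
    have := g.mono (show x + 1 ≤ x₁ by omega)
    have := (g.mem hT₂).1
    omega
  have hhx := (g.mem hT₂).1
  -- The starting label of row `y` turns north at the first node of the row and east again at this
  -- node just above it, beyond which row `y + 1` has only crossings.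
  have hT₃ : T x₁ (y + 1) := by
    by_contra hn
    rcases g.maxl (by omega) (by omega) hn with ⟨x', y', h2, h3, h4, h5⟩ | ⟨x', y', h2, h3, h4, h5⟩
    · have := g.compat h2 hT₁ h3 (by omega)
      omega
    · have h6 : x' ≤ x := by
        by_contra hc
        have := g.mono (show x + 1 ≤ x' by omega)
        omega
      have := hmax x' y' (by omega) ((g.mono h6).trans hx) h2
      omega
  rw [lW_eq_lS (by omega) (not_cross_of_mem hT₃) (by omega) fun z h2 h3 => ?_,
    lS_succ_of_not_cross hy (not_cross_of_mem hT₂), g.lW_eq_of_forall_notMem hhx hy.le hfirst]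
  have h4 := g.mono (show z ≤ x by omega)
  refine ⟨by omega, by omega, fun h5 => ?_⟩
  have := hmax z (y + 1) (by omega) (by omega) h5
  omega

theorem lS_bottom {x : ℕ} : lS b (Cross b h T) x (h x)
    = gs b (Cross b h T) x 0 (x + b - h x + 1) :=
  lS_of_forall_not_cross not_cross_of_lt

theorem lW_succ_corner (g : GridTree a b h T) {x : ℕ} (hx : h x ≤ b) (hlt : h x < h (x + 1)) :
    lW b (Cross b h T) (x + 1) (h x) = gs b (Cross b h T) x 0 (x + b - h x + 1) := by
  rw [lW_succ_of_not_cross hx (not_cross_of_mem (g.corner_mem hx hlt)), lS_bottom]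

/-- The labels at high levels do not depend on the tree. -/
theorem gs_stack_eq (g : GridTree a b h T) (g' : GridTree a b h T') {x : ℕ} (hx : x ≤ a + 1)
    {l : ℕ} (hl : x + b - h x + 1 ≤ l) (hxl : x ≤ l) :
    gs b (Cross b h T) x 0 l = gs b (Cross b h T') x 0 l := by
  induction x generalizing l with
  | zero => rw [gs_zero_zero, gs_zero_zero]
  | succ x ih =>
    have hhx : h x ≤ b := (g.le_iff x).2 (by omega)
    rcases lt_trichotomy (x + b - h x + 1) l with h1 | h1 | h1
    · rw [gs_succ_apply_of_gt not_cross_of_lt h1, gs_succ_apply_of_gt not_cross_of_lt h1]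
      exact ih (by omega) h1.le (by omega)
    · have e := g.lW_succ_corner hhx (by omega)
      have e' := g'.lW_succ_corner hhx (by omega)
      rw [lW, show x + 1 + b - h x = l by omega] at e e'
      rw [e, e', ih (by omega) le_rfl (by omega)]
    · obtain ⟨y, rfl⟩ : ∃ y, l = x + 1 + b - (y + 1) := ⟨x + b - l, by omega⟩
      have e := g.lW_succ_end (x := x) (y := y) (by omega) (by omega) (by omega)
      have e' := g'.lW_succ_end (x := x) (y := y) (by omega) (by omega) (by omega)
      rw [lW] at e e'
      rw [e, e']

theorem gs_succ_apply_top (g : GridTree a b h T) {x y : ℕ} (hT : T x y)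
    (htop : ∀ y', y < y' → ¬ T x y') :
    gs b (Cross b h T) (x + 1) 0 x = lW b (Cross b h T) x y := by
  obtain ⟨h1, h2⟩ := g.mem hT
  rcases eq_or_lt_of_le h2 with rfl | h3
  · exact gs_succ_apply_of_not_cross (not_cross_of_mem hT)
  · rw [gs_succ_apply_of_cross ⟨by omega, le_rfl, htop b h3⟩,
      lS_eq_lW le_rfl (not_cross_of_mem hT) h3 fun z h4 h5 => ⟨by omega, h5.le, htop z h4⟩]

/-- The final labels do not depend on the tree. -/
theorem gs_final_eq (g : GridTree a b h T) (g' : GridTree a b h T') :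
    gs b (Cross b h T) (a + 1) 0 = gs b (Cross b h T') (a + 1) 0 := by
  ext l
  -- Large levels carry the labels below the diagram; each level `x ≤ a` carries the label that
  -- leaves column `x` at its top.
  by_cases hl : a + 1 ≤ l
  · refine g.gs_stack_eq g' le_rfl ?_ hl
    have := (g.le_iff (a + 1)).not.2 (by omega)
    omega
  · rw [gs_apply_of_le (x := l + 1) (by omega) (by omega),
      gs_apply_of_le (C := Cross b h T') (x := l + 1) (by omega) (by omega)]
    rcases l with _ | x
    · rw [gs_succ_apply_of_not_cross (not_cross_of_mem g.root_mem),
        gs_succ_apply_of_not_cross (not_cross_of_mem g'.root_mem), lW_zero, lW_zero]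
    · have hx : h (x + 1) ≤ b := (g.le_iff _).2 (by omega)
      obtain ⟨y, -, -, -, -, hT, htop, -⟩ := g.exists_top (x := x + 1) (by omega) hx
      obtain ⟨y', -, -, -, -, hT', htop', -⟩ := g'.exists_top (x := x + 1) (by omega) hx
      rw [g.gs_succ_apply_top hT htop, g'.gs_succ_apply_top hT' htop',
        g.lW_top hx hT htop, g'.lW_top hx hT' htop', lS_bottom, lS_bottom,
        g.gs_stack_eq g' (by omega) le_rfl (by have := g.mono (show x ≤ x + 1 by omega); omega)]

/-- The roots at an ascent are exchanged at a later point outside the tree. -/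
theorem exists_cross_of_ascent (g : GridTree a b h T) {x y x' y' : ℕ} (hT : T x y) (h1 : T x y')
    (hy : y < y') (h2 : T x' y) (hx : x < x') :
    ∃ x₂ y₂, Cross b h T x₂ y₂ ∧ lW b (Cross b h T) x₂ y₂ = lW b (Cross b h T) x y ∧
      lS b (Cross b h T) x₂ y₂ = lS b (Cross b h T) x y := by
  classical
  have hex : ∃ z, y < z ∧ T x z := ⟨y', hy, h1⟩
  have hex' : ∃ z, x < z ∧ T z y := ⟨x', hx, h2⟩
  obtain ⟨hy₂, hN⟩ := Nat.find_spec hex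
  have hminN : ∀ z < Nat.find hex, ¬ (y < z ∧ T x z) := fun z => Nat.find_min hex
  obtain ⟨hx₂, hE⟩ := Nat.find_spec hex'
  have hminE : ∀ z < Nat.find hex', ¬ (x < z ∧ T z y) := fun z => Nat.find_min hex'
  generalize Nat.find hex = y₂ at *
  generalize Nat.find hex' = x₂ at *
  have hyb := (g.mem hN).2
  have hhx := (g.mem hE).1
  have key : ∀ u v, x < u → u ≤ x₂ → y < v → ¬ T u v := fun u v hu hu' hv hc => by
    have := g.compat hT hc hu hv
    have := g.mono hu'
    omega
  -- The western label turns north at the ascent and east at the next node to the north; the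
  -- southern label turns east and then north at the next node to the east. They meet at the fourth
  -- corner of this rectangle.
  refine ⟨x₂, y₂, ⟨by omega, hyb, key _ _ hx₂ le_rfl hy₂⟩, ?_, ?_⟩
  · rw [lW_eq_lS hyb (not_cross_of_mem hN) hx₂ fun z h3 h4 => ?_,
      lS_eq_lW hyb (not_cross_of_mem hT) hy₂ fun z h3 h4 => ?_]
    · exact ⟨by have := (g.mem hT).1; omega, by omega, fun hc => hminN z h4 ⟨h3, hc⟩⟩
    · exact ⟨by have := g.mono h4.le; omega, hyb, key z y₂ h3 h4.le hy₂⟩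
  · rw [lS_eq_lW hyb (not_cross_of_mem hE) hy₂ fun z h3 h4 => ?_,
      lW_eq_lS (by omega) (not_cross_of_mem hT) hx₂ fun z h3 h4 => ?_]
    · exact ⟨by have := g.mono h4.le; omega, by omega, fun hc => hminE z h4 ⟨h3, hc⟩⟩
    · exact ⟨by omega, by omega, key x₂ z hx₂ le_rfl h3⟩

end GridTree
end

/-! ## Functionals that vanish on the roots at given ascents -/

/-- The values `φ` on the labels vanish on the roots at the nodes in `A` and are positive on the
roots at the other nodes, for the nodes in the columns before `x`. -/
def PosBefore (b : ℕ) (h : ℕ → ℕ) (T A : ℕ → ℕ → Prop) (φ : ℕ → ℝ) (x : ℕ) : Prop :=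
  ∀ x' < x, ∀ y, T x' y →
    (A x' y → φ (lW b (Cross b h T) x' y) = φ (lS b (Cross b h T) x' y)) ∧
      (¬ A x' y → φ (lS b (Cross b h T) x' y) < φ (lW b (Cross b h T) x' y))

/-- The values `φ` decrease along the labels that enter column `x` below its points. -/
def StackDecreasing (b : ℕ) (h : ℕ → ℕ) (T : ℕ → ℕ → Prop) (φ : ℕ → ℝ) (x : ℕ) : Prop :=
  ∀ l, x + b - h x + 1 ≤ l →
    φ (gs b (Cross b h T) x 0 (l + 1)) < φ (gs b (Cross b h T) x 0 l)

/-- The value of `φ` at the top node of column `x` is larger than at the entry of the column. -/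
def TopLarger (b : ℕ) (h : ℕ → ℕ) (T : ℕ → ℕ → Prop) (φ : ℕ → ℝ) (x : ℕ) : Prop :=
  ∀ y, T x y → (∀ y', y < y' → ¬ T x y') →
    φ (gs b (Cross b h T) x 0 (x + b - h x + 1)) < φ (lW b (Cross b h T) x y)

section
variable {a b : ℕ} {h : ℕ → ℕ} {T A : ℕ → ℕ → Prop} {φ : ℕ → ℝ}

namespace GridTree

/-- The label that enters a node from the south. -/
theorem lS_node (g : GridTree a b h T) {x y : ℕ} (hT : T x y) :
    (∃ y', y' < y ∧ T x y' ∧ (∀ z, y' < z → z < y → ¬ T x z) ∧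
        lS b (Cross b h T) x y = lW b (Cross b h T) x y') ∨
      ((∀ z < y, ¬ T x z) ∧
        lS b (Cross b h T) x y = gs b (Cross b h T) x 0 (x + b - h x + 1)) := by
  classical
  obtain ⟨h1, h2⟩ := g.mem hT
  by_cases hs : ((Finset.range y).filter fun z => T x z).Nonempty
  · left
    obtain ⟨y', hy'⟩ : ∃ y', y' = Finset.max' _ hs := ⟨_, rfl⟩
    have hm := Finset.max'_mem _ hs
    rw [← hy'] at hm
    simp only [Finset.mem_filter, Finset.mem_range] at hm
    have hmax : ∀ z, y' < z → z < y → ¬ T x z := fun z h3 h4 h5 => by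
      have := Finset.le_max' ((Finset.range y).filter fun z => T x z) z
        (Finset.mem_filter.2 ⟨Finset.mem_range.2 h4, h5⟩)
      omega
    refine ⟨y', hm.1, hm.2, hmax, lS_eq_lW h2 (not_cross_of_mem hm.2) hm.1 fun z h3 h4 => ?_⟩
    exact ⟨(g.mem hm.2).1.trans h3.le, by omega, hmax z h3 h4⟩
  · right
    have hn : ∀ z < y, ¬ T x z := fun z h3 h4 =>
      hs ⟨z, Finset.mem_filter.2 ⟨Finset.mem_range.2 h3, h4⟩⟩
    refine ⟨hn, ?_⟩
    rw [lS_eq_of_forall_cross h1 h2 fun z h3 h4 => ⟨h3, by omega, hn z h4⟩, lS_bottom]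

/-- Along a complete row the value of `φ` decreases. -/
theorem row_decreasing (g : GridTree a b h T) (hA : ∀ x y, A x y → ∃ x', x < x' ∧ T x' y) {x : ℕ}
    (hV : PosBefore b h T A φ (x + 1)) {y : ℕ} (hy : y < b) (hx : h x ≤ y) (hlt : y < h (x + 1)) :
    φ (lW b (Cross b h T) (x + 1) y) < φ (b - y) := by
  classical
  have hle : ∀ z ≤ x + 1, φ (lW b (Cross b h T) z y) ≤ φ (b - y) := by
    intro z
    induction z with
    | zero => intro _; rw [lW_zero]
    | succ z ih =>
      intro hz
      have ih := ih (by omega)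
      by_cases hT : T z y
      · rw [lW_succ_of_not_cross hy.le (not_cross_of_mem hT)]
        obtain ⟨h1, h2⟩ := hV z (by omega) y hT
        by_cases hAz : A z y
        · rw [← h1 hAz]; exact ih
        · exact (h2 hAz).le.trans ih
      · rw [lW_succ_of_cross hy.le ⟨(g.mono (by omega)).trans hx, hy.le, hT⟩]
        exact ih
  have hbound : ∀ z, T z y → z ≤ x := fun z hz => by
    by_contra hc
    have := g.mono (show x + 1 ≤ z by omega)
    have := (g.mem hz).1
    omega
  obtain ⟨x₁, -, -, -, hT₁, -⟩ := g.exists_first hy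
  have hs : ((Finset.range (x + 1)).filter fun z => T z y).Nonempty :=
    ⟨x₁, Finset.mem_filter.2 ⟨Finset.mem_range.2 (by have := hbound x₁ hT₁; omega), hT₁⟩⟩
  obtain ⟨x₂, hx₂⟩ : ∃ x₂, x₂ = Finset.max' _ hs := ⟨_, rfl⟩
  have hm := Finset.max'_mem _ hs
  rw [← hx₂] at hm
  simp only [Finset.mem_filter, Finset.mem_range] at hm
  have hmax : ∀ z, x₂ < z → ¬ T z y := fun z h4 h5 => by
    have := Finset.le_max' ((Finset.range (x + 1)).filter fun z => T z y) z
      (Finset.mem_filter.2 ⟨Finset.mem_range.2 (by have := hbound z h5; omega), h5⟩)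
    omega
  -- The last node of the row has nothing to its east and hence is not in `A`; the decrease there is
  -- strict.
  have hnA : ¬ A x₂ y := fun hc => by
    obtain ⟨x', h1, h2⟩ := hA _ _ hc
    exact hmax x' h1 h2
  rw [lW_eq_lS hy.le (not_cross_of_mem hm.2) hm.1 fun z h1 h2 =>
    ⟨(g.mono (by omega)).trans hx, hy.le, hmax z h1⟩]
  exact ((hV x₂ hm.1 y hm.2).2 hnA).trans_le (hle x₂ (by omega))

/-- Where consecutive rows end, the end of row `y + 1` carries the starting label of row `y`, which
`row_decreasing` compares with the end of row `y`. The remaining comparisons are inherited from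
column `x`. -/
theorem stackDecreasing_succ (g : GridTree a b h T)
    (hA : ∀ x y, A x y → ∃ x', x < x' ∧ T x' y) {x : ℕ} (hx : h (x + 1) ≤ b)
    (hV : PosBefore b h T A φ (x + 1)) (hS : StackDecreasing b h T φ x) :
    StackDecreasing b h T φ (x + 1) := by
  intro l hl
  have hhx := g.mono (show x ≤ x + 1 by omega)
  rcases lt_trichotomy (x + b - h x + 1) l with h1 | h1 | h1
  · rw [gs_succ_apply_of_gt not_cross_of_lt h1, gs_succ_apply_of_gt not_cross_of_lt (by omega)]
    exact hS l h1.le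
  · have e := g.lW_succ_corner (x := x) (by omega) (by omega)
    rw [lW, show x + 1 + b - h x = l by omega] at e
    rw [e, gs_succ_apply_of_gt not_cross_of_lt (by omega), ← h1]
    exact hS _ le_rfl
  · obtain ⟨y, rfl⟩ : ∃ y, l = x + 1 + b - (y + 1) := ⟨x + b - l, by omega⟩
    have e := g.lW_succ_end (x := x) (y := y) (by omega) (by omega) (by omega)
    rw [lW] at e
    rw [e, show x + 1 + b - (y + 1) + 1 = x + 1 + b - y by omega]
    exact g.row_decreasing hA hV (by omega) (by omega) (by omega)

/-- By `lW_top` the top label either precedes the entry label in the stack of column `x`, or is the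
starting label of the row that ends with the entry label. -/
theorem topLarger_succ (g : GridTree a b h T)
    (hA : ∀ x y, A x y → ∃ x', x < x' ∧ T x' y) {x : ℕ} (hx : h (x + 1) ≤ b)
    (hV : PosBefore b h T A φ (x + 1)) (hS : StackDecreasing b h T φ x) :
    TopLarger b h T φ (x + 1) := by
  intro y hT htop
  have hhx := g.mono (show x ≤ x + 1 by omega)
  rw [g.lW_top hx hT htop]
  split_ifs with he
  · rw [gs_succ_apply_of_gt not_cross_of_lt (by omega), lS_bottom, he,
      show x + 1 + b - h x + 1 = x + b - h x + 1 + 1 by omega]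
    exact hS _ le_rfl
  · have := g.row_decreasing hA hV (x := x) (y := h (x + 1) - 1) (by omega) (by omega) (by omega)
    rwa [lW, show x + 1 + b - (h (x + 1) - 1) = x + 1 + b - h (x + 1) + 1 by omega] at this

open scoped Classical in
/-- The values can be adapted to the nodes of the next column. -/
theorem exists_posBefore_succ (g : GridTree a b h T)
    (hA : ∀ x y, A x y → ∃ y', y < y' ∧ T x y') {x : ℕ} (hx : h x ≤ b)
    (hV : PosBefore b h T A φ x) (hS : StackDecreasing b h T φ x) (hK : TopLarger b h T φ x) :
    ∃ φ', PosBefore b h T A φ' (x + 1) ∧ StackDecreasing b h T φ' x := by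
  obtain ⟨t, hT, htop⟩ : ∃ t, T x t ∧ ∀ y', t < y' → ¬ T x y' := by
    rcases Nat.eq_zero_or_pos x with rfl | hx0
    · exact ⟨b, g.root_mem, fun y' h1 h2 => by have := (g.mem h2).2; omega⟩
    · obtain ⟨y, -, -, -, -, h1, h2, -⟩ := g.exists_top hx0 hx
      exact ⟨y, h1, h2⟩
  have htA : ¬ A x t := fun hc => by
    obtain ⟨y', h1, h2⟩ := hA _ _ hc
    exact htop y' h1 h2
  have htb := (g.mem hT).2
  let κ := φ (lW b (Cross b h T) x t)
  let σ := φ (gs b (Cross b h T) x 0 (x + b - h x + 1))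
  have hκσ : σ < κ := hK t hT htop
  -- `m y` counts the nodes above `y` outside `A`, and `M` counts all nodes of the column outside
  -- `A`. The new values descend from `κ` at the top to `σ` at the entry in `M` equal steps, one for
  -- each node outside `A`.
  let m : ℕ → ℕ := fun y => ((Finset.range (b + 1)).filter fun z => y < z ∧ T x z ∧ ¬ A x z).card
  let M : ℕ := ((Finset.range (b + 1)).filter fun z => T x z ∧ ¬ A x z).card
  have hM : 0 < M := Finset.card_pos.2 ⟨t, by simp only [Finset.mem_filter, Finset.mem_range]
                                              exact ⟨by omega, hT, htA⟩⟩
  have hM' : (0 : ℝ) < M := Nat.cast_pos.2 hM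
  -- A node below the top of its column has no node to its west, so its western label is the
  -- starting label of its row. This label occurs in no root of an earlier column and its value is
  -- free.
  let NT : ℕ → Prop := fun y => T x y ∧ ∃ y', y < y' ∧ T x y'
  let φ' : ℕ → ℝ := fun l => if ∃ y, NT y ∧ l = b - y then κ - (κ - σ) * m (b - l) / M else φ l
  have hrow : ∀ x' ≤ x, ∀ y, NT y → gs b (Cross b h T) x' 0 (x' + b - y) = b - y := by
    rintro x' hx' y ⟨hy, y', hyy', hy'⟩
    obtain ⟨h1, h2⟩ := g.mem hy
    exact g.lW_eq_of_forall_notMem ((g.mono hx').trans h1) h2 fun z hz h3 =>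
      g.not_north_west hy hy' hyy' h3 (by omega)
  have hφ : ∀ x' ≤ x, ∀ l, (∀ y, NT y → l ≠ x' + b - y) →
      φ' (gs b (Cross b h T) x' 0 l) = φ (gs b (Cross b h T) x' 0 l) := by
    intro x' hx' l hl
    refine if_neg ?_
    rintro ⟨y, hy, e⟩
    rw [← hrow x' hx' y hy] at e
    exact hl y hy ((gs b (Cross b h T) x' 0).injective e)
  have hstack : ∀ x' ≤ x, ∀ l, x' + b - h x' + 1 ≤ l →
      φ' (gs b (Cross b h T) x' 0 l) = φ (gs b (Cross b h T) x' 0 l) := by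
    intro x' hx' l hl
    refine hφ x' hx' l fun y hy => ?_
    have := g.mono hx'
    have := g.mem hy.1
    omega
  have hW : ∀ x' < x, ∀ y, T x' y →
      φ' (lW b (Cross b h T) x' y) = φ (lW b (Cross b h T) x' y) := by
    intro x' hx' y hy
    refine hφ x' hx'.le _ fun z ⟨hz, y', hzy', hy'⟩ e => ?_
    have h1 := (g.mem hy).2
    have h2 := (g.mem hz).2
    obtain rfl : y = z := by omega
    exact g.not_north_west hz hy' hzy' hy hx'
  have hWx : ∀ y, T x y → φ' (lW b (Cross b h T) x y) = κ - (κ - σ) * m y / M := by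
    intro y hy
    have hyb := (g.mem hy).2
    by_cases hN : ∃ y', y < y' ∧ T x y'
    · have e : lW b (Cross b h T) x y = b - y := hrow x le_rfl y ⟨hy, hN⟩
      rw [e]
      have : φ' (b - y) = κ - (κ - σ) * m (b - (b - y)) / M := if_pos ⟨y, ⟨hy, hN⟩, rfl⟩
      rw [this, Nat.sub_sub_self hyb]
    · obtain rfl : y = t := by
        rcases lt_trichotomy y t with h1 | h1 | h1
        · exact absurd ⟨t, h1, hT⟩ hN
        · exact h1
        · exact absurd hy (htop y h1)
      have hm : m y = 0 := by
        refine Finset.card_eq_zero.2 (Finset.filter_eq_empty_iff.2 ?_)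
        rintro z - ⟨h1, h2, -⟩
        exact htop z h1 h2
      rw [hm, Nat.cast_zero, mul_zero, zero_div, sub_zero]
      refine hφ x le_rfl _ fun z ⟨hz, y', hzy', hy'⟩ e => ?_
      have := (g.mem hz).2
      obtain rfl : y = z := by omega
      exact hN ⟨y', hzy', hy'⟩
  have hSx : ∀ y, T x y → φ' (lS b (Cross b h T) x y)
      = κ - (κ - σ) * (m y + if A x y then 0 else 1) / M := by
    intro y hy
    have hyb := (g.mem hy).2
    have hcount : ∀ (P : ℕ → Prop) [DecidablePred P], (∀ z, T x z → (P z ↔ y ≤ z)) →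
        (((Finset.range (b + 1)).filter fun z => P z ∧ T x z ∧ ¬ A x z).card : ℝ)
          = m y + if A x y then 0 else 1 := by
      intro P _ hP
      split_ifs with hAy
      · rw [add_zero]
        congr 2
        refine Finset.filter_congr fun z _ => ?_
        constructor
        · rintro ⟨h1, h2, h3⟩
          refine ⟨lt_of_le_of_ne ((hP z h2).1 h1) ?_, h2, h3⟩
          rintro rfl
          exact h3 hAy
        · rintro ⟨h1, h2, h3⟩
          exact ⟨(hP z h2).2 h1.le, h2, h3⟩
      · rw [← Nat.cast_add_one, ← Finset.card_insert_of_notMem (a := y) (s :=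
          (Finset.range (b + 1)).filter fun z => y < z ∧ T x z ∧ ¬ A x z) (by simp)]
        congr 2
        ext z
        simp only [Finset.mem_filter, Finset.mem_range, Finset.mem_insert]
        constructor
        · rintro ⟨h1, h2, h3, h4⟩
          rcases eq_or_lt_of_le ((hP z h3).1 h2) with h5 | h5
          · exact Or.inl h5.symm
          · exact Or.inr ⟨h1, h5, h3, h4⟩
        · rintro (rfl | ⟨h1, h2, h3, h4⟩)
          · exact ⟨by omega, (hP z hy).2 le_rfl, hy, hAy⟩
          · exact ⟨h1, (hP z h3).2 h2.le, h3, h4⟩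
    rcases g.lS_node hy with ⟨y', h1, h2, h3, h4⟩ | ⟨h1, h2⟩
    · have e := hcount (fun z => y' < z) fun z hz =>
        ⟨fun h5 => by by_contra h6; exact h3 z h5 (by omega) hz, fun h5 => by omega⟩
      rw [h4, hWx y' h2, ← e]
    · have e := hcount (fun _ => True) fun z hz => by
        simp only [true_iff]
        by_contra h6
        exact h1 z (by omega) hz
      simp only [true_and] at e
      rw [h2, hstack x le_rfl _ le_rfl, ← e]
      change σ = κ - (κ - σ) * (M : ℝ) / M
      rw [mul_div_cancel_right₀ _ hM'.ne']
      ring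
  refine ⟨φ', fun x' hx' y hy => ?_, fun l hl => ?_⟩
  · rcases Nat.lt_succ_iff_lt_or_eq.1 hx' with h1 | rfl
    · rw [hW x' h1 y hy]
      have e : φ' (lS b (Cross b h T) x' y) = φ (lS b (Cross b h T) x' y) := by
        rcases g.lS_node hy with ⟨y', -, h3, -, h4⟩ | ⟨-, h3⟩
        · rw [h4, hW x' h1 y' h3]
        · rw [h3, hstack x' h1.le _ le_rfl]
      rw [e]
      exact hV x' h1 y hy
    · rw [hWx y hy, hSx y hy]
      constructor
      · intro h1
        rw [if_pos h1, add_zero]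
      · intro h1
        rw [if_neg h1]
        have : 0 < (κ - σ) / M := div_pos (sub_pos.2 hκσ) hM'
        have e : κ - (κ - σ) * (m y : ℝ) / M - (κ - (κ - σ) * (m y + 1 : ℝ) / M)
            = (κ - σ) / M := by ring
        linarith
  · rw [hstack x le_rfl _ hl, hstack x le_rfl _ (by omega)]
    exact hS l hl

/-- Columns are treated from left to right; the two auxiliary inequalities are what the
interpolation in the next column needs. -/
theorem exists_values (g : GridTree a b h T) (hE : ∀ x y, A x y → ∃ x', x < x' ∧ T x' y)
    (hN : ∀ x y, A x y → ∃ y', y < y' ∧ T x y') : ∃ φ, PosBefore b h T A φ (a + 1) := by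
  suffices ∀ x ≤ a, ∃ φ, PosBefore b h T A φ x ∧ StackDecreasing b h T φ x ∧
      TopLarger b h T φ x by
    obtain ⟨φ, h1, h2, h3⟩ := this a le_rfl
    obtain ⟨φ', h4, -⟩ := g.exists_posBefore_succ hN ((g.le_iff a).2 le_rfl) h1 h2 h3
    exact ⟨φ', h4⟩
  intro x
  induction x with
  | zero =>
    refine fun _ => ⟨fun l => -l, fun x' hx' => absurd hx' (Nat.not_lt_zero _), fun l _ => ?_,
      fun y hT htop => ?_⟩
    · simp [gs_zero_zero]
    · have hy : y = b := by
        by_contra hne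
        have := (g.mem hT).2
        exact htop b (by omega) g.root_mem
      simp only [hy, lW_zero, gs_zero_zero, Nat.sub_self, Equiv.Perm.coe_one, id_eq]
      push_cast
      have : (0 : ℝ) ≤ ((0 + b - h 0 : ℕ) : ℝ) := Nat.cast_nonneg _
      linarith
  | succ x ih =>
    intro hx
    obtain ⟨φ, h1, h2, h3⟩ := ih (by omega)
    obtain ⟨φ', h4, h5⟩ := g.exists_posBefore_succ hN ((g.le_iff x).2 (by omega)) h1 h2 h3
    have hhx := (g.le_iff (x + 1)).2 hx
    exact ⟨φ', h4, g.stackDecreasing_succ hE hhx h4 h5, g.topLarger_succ hE hhx h4 h5⟩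

end GridTree
end

/-! ## The initial tree and the number of nodes -/

/-- The tree that consists of the first column and the lowest points of the other columns. -/
def initialTree (b : ℕ) (h : ℕ → ℕ) (x y : ℕ) : Prop := h x ≤ y ∧ y ≤ b ∧ (x = 0 ∨ y = h x)

section
variable {a b : ℕ} {h : ℕ → ℕ} {T : ℕ → ℕ → Prop}

namespace GridTree

theorem initialTree (g : GridTree a b h T) : GridTree a b h (initialTree b h) where
  mono := g.mono
  zero := g.zero
  le_iff := g.le_iff
  mem := fun hT => ⟨hT.1, hT.2.1⟩
  compat := by
    rintro x y x' y' - ⟨-, -, h1 | h1⟩ h2 h3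
    · omega
    · omega
  maxl := by
    intro x y h1 h2 h3
    have hx : ¬ (x = 0 ∨ y = h x) := fun hc => h3 ⟨h1, h2, hc⟩
    refine Or.inl ⟨0, h x, ⟨?_, by omega, Or.inl rfl⟩, by omega, by omega, le_rfl⟩
    rw [g.zero]
    exact Nat.zero_le _

/-- Column `0` has no crossing. In each later column the only contact, at the lowest point, sends
one label out at the top, and the other labels keep their relative order. -/
theorem initialTree_gs_lt (g : GridTree a b h T) {x : ℕ} (hx : x ≤ a) {l : ℕ} (hl : x ≤ l) :
    gs b (Cross b h (Brick.initialTree b h)) x 0 l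
      < gs b (Cross b h (Brick.initialTree b h)) x 0 (l + 1) := by
  induction x generalizing l with
  | zero => simp [gs_zero_zero]
  | succ x ih =>
    have hhx : h x ≤ b := (g.le_iff x).2 (by omega)
    have ih' : ∀ l l', x ≤ l → l < l' → gs b (Cross b h (Brick.initialTree b h)) x 0 l
        < gs b (Cross b h (Brick.initialTree b h)) x 0 l' := by
      intro l l' h1 h2
      induction l', h2 using Nat.le_induction with
      | base => exact ih (by omega) h1
      | succ l' h2 ih2 => exact ih2.trans (ih (by omega) (by omega))
    rcases Nat.eq_zero_or_pos x with rfl | hx0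
    · have e : gs b (Cross b h (Brick.initialTree b h)) 1 0
          = gs b (Cross b h (Brick.initialTree b h)) 0 0 := by
        ext l
        rw [gs_succ_zero]
        exact gs_apply_of_forall_ne (Nat.zero_le _) fun z _ _ hc =>
          absurd ⟨hc.1, hc.2.1, Or.inl rfl⟩ hc.2.2
      rw [zero_add, e]
      exact ih (by omega) (by omega)
    · have hlow : ∀ l, x + b - h x + 1 ≤ l → gs b (Cross b h (Brick.initialTree b h)) (x + 1) 0 l
          = gs b (Cross b h (Brick.initialTree b h)) x 0 l := by
        intro l h1
        rcases eq_or_lt_of_le h1 with rfl | h1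
        · have hn : ¬ Cross b h (Brick.initialTree b h) x (h x) :=
            not_cross_of_mem ⟨le_rfl, hhx, Or.inr rfl⟩
          rw [← lS_bottom, ← lW_succ_of_not_cross hhx hn, lW,
            show x + b - h x + 1 = x + 1 + b - h x by omega]
        · exact gs_succ_apply_of_gt not_cross_of_lt h1
      have hhigh : ∀ l, x ≤ l → l < x + b - h x →
          gs b (Cross b h (Brick.initialTree b h)) (x + 1) 0 (l + 1)
            = gs b (Cross b h (Brick.initialTree b h)) x 0 l := by
        intro l h1 h2
        obtain ⟨y, rfl, hy⟩ : ∃ y, l = x + b - y ∧ y ≤ b := ⟨x + b - l, by omega, by omega⟩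
        have hc : Cross b h (Brick.initialTree b h) x y :=
          ⟨by omega, hy, fun hc => by have := hc.2.2; omega⟩
        have := lW_succ_of_cross hy hc
        rwa [lW, lW, show x + 1 + b - y = x + b - y + 1 by omega] at this
      obtain ⟨l, rfl⟩ : ∃ k, l = k + 1 := ⟨l - 1, by omega⟩
      rcases lt_trichotomy (l + 1) (x + b - h x) with h1 | h1 | h1
      · rw [hhigh l (by omega) (by omega), hhigh (l + 1) (by omega) h1]
        exact ih' _ _ (by omega) (by omega)
      · rw [hhigh l (by omega) (by omega), hlow (l + 1 + 1) (by omega)]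
        exact ih' _ _ (by omega) (by omega)
      · rw [hlow (l + 1) (by omega), hlow (l + 1 + 1) (by omega)]
        exact ih' _ _ (by omega) (by omega)

/-- The southern label entered the column from the west at its lowest point, hence at a larger level
than the western label. This makes the complement of the initial tree reduced. -/
theorem initialTree_lW_lt_lS (g : GridTree a b h T) {x y : ℕ}
    (hc : Cross b h (Brick.initialTree b h) x y) :
    lW b (Cross b h (Brick.initialTree b h)) x y < lS b (Cross b h (Brick.initialTree b h)) x y := by
  obtain ⟨h1, h2, h3⟩ := hc
  have h4 : ¬ (x = 0 ∨ y = h x) := fun hc => h3 ⟨h1, h2, hc⟩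
  have hn : ¬ Cross b h (Brick.initialTree b h) x (h x) :=
    not_cross_of_mem ⟨le_rfl, by omega, Or.inr rfl⟩
  rw [lS_eq_lW h2 hn (by omega) fun z h5 h6 => ⟨h5.le, by omega, fun hz => by
    have := hz.2.2; omega⟩]
  have hx : x ≤ a := (g.le_iff x).1 (h1.trans h2)
  have key : ∀ l l', x ≤ l → l < l' → gs b (Cross b h (Brick.initialTree b h)) x 0 l
      < gs b (Cross b h (Brick.initialTree b h)) x 0 l' := by
    intro l l' h1 h2
    induction l', h2 using Nat.le_induction with
    | base => exact g.initialTree_gs_lt hx h1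
    | succ l' h2 ih2 => exact ih2.trans (g.initialTree_gs_lt hx (by omega))
  exact key _ _ (by omega) (by omega)

/-- Each column after the first has exactly one node with a node to its west, and each row has
exactly one node without. -/
theorem card_eq (g : GridTree a b h T) {S : Finset (ℕ × ℕ)} (hS : ∀ p, p ∈ S ↔ T p.1 p.2) :
    S.card = a + b + 1 := by
  classical
  rw [← Finset.card_filter_add_card_filter_not (fun p : ℕ × ℕ => ∃ x' < p.1, T x' p.2)]
  have h1 : (S.filter fun p : ℕ × ℕ => ∃ x' < p.1, T x' p.2).card = (Finset.Icc 1 a).card := by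
    refine Finset.card_bij (fun p _ => p.1) ?_ ?_ ?_
    · rintro ⟨x, y⟩ hp
      simp only [Finset.mem_filter, hS] at hp
      obtain ⟨hT, x', hx', -⟩ := hp
      exact Finset.mem_Icc.2 ⟨by omega, g.x_le hT⟩
    · rintro ⟨x, y⟩ hp ⟨x', y'⟩ hp' (rfl : x = x')
      simp only [Finset.mem_filter, hS] at hp hp'
      obtain ⟨hT, z, hz, hTz⟩ := hp
      obtain ⟨hT', z', hz', hTz'⟩ := hp'
      rcases lt_trichotomy y y' with h1 | rfl | h1
      · exact (g.not_north_west hT hT' h1 hTz hz).elim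
      · rfl
      · exact (g.not_north_west hT' hT h1 hTz' hz').elim
    · intro x hx
      obtain ⟨h1, h2⟩ := Finset.mem_Icc.1 hx
      obtain ⟨y, x₁, -, h3, h4, h5, -⟩ := g.exists_top h1 ((g.le_iff x).2 h2)
      exact ⟨(x, y), Finset.mem_filter.2 ⟨(hS _).2 h5, x₁, h3, h4⟩, rfl⟩
  have h2 : (S.filter fun p : ℕ × ℕ => ¬ ∃ x' < p.1, T x' p.2).card
      = (Finset.range (b + 1)).card := by
    refine Finset.card_bij (fun p _ => p.2) ?_ ?_ ?_
    · rintro ⟨x, y⟩ hp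
      simp only [Finset.mem_filter, hS] at hp
      exact Finset.mem_range.2 (Nat.lt_succ_of_le (g.mem hp.1).2)
    · rintro ⟨x, y⟩ hp ⟨x', y'⟩ hp' (rfl : y = y')
      simp only [Finset.mem_filter, hS] at hp hp'
      rcases lt_trichotomy x x' with h1 | rfl | h1
      · exact absurd ⟨x, h1, hp.1⟩ hp'.2
      · rfl
      · exact absurd ⟨x', h1, hp'.1⟩ hp.2
    · intro y hy
      rcases eq_or_lt_of_le (Nat.lt_succ_iff.1 (Finset.mem_range.1 hy)) with rfl | hy
      · exact ⟨(0, y), Finset.mem_filter.2 ⟨(hS _).2 g.root_mem, by simp⟩, rfl⟩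
      · obtain ⟨x, -, -, -, h3, h4, -⟩ := g.exists_first hy
        exact ⟨(x, y), Finset.mem_filter.2 ⟨(hS _).2 h3, fun ⟨x', h5, h6⟩ => h4 x' h5 h6⟩, rfl⟩
  rw [h1, h2, Nat.card_Icc, Finset.card_range]
  omega

end GridTree
end

/-! ## The diagram of a lattice path -/

section
variable {ν : List Step}

theorem endpoint_append (l l' : List Step) : endpoint (l ++ l') = endpoint l + endpoint l' := by
  simp [endpoint]

theorem endpoint_take_le {j k : ℕ} (h : j ≤ k) :
    endpoint (ν.take j) ≤ endpoint (ν.take k) := by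
  obtain ⟨i, rfl⟩ := Nat.exists_eq_add_of_le h
  rw [List.take_add, endpoint_append]
  exact le_self_add

theorem endpoint_take_succ_fst_le (k : ℕ) :
    (endpoint (ν.take (k + 1))).1 ≤ (endpoint (ν.take k)).1 + 1 := by
  rw [List.take_add, endpoint_append]
  have : ∀ l : List Step, l.length ≤ 1 → (endpoint l).1 ≤ 1 := by
    intro l hl
    match l, hl with
    | [], _ => simp [endpoint]
    | [.E], _ => simp [endpoint, Step.vec]
    | [.N], _ => simp [endpoint, Step.vec]
  have := this ((ν.drop k).take 1) (by simp)
  simp only [Prod.fst_add]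
  omega

theorem exists_endpoint_fst_eq {v k : ℕ} (h : v ≤ (endpoint (ν.take k)).1) :
    ∃ j ≤ k, (endpoint (ν.take j)).1 = v := by
  induction k with
  | zero => exact ⟨0, le_rfl, by simp [endpoint] at h ⊢; omega⟩
  | succ k ih =>
    by_cases hv : v ≤ (endpoint (ν.take k)).1
    · obtain ⟨j, h1, h2⟩ := ih hv
      exact ⟨j, by omega, h2⟩
    · exact ⟨k + 1, le_rfl, by have := endpoint_take_succ_fst_le (ν := ν) k; omega⟩

/-- The height of the lowest point of a column of the diagram of `ν`. -/
def height (ν : List Step) (x : ℕ) : ℕ :=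
  if x ≤ (endpoint ν).1 then
    sInf {y | ∃ k ≤ ν.length, (endpoint (ν.take k)).1 = x ∧ (endpoint (ν.take k)).2 = y}
  -- This value makes the columns beyond the rectangle empty, as `GridTree.le_iff` requires.
  else (endpoint ν).2 + 1

theorem height_le_of_eq {x k : ℕ} (hk : k ≤ ν.length) (hx : (endpoint (ν.take k)).1 = x) :
    height ν x ≤ (endpoint (ν.take k)).2 := by
  have := endpoint_take_le (ν := ν) hk
  rw [List.take_length] at this
  rw [height, if_pos (hx ▸ this.1)]
  exact Nat.sInf_le ⟨k, hk, hx, rfl⟩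

theorem exists_height {x : ℕ} (hx : x ≤ (endpoint ν).1) :
    ∃ k ≤ ν.length, (endpoint (ν.take k)).1 = x ∧ (endpoint (ν.take k)).2 = height ν x := by
  rw [height, if_pos hx]
  refine Nat.sInf_mem (s := {y | ∃ k ≤ ν.length, (endpoint (ν.take k)).1 = x ∧
    (endpoint (ν.take k)).2 = y}) ?_
  obtain ⟨k, h1, h2⟩ := exists_endpoint_fst_eq (ν := ν) (k := ν.length)
    (hx.trans (by rw [List.take_length]))
  exact ⟨_, k, h1, h2, rfl⟩

theorem height_le_iff (x : ℕ) : height ν x ≤ (endpoint ν).2 ↔ x ≤ (endpoint ν).1 := by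
  by_cases hx : x ≤ (endpoint ν).1
  · obtain ⟨k, h1, -, h3⟩ := exists_height hx
    have := endpoint_take_le (ν := ν) h1
    rw [List.take_length] at this
    exact ⟨fun _ => hx, fun _ => h3 ▸ this.2⟩
  · rw [height, if_neg hx]
    omega

theorem height_zero : height ν 0 = 0 := by
  have := height_le_of_eq (ν := ν) (x := 0) (Nat.zero_le _) (by simp [endpoint])
  simpa [endpoint] using this

theorem height_mono : Monotone (height ν) := by
  intro x x' hxx
  by_cases hx : x' ≤ (endpoint ν).1
  · obtain ⟨k, h1, h2, h3⟩ := exists_height hx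
    obtain ⟨j, h4, h5⟩ := exists_endpoint_fst_eq (ν := ν) (v := x) (k := k) (by omega)
    rw [← h3]
    exact (height_le_of_eq (h4.trans h1) h5).trans (endpoint_take_le h4).2
  · rw [height.eq_1 ν x', if_neg hx]
    by_cases hx : x ≤ (endpoint ν).1
    · exact ((height_le_iff x).2 hx).trans (Nat.le_succ _)
    · rw [height, if_neg hx]

theorem mem_pts {p : Pt} : p ∈ pts ν ↔ height ν p.x ≤ p.y ∧ p.y ≤ (endpoint ν).2 := by
  have h0 : p ∈ pts ν ↔ (p.x ≤ (endpoint ν).1 ∧ p.y ≤ (endpoint ν).2) ∧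
      ∃ k ≤ ν.length, (endpoint (ν.take k)).1 = p.x ∧ (endpoint (ν.take k)).2 ≤ p.y := by
    simp only [pts, Finset.mem_filter, Finset.mem_map_equiv, Finset.mem_product,
      Finset.mem_range, Nat.lt_succ_iff]
    rfl
  rw [h0]
  constructor
  · rintro ⟨⟨-, h2⟩, k, h3, h4, h5⟩
    exact ⟨(height_le_of_eq h3 h4).trans h5, h2⟩
  · rintro ⟨h1, h2⟩
    have hx := (height_le_iff p.x).1 (h1.trans h2)
    obtain ⟨k, h3, h4, h5⟩ := exists_height hx
    exact ⟨⟨hx, h2⟩, k, h3, h4, h5 ▸ h1⟩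

/-- The point with coordinates `x` and `y`. -/
abbrev pt (x y : ℕ) : Pt := toLex (x, y)

theorem pt_eta (p : Pt) : pt p.x p.y = p := rfl

local instance : DecidableEq (pts ν) := LinearOrder.toDecidableEq

/-- The relation on coordinates given by a set of points of the diagram. -/
def coordRel (T : Finset (pts ν)) (x y : ℕ) : Prop := ∃ hp : pt x y ∈ pts ν, ⟨pt x y, hp⟩ ∈ T

theorem coordRel_iff {T : Finset (pts ν)} (p : pts ν) : coordRel T p.1.x p.1.y ↔ p ∈ T :=
  ⟨fun ⟨_, h⟩ => h, fun h => ⟨p.2, h⟩⟩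

/-- Heights are monotone, so the lower right corner of the rectangle decides whether all of it lies
in the diagram. -/
theorem swIncompatible_iff {p q : Pt} (hq : q ∈ pts ν) :
    SWIncompatible ν p q ↔ p.x < q.x ∧ p.y < q.y ∧ height ν q.x ≤ p.y := by
  have hq' := mem_pts.1 hq
  constructor
  · rintro ⟨h1, h2, h3⟩
    exact ⟨h1, h2, (mem_pts.1 (h3 (pt q.x p.y) h1.le le_rfl le_rfl h2.le)).1⟩
  · rintro ⟨h1, h2, h3⟩
    refine ⟨h1, h2, fun r _ h5 h6 h7 => mem_pts.2 ⟨?_, h7.trans hq'.2⟩⟩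
    exact (height_mono h5).trans (h3.trans h6)

theorem IsNuTree.gridTree {T : Finset (pts ν)} (hT : IsNuTree ν T) :
    GridTree (endpoint ν).1 (endpoint ν).2 (height ν) (coordRel T) where
  mono := height_mono
  zero := height_zero
  le_iff := height_le_iff
  mem := fun ⟨hp, _⟩ => mem_pts.1 hp
  compat := by
    rintro x y x' y' ⟨hp, h1⟩ ⟨hp', h2⟩ h3 h4
    by_contra h5
    exact hT.prop _ h1 _ h2 (Or.inl ((swIncompatible_iff hp').2 ⟨h3, h4, not_lt.1 h5⟩))
  maxl := by
    intro x y h1 h2 h3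
    have hp : pt x y ∈ pts ν := mem_pts.2 ⟨h1, h2⟩
    have hnT : (⟨pt x y, hp⟩ : pts ν) ∉ T := fun hc => h3 ⟨hp, hc⟩
    have hmax := hT.not_prop_of_gt (Finset.ssubset_insert hnT)
    by_contra hcon
    push Not at hcon
    have key : ∀ q ∈ T, Compatible ν (pt x y) q := by
      rintro q hq (hc | hc)
      · obtain ⟨h4, h5, h6⟩ := (swIncompatible_iff q.2).1 hc
        exact absurd h6 (hcon.2 q.1.x q.1.y ⟨q.2, hq⟩ h4 h5).not_ge
      · obtain ⟨h4, h5, h6⟩ := (swIncompatible_iff hp).1 hc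
        exact absurd h6 (hcon.1 q.1.x q.1.y ⟨q.2, hq⟩ h4 h5).not_ge
    refine hmax fun p hp q hq => ?_
    rcases Finset.mem_insert.1 hp with rfl | hp <;> rcases Finset.mem_insert.1 hq with rfl | hq
    · rintro (hc | hc) <;> exact lt_irrefl _ hc.1
    · exact key q hq
    · exact fun hc => key p hp hc.symm
    · exact hT.prop p hp q hq

/-! ## The labels of the word of `ν` -/

theorem simpleRefl_val {n : ℕ} (p : Fin n) (l : Fin (n + 1)) :
    (simpleRefl p l : ℕ) = Equiv.swap (p : ℕ) (p + 1) l := by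
  simp only [simpleRefl, Equiv.swap_apply_def, Fin.ext_iff, Fin.val_castSucc, Fin.val_succ]
  split_ifs <;> rfl

/-- Induction along the reading order, in which the filtered set is the initial segment before `(x,
y)`; passing to the next column adds no position. -/
theorem subProd_filter_apply (S : Finset (pts ν)) {x y : ℕ} (hy : y ≤ (endpoint ν).2 + 1)
    (l : Fin (rank ν + 1)) :
    (subProd (wordNu ν) (S.filter fun q => q.1.x < x ∨ (q.1.x = x ∧ q.1.y < y)) l : ℕ)
      = gs (endpoint ν).2 (coordRel S) x y l := by
  have step : ∀ x, (∀ l : Fin (rank ν + 1), (subProd (wordNu ν)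
      (S.filter fun q => q.1.x < x ∨ (q.1.x = x ∧ q.1.y < 0)) l : ℕ)
        = gs (endpoint ν).2 (coordRel S) x 0 l) → ∀ y ≤ (endpoint ν).2 + 1,
      ∀ l : Fin (rank ν + 1), (subProd (wordNu ν)
        (S.filter fun q => q.1.x < x ∨ (q.1.x = x ∧ q.1.y < y)) l : ℕ)
          = gs (endpoint ν).2 (coordRel S) x y l := by
    intro x hx y
    induction y with
    | zero => exact fun _ => hx
    | succ y ih =>
      intro hy l
      have ih := ih (by omega)
      by_cases hS : coordRel S x y
      · obtain ⟨hp, hpS⟩ := hS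
        have e : (S.filter fun q => q.1.x < x ∨ (q.1.x = x ∧ q.1.y < y + 1))
            = insert ⟨pt x y, hp⟩ (S.filter fun q => q.1.x < x ∨ (q.1.x = x ∧ q.1.y < y)) := by
          ext q
          simp only [Finset.mem_filter, Finset.mem_insert]
          constructor
          · rintro ⟨h1, h2⟩
            by_cases h3 : q.1.x = x ∧ q.1.y = y
            · left
              ext
              rw [← pt_eta q.1, h3.1, h3.2]
            · exact Or.inr ⟨h1, by omega⟩
          · rintro (rfl | ⟨h1, h2⟩)
            · exact ⟨hpS, Or.inr ⟨rfl, Nat.lt_succ_self y⟩⟩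
            · exact ⟨h1, by omega⟩
        rw [e, subProd_insert, Equiv.Perm.mul_apply, ih, simpleRefl_val, gs_of_cross ⟨hp, hpS⟩,
          Equiv.Perm.mul_apply]
        · have : ((wordNu ν ⟨pt x y, hp⟩ : Fin (rank ν)) : ℕ) = x + (endpoint ν).2 - y := by
            have := (mem_pts.1 hp).2
            change x + ((endpoint ν).2 - y) = _
            change y ≤ _ at this
            omega
          rw [this]
        · intro q hq
          have h1 := (Finset.mem_filter.1 hq).2
          rw [← Subtype.coe_lt_coe, Prod.Lex.lt_iff]
          exact h1
      · have e : (S.filter fun q => q.1.x < x ∨ (q.1.x = x ∧ q.1.y < y + 1))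
            = (S.filter fun q => q.1.x < x ∨ (q.1.x = x ∧ q.1.y < y)) := by
          refine Finset.filter_congr fun q hq => ?_
          have : ¬ (q.1.x = x ∧ q.1.y = y) := by
            rintro ⟨rfl, rfl⟩
            exact hS ((coordRel_iff q).2 hq)
          omega
        rw [e, ih, gs_of_not_cross hS]
  refine step x ?_ y hy l
  induction x with
  | zero => simp [subProd, gs_zero_zero]
  | succ x ih =>
    intro l
    rw [gs_succ_zero, ← step x ih _ le_rfl]
    congr 3
    refine Finset.filter_congr fun q _ => ?_
    have := (mem_pts.1 q.2).2
    omega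

theorem subProd_apply (S : Finset (pts ν)) (l : Fin (rank ν + 1)) :
    (subProd (wordNu ν) S l : ℕ)
      = gs (endpoint ν).2 (coordRel S) ((endpoint ν).1 + 1) 0 l := by
  rw [← subProd_filter_apply S (Nat.zero_le _), Finset.filter_true_of_mem]
  intro q _
  have h1 := mem_pts.1 q.2
  have := (height_le_iff q.1.x).1 (h1.1.trans h1.2)
  omega

theorem prefixProd_apply (T : Finset (pts ν)) (p : pts ν) (l : Fin (rank ν + 1)) :
    (prefixProd (wordNu ν) T p l : ℕ)
      = gs (endpoint ν).2 (coordRel Tᶜ) p.1.x p.1.y l := by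
  rw [← subProd_filter_apply _ ((mem_pts.1 p.2).2.trans (Nat.le_succ _)), prefixProd]
  congr 3
  ext q
  simp only [Finset.mem_filter, Finset.mem_univ, true_and, Finset.mem_compl]
  rw [← Subtype.coe_lt_coe, Prod.Lex.lt_iff]
  exact and_comm

theorem coordRel_compl (T : Finset (pts ν)) :
    coordRel Tᶜ = Cross (endpoint ν).2 (height ν) (coordRel T) := by
  ext x y
  constructor
  · rintro ⟨hp, h⟩
    exact ⟨(mem_pts.1 hp).1, (mem_pts.1 hp).2, fun ⟨_, h'⟩ => Finset.mem_compl.1 h h'⟩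
  · rintro ⟨h1, h2, h3⟩
    have hp : pt x y ∈ pts ν := mem_pts.2 ⟨h1, h2⟩
    exact ⟨hp, Finset.mem_compl.2 fun h => h3 ⟨hp, h⟩⟩

theorem upLabel_val (p₀ : Fin (rank ν)) (T : Finset (pts ν)) (p : pts ν) :
    (upLabel (nword p₀ (wordNu ν)) (Tᶜ.image enc) (enc p) : ℕ)
      = lW (endpoint ν).2 (Cross (endpoint ν).2 (height ν) (coordRel T)) p.1.x p.1.y := by
  have hy := (mem_pts.1 p.2).2
  rw [upLabel, nword_enc, ← prefixProd_eq_wstate, prefixProd_apply, ← coordRel_compl,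
    ← gs_apply_level hy]
  congr 1
  change p.1.x + ((endpoint ν).2 - p.1.y) = _
  omega

theorem loLabel_val (p₀ : Fin (rank ν)) (T : Finset (pts ν)) (p : pts ν) :
    (loLabel (nword p₀ (wordNu ν)) (Tᶜ.image enc) (enc p) : ℕ)
      = lS (endpoint ν).2 (Cross (endpoint ν).2 (height ν) (coordRel T)) p.1.x p.1.y := by
  have hy := (mem_pts.1 p.2).2
  rw [loLabel, nword_enc, ← prefixProd_eq_wstate, prefixProd_apply, ← coordRel_compl, lS]
  congr 1
  change p.1.x + ((endpoint ν).2 - p.1.y) + 1 = _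
  omega

/-! ### Trees as facets, roots at ascents, separating functionals -/

theorem subProd_compl_eq {T T' : Finset (pts ν)}
    (g : GridTree (endpoint ν).1 (endpoint ν).2 (height ν) (coordRel T))
    (g' : GridTree (endpoint ν).1 (endpoint ν).2 (height ν) (coordRel T')) :
    subProd (wordNu ν) Tᶜ = subProd (wordNu ν) T'ᶜ := by
  ext l
  rw [subProd_apply, subProd_apply, coordRel_compl, coordRel_compl, g.gs_final_eq g']

theorem card_of_gridTree {T : Finset (pts ν)}
    (g : GridTree (endpoint ν).1 (endpoint ν).2 (height ν) (coordRel T)) :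
    T.card = (endpoint ν).1 + (endpoint ν).2 + 1 := by
  have hinj : Function.Injective fun p : pts ν => (p.1.x, p.1.y) := fun p q h => by
    ext
    exact congrArg toLex h
  rw [← g.card_eq (S := T.map ⟨_, hinj⟩) ?_, Finset.card_map]
  · rintro ⟨x, y⟩
    rw [Finset.mem_map]
    constructor
    · rintro ⟨p, hp, e⟩
      obtain ⟨rfl, rfl⟩ := Prod.ext_iff.1 e
      exact (coordRel_iff p).2 hp
    · rintro ⟨hp, h⟩
      exact ⟨_, h, rfl⟩

theorem permNu_eq {T : Finset (pts ν)} (hT : IsNuTree ν T) :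
    permNu ν = subProd (wordNu ν) Tᶜ := by
  have := subProd_compl_eq (Classical.choose_spec (exists_isNuTree ν)).gridTree hT.gridTree
  rw [← this, permNu]
  congr 1

/-- The product and the number of letters of the complement are the same for all trees, so it
suffices that the initial tree gives a reduced word. -/
theorem IsNuTree.isFacet (p₀ : Fin (rank ν)) {T : Finset (pts ν)} (hT : IsNuTree ν T) :
    IsFacet (wordNu ν) (permNu ν) T := by
  classical
  obtain ⟨T₀, hT₀⟩ : ∃ T₀ : Finset (pts ν),
      coordRel T₀ = initialTree (endpoint ν).2 (height ν) := by
    refine ⟨Finset.univ.filter fun p => initialTree (endpoint ν).2 (height ν) p.1.x p.1.y, ?_⟩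
    ext x y
    constructor
    · rintro ⟨hp, h⟩
      exact (Finset.mem_filter.1 h).2
    · intro h
      have hp : pt x y ∈ pts ν := mem_pts.2 ⟨h.1, h.2.1⟩
      exact ⟨hp, Finset.mem_filter.2 ⟨Finset.mem_univ _, h⟩⟩
  have g := hT.gridTree
  have g₀ := g.initialTree
  rw [← hT₀] at g₀
  have hred : Red (nword p₀ (wordNu ν)) (T₀ᶜ.image enc) (Fintype.card (pts ν)) := by
    intro i hi _
    obtain ⟨p, hp, rfl⟩ := Finset.mem_image.1 hi
    rw [Fin.lt_def, upLabel_val, loLabel_val, hT₀]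
    refine g.initialTree_lW_lt_lS ?_
    rw [← hT₀, ← coordRel_compl, coordRel_iff]
    exact hp
  have hlen := hred.card_eq_len (image_enc_subset _)
  rw [← subProd_eq_wstate, Finset.card_image_of_injective _ enc_injective,
    subProd_compl_eq g₀ g] at hlen
  rw [permNu_eq hT]
  refine ⟨rfl, ?_⟩
  rw [← hlen, Finset.card_compl, Finset.card_compl, card_of_gridTree g, card_of_gridTree g₀]

/-- The labels at an ascent also cross in the same orientation, and in a reduced word a crossed pair
stays inverted up to the final product. -/
theorem IsNuTree.invRoots (p₀ : Fin (rank ν)) {T A : Finset (pts ν)} (hT : IsNuTree ν T)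
    (hA : ∀ a ∈ A, IsAscent ν T a) : InvRoots (wordNu ν) (permNu ν) T A := by
  intro p hp
  obtain ⟨hpT, ⟨q, hq, hqx, hqy⟩, ⟨r, hr, hry, hrx⟩⟩ := hA p hp
  have hq' := (coordRel_iff q).2 hq
  have hr' := (coordRel_iff r).2 hr
  rw [hqx] at hq'
  rw [hry] at hr'
  obtain ⟨x, y, hc, h1, h2⟩ := hT.gridTree.exists_cross_of_ascent ((coordRel_iff p).2 hpT) hq' hqy
    hr' hrx
  rw [← coordRel_compl] at hc
  obtain ⟨hk, hkT⟩ := hc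
  have hF := (isFacet_iff p₀ _ _ _).1 (hT.isFacet p₀)
  refine ⟨_, _, rootFun_eq p₀ _ _ _, ?_⟩
  have hk' := (mem_image_enc (S := Tᶜ) (k := (⟨pt x y, hk⟩ : pts ν))).2 hkT
  have hu : upLabel (nword p₀ (wordNu ν)) (Tᶜ.image enc) (enc (⟨pt x y, hk⟩ : pts ν))
      = upLabel (nword p₀ (wordNu ν)) (Tᶜ.image enc) (enc p) := by
    ext
    rw [upLabel_val, upLabel_val]
    exact h1
  have hl : loLabel (nword p₀ (wordNu ν)) (Tᶜ.image enc) (enc (⟨pt x y, hk⟩ : pts ν))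
      = loLabel (nword p₀ (wordNu ν)) (Tᶜ.image enc) (enc p) := by
    ext
    rw [loLabel_val, loLabel_val]
    exact h2
  have := hF.red.stays (show enc (⟨pt x y, hk⟩ : pts ν) + 1 ≤ _ from enc_lt _) le_rfl
    (hF.red _ hk' (enc_lt _)) (inv_succ_of_mem hk')
  rwa [hF.prod, hu, hl] at this

theorem IsNuTree.exists_separates (p₀ : Fin (rank ν)) {T A : Finset (pts ν)} (hT : IsNuTree ν T)
    (hA : ∀ a ∈ A, IsAscent ν T a) : ∃ f, Separates ν T A f := by
  obtain ⟨φ, hφ⟩ := hT.gridTree.exists_values (A := coordRel A)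
    (fun x y ⟨hp, h⟩ => by
      obtain ⟨-, -, r, hr, hry, hrx⟩ := hA _ h
      have := (coordRel_iff r).2 hr
      rw [hry] at this
      exact ⟨_, hrx, this⟩)
    (fun x y ⟨hp, h⟩ => by
      obtain ⟨-, ⟨q, hq, hqx, hqy⟩, -⟩ := hA _ h
      have := (coordRel_iff q).2 hq
      rw [hqx] at this
      exact ⟨_, hqy, this⟩)
  let f : (Fin (rank ν + 1) → ℝ) →ₗ[ℝ] ℝ := ∑ i : Fin (rank ν + 1), φ i • LinearMap.proj i
  have hf : ∀ i : Fin (rank ν + 1), f (Pi.single i 1) = φ i := by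
    intro i
    simp only [f, LinearMap.sum_apply, LinearMap.smul_apply, LinearMap.proj_apply, smul_eq_mul,
      Pi.single_apply]
    simp
  have hroot : ∀ p : pts ν, f (rootFun (wordNu ν) T p)
      = φ (lW (endpoint ν).2 (Cross (endpoint ν).2 (height ν) (coordRel T)) p.1.x p.1.y)
        - φ (lS (endpoint ν).2 (Cross (endpoint ν).2 (height ν) (coordRel T)) p.1.x p.1.y) := by
    intro p
    rw [map_rootFun p₀, hf, hf, upLabel_val, loLabel_val]
  have hval : ∀ p ∈ T, _ := fun p hp => hφ p.1.x
    (Nat.lt_succ_of_le (hT.gridTree.x_le ((coordRel_iff p).2 hp))) p.1.y ((coordRel_iff p).2 hp)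
  refine ⟨f, fun a ha => ?_, fun t ht => ?_⟩
  · rw [hroot, sub_eq_zero]
    exact (hval a (hA a ha).1).1 ((coordRel_iff a).2 ha)
  · obtain ⟨h1, h2⟩ := Finset.mem_sdiff.1 ht
    rw [hroot, sub_pos]
    exact (hval t h1).2 fun hc => h2 ((coordRel_iff t).1 hc)

end
end Brick
end

/-! ### The proposition -/

theorem mainTheorem6 (ν : List Brick.Step) (T A : Finset (Brick.pts ν))
    (hT : Brick.IsNuTree ν T) (hA : ∀ a ∈ A, Brick.IsAscent ν T a) :
    Brick.IsFace (Brick.nuBrickPolyhedron ν)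
        (Brick.modifiedBrickPolyhedron (Brick.wordNu ν) (Brick.permNu ν) (T \ A)) ∧
      (∃ f, Brick.Separates ν T A f) ∧
      ∀ f, Brick.Separates ν T A f →
        Brick.minFace (Brick.nuBrickPolyhedron ν) f =
          Brick.modifiedBrickPolyhedron (Brick.wordNu ν) (Brick.permNu ν) (T \ A) := by
  have p₀ : Fin (Brick.rank ν) := ⟨0, Nat.succ_pos _⟩
  have hF := hT.isFacet p₀
  have hmin : ∀ f, Brick.Separates ν T A f →
      Brick.minFace (Brick.nuBrickPolyhedron ν) f =
        Brick.modifiedBrickPolyhedron (Brick.wordNu ν) (Brick.permNu ν) (T \ A) := fun f hf =>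
    Brick.minFace_brickPolyhedron p₀ hF hf.1 hf.2 (hT.invRoots p₀ hA)
  obtain ⟨f, hf⟩ := hT.exists_separates p₀ hA
  exact ⟨⟨Brick.modifiedBrickPolyhedron_nonempty hF Finset.sdiff_subset, f, (hmin f hf).symm⟩,
    ⟨f, hf⟩, hmin⟩
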